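/- **Model.** For $N\ge 1$ identify $[N]$ with the basis states of a register of $\lceil\log_2 N\rceil$ qubits. Fix $c$ and a $c$-bit number format (each $c$-bit string stands for a non-negative real); the input is a vector $w\in\mathbb R_{\ge 0}^N$ whose coordinates are given by $c$-bit strings. The elementary gates are CNOT, all one-qubit gates, the indicator gates $\mathbb 1_H:|i\rangle|b\rangle\mapsto|i\rangle|b\oplus[i\notin H]\rangle$ for $H\subseteq[N]$, the query gate $\mathcal O_w:|v\rangle|i\rangle\mapsto|v\oplus w_i\rangle|i\rangle$, and the rotation gates $\mathrm{Rot}_h$ for real $h\ge 0$ (possibly with one more control qubit), which for $h>0$ and $0\le v\le h$ map $|0\rangle|v\rangle\mapsto\big(\sqrt{v/h}\,|0\rangle+\sqrt{1-v/h}\,|1\rangle\big)|v\rangle$ and $|1\rangle|v\rangle\mapsto\big(\sqrt{v/h}\,|1\rangle-\sqrt{1-v/h}\,|0\rangle\big)|v\rangle$, and are the identity otherwise. A quantum algorithm adaptively runs such circuits on $|\vec 0\rangle$, measures them, and processes the outcomes classically; its query complexity is the maximal number of query gates that it executes. Write $\|w\|_1=\sum_i w_i$ and $|w\rangle=\|w\|_1^{-1/2}\sum_i\sqrt{w_i}\,|i\rangle$.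 **Algorithm 1** (input $K$, $\delta$ and query access to $w$). (1) Compute a set $H$ of positions of $K$ largest entries of $w$ by a quantum top-$K$ maximum finding algorithm with failure probability at most $\delta$. (2) Read the values $w_i$, $i\in H$, and let $h=\min_{i\in H}w_i$ and $Z=(N-K)h+\sum_{i\in H}w_i$. (3) Construct a circuit $\mathcal D$, without queries, with $\mathcal D|\vec 0\rangle=\sum_{i\in H}\sqrt{w_i/Z}\,|i\rangle+\sum_{i\notin H}\sqrt{h/Z}\,|i\rangle$ on a register $\mathrm{out}$. (4) Output the circuit $\mathcal C$ that applies, in this order, $\mathcal D$, the gate $\mathbb 1_H$ from $\mathrm{out}$ to a qubit $\mathrm{ind}$, the query $\mathcal O_w$ from $\mathrm{out}$ to a register $\mathrm{qry}$, the gate $\mathrm{Rot}_h$ from $\mathrm{qry}$ to a qubit $\mathrm{rot}$ controlled by $\mathrm{ind}$, then $\mathcal O_w$ and $\mathbb 1_H$ again. **Theorem (preprocessing phase).** The subroutines of steps (1) and (3) can be chosen such that the following holds for all integers $1\le K\le N$, all $\delta\in(0,1)$ and all non-zero $w$ as above. With probability at least $1-\delta$, Algorithm 1 outputs the description of a quantum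 circuit $\mathcal C$ that maps $|\vec 0\rangle$ to $$\sqrt{p_w}\,|w\rangle_{\mathrm{out}}|0\rangle_{\mathrm{rot}}+\sqrt{1-p_w}\,|w^\perp\rangle_{\mathrm{out}}|1\rangle_{\mathrm{rot}}$$ (all other qubits being in state $|0\rangle$), where $K/N\le p_w\le 1$ and $|w^\perp\rangle$ is some unit state, that performs exactly two queries to $w$, and that has $O(K(1+\log N))$ elementary gates. The key inequality is that $\min_{i\in H}w_i\le\|w\|_1/K$ for every set $H$ of positions of $K$ largest entries of $w$. Algorithm 1 performs $O\big(\sqrt{KN}\,(1+\log(1/\delta))\big)$ queries to $w$, with a universal constant, and the number of elementary gates that it executes is larger than this query bound by at most a factor polylogarithmic in $N$ (for fixed $c$). -/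

import Mathlib

open scoped NNReal

noncomputable section

namespace StatePrep

/-! ### Registers and numbers -/

/-- Contents of a register of `c` qubits in the computational basis. -/
abbrev Bits (c : ℕ) : Type := Fin c → Bool

/-- The number of qubits of a register that holds an index in `[N]`. -/
abbrev idxLen (N : ℕ) : ℕ := Nat.clog 2 N

/-- The binary encoding of an index. The indices are `0, …, N - 1`. -/
def encode {N : ℕ} (i : Fin N) : Bits (idxLen N) := fun j => (i : ℕ).testBit j

/-- A `c`-bit number format: the non-negative real that each `c`-bit string stands for. -/
abbrev Format (c : ℕ) : Type := Bits c → ℝ≥0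

/-- The vector `w` whose coordinates are given by `c`-bit strings. -/
def vec {N c : ℕ} (val : Format c) (x : Fin N → Bits c) : Fin N → ℝ≥0 := fun i => val (x i)

/-! ### Gates -/

/-- Elementary gates on a finite set `W` of qubits ("wires"): all one-qubit gates, CNOT, the
indicator gate of a set `S ⊆ [N]`, the query gate, the rotation gate of a real `h`, and the
rotation gate with one additional control qubit. Side conditions say that wires are distinct. -/
inductive Gate (N c : ℕ) (W : Type) : Type
  | one (U : Matrix.unitaryGroup Bool ℂ) (q : W)
  | cnot (ctl q : W) (hq : ctl ≠ q)
  | ind (S : Finset (Fin N)) (i : Fin (idxLen N) ↪ W) (b : W) (hb : ∀ k, i k ≠ b)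
  | query (v : Fin c ↪ W) (i : Fin (idxLen N) ↪ W) (hvi : ∀ j k, v j ≠ i k)
  | rot (h : ℝ≥0) (b : W) (v : Fin c ↪ W) (hb : ∀ j, v j ≠ b)
  | crot (h : ℝ≥0) (ctl b : W) (v : Fin c ↪ W) (hb : ∀ j, v j ≠ b) (hctl : ctl ≠ b)
      (hv : ∀ j, v j ≠ ctl)

/-- A circuit is a list of gates, the first gate being applied first. -/
abbrev Circuit (N c : ℕ) (W : Type) : Type := List (Gate N c W)

/-- Vectors of amplitudes over the computational basis of the qubits `W`. -/
abbrev State (W : Type) : Type := (W → Bool) → ℂ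

open Classical in
/-- The computational basis state `|y⟩`. -/
def basisState {W : Type} (y : W → Bool) : State W := fun z => if z = y then 1 else 0

/-- The Pauli matrix `X` (NOT). -/
def pauliX : Matrix Bool Bool ℂ := fun a b => if a = b then 0 else 1

theorem pauliX_mem : pauliX ∈ Matrix.unitaryGroup Bool ℂ := by
  rw [Matrix.mem_unitaryGroup_iff]
  ext a b
  cases a <;> cases b <;>
    simp [pauliX, Matrix.mul_apply, Matrix.star_apply]

/-- The rotation applied to the target qubit when the value register contains `v`. For
`0 ≤ v ≤ h` with `h > 0` it maps `|0⟩` to `√(v/h) |0⟩ + √(1 - v/h) |1⟩` and `|1⟩` to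
`√(v/h) |1⟩ - √(1 - v/h) |0⟩`; otherwise it is the identity. Rows are outputs. -/
def rotMatrix (h v : ℝ≥0) : Matrix Bool Bool ℂ :=
  if 0 < h ∧ v ≤ h then
    fun a b =>
      if a = b then ((Real.sqrt ((v : ℝ) / h) : ℝ) : ℂ)
      else if b then -((Real.sqrt (1 - (v : ℝ) / h) : ℝ) : ℂ)
      else ((Real.sqrt (1 - (v : ℝ) / h) : ℝ) : ℂ)
  else 1

section Semantics

variable {N c : ℕ} {W : Type} [DecidableEq W]

/-- Apply to the qubit `q` the one-qubit matrix `M y`, which may depend on the contents `y` of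
the other qubits. -/
def onWire (q : W) (M : (W → Bool) → Matrix Bool Bool ℂ) (ψ : State W) : State W :=
  fun y => ∑ b : Bool, M y (y q) b * ψ (Function.update y q b)

/-- The encoded entry read by a query at the index register's contents (all zeros when these
contents are not the encoding of an index). -/
def entryAt (x : Fin N → Bits c) (k : Bits (idxLen N)) : Bits c :=
  if h : Nat.ofBits k < N then x ⟨Nat.ofBits k, h⟩ else fun _ => false

/-- The action `|v⟩|i⟩ ↦ |v ⊕ wᵢ⟩|i⟩` of the query gate on basis states (an involution). -/
def queryMap (x : Fin N → Bits c) (v : Fin c ↪ W) (i : Fin (idxLen N) ↪ W)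
    (y : W → Bool) : W → Bool :=
  fun q => xor (y q) (decide (∃ j, v j = q ∧ entryAt x (y ∘ i) j = true))

/-- The action of a gate on states, for the number format `val` and the input `x`. -/
def Gate.apply (val : Format c) (x : Fin N → Bits c) : Gate N c W → State W → State W
  | .one U q, ψ => onWire q (fun _ => (U : Matrix Bool Bool ℂ)) ψ
  | .cnot ctl q _, ψ => onWire q (fun y => if y ctl then pauliX else 1) ψ
  | .ind S i b _, ψ => onWire b (fun y => if ∃ s ∈ S, y ∘ i = encode s then 1 else pauliX) ψ
  | .query v i _, ψ => fun y => ψ (queryMap x v i y)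
  | .rot h b v _, ψ => onWire b (fun y => rotMatrix h (val (y ∘ v))) ψ
  | .crot h ctl b v _ _ _, ψ =>
      onWire b (fun y => if y ctl then rotMatrix h (val (y ∘ v)) else 1) ψ

/-- The state produced by a circuit on the input `|0…0⟩`. -/
def output (val : Format c) (x : Fin N → Bits c) (C : Circuit N c W) : State W :=
  C.foldl (fun ψ g => g.apply val x ψ) (basisState (fun _ => false))

/-- Is this gate a query gate? -/
def Gate.isQuery : Gate N c W → Bool
  | .query _ _ _ => true
  | _ => false

/-- The number of queries performed by a circuit. -/
def queryCount (C : Circuit N c W) : ℕ := C.countP Gate.isQuery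

/-- The set of the wires on which a gate operates. -/
def Gate.wires : Gate N c W → Set W
  | .one _ q => {q}
  | .cnot ctl q _ => {ctl, q}
  | .ind _ i b _ => Set.range i ∪ {b}
  | .query v i _ => Set.range v ∪ Set.range i
  | .rot _ b v _ => {b} ∪ Set.range v
  | .crot _ ctl b v _ _ _ => {ctl, b} ∪ Set.range v

end Semantics

/-! ### Quantum query algorithms -/

/-- A quantum query algorithm with classical control and output in `α`: either it stops and
returns a value, or it runs a circuit on `|0…0⟩`, measures all qubits in the computational basis,
and continues depending on the outcome. The input `x` is accessed only through query gates. -/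
inductive Algo (N c : ℕ) (α : Type) : Type 1
  | ret (a : α) : Algo N c α
  | run (W : Type) [Fintype W] [DecidableEq W] (C : Circuit N c W)
      (next : (W → Bool) → Algo N c α) : Algo N c α

namespace Algo

variable {N c : ℕ} {α β : Type}

/-- Sequential composition. -/
def bind : Algo N c α → (α → Algo N c β) → Algo N c β
  | ret a, f => f a
  | run W C next, f => run W C (fun y => bind (next y) f)

open Classical in
/-- The probability that the output satisfies `P`, when the input is `x`. -/
def prob (val : Format c) (x : Fin N → Bits c) (P : α → Prop) : Algo N c α → ℝ
  | ret a => if P a then 1 else 0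
  | run W C next => ∑ y : W → Bool, ‖output val x C y‖ ^ 2 * prob val x P (next y)

/-- The maximal number of queries over all sequences of measurement outcomes. -/
def queries : Algo N c α → ℕ
  | ret _ => 0
  | run W C next => queryCount C + Finset.univ.sup (fun y : W → Bool => queries (next y))

/-- The maximal number of elementary gates executed, over all sequences of measurement outcomes. -/
def gates : Algo N c α → ℕ
  | ret _ => 0
  | run W C next => C.length + Finset.univ.sup (fun y : W → Bool => gates (next y))

/-- Read the entry `i` with one query. -/
def readEntry (i : Fin N) : Algo N c (Bits c) :=
  run (Fin c ⊕ Fin (idxLen N))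
    (((List.finRange (idxLen N)).filter (fun j => encode i j)).map
        (fun j => Gate.one ⟨pauliX, pauliX_mem⟩ (Sum.inr j)) ++
      [Gate.query Function.Embedding.inl Function.Embedding.inr (fun _ _ => Sum.inl_ne_inr)])
    (fun y => ret (fun j => y (Sum.inl j)))

/-- Read all entries at the listed positions; the result is zero at the other positions. -/
def readList : List (Fin N) → Algo N c (Fin N → Bits c)
  | [] => ret (fun _ _ => false)
  | i :: l => bind (readEntry i) (fun b => bind (readList l) (fun r => ret (Function.update r i b)))

end Algo

/-! ### The circuit output by the preprocessing phase -/

/-- The qubits of the output circuit: `rot` and `ind` are single qubits, `qry` stores a number,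
`out` stores an index, and `anc` are `a` ancillary qubits. -/
inductive Wire (n c a : ℕ) : Type
  | rot
  | ind
  | qry (j : Fin c)
  | out (j : Fin n)
  | anc (j : Fin a)
  deriving DecidableEq, Fintype

section Output

variable {N c a : ℕ}

/-- The register `qry`. -/
def qryReg {n c a : ℕ} : Fin c ↪ Wire n c a := ⟨Wire.qry, fun _ _ h => by injection h⟩

/-- The register `out`. -/
def outReg {n c a : ℕ} : Fin n ↪ Wire n c a := ⟨Wire.out, fun _ _ h => by injection h⟩

/-- Basis contents: index `i` in `out`, bit `b` in `rot`, and zeros elsewhere. -/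
def basis (c a : ℕ) (i : Fin N) (b : Bool) : Wire (idxLen N) c a → Bool
  | .rot => b
  | .ind => false
  | .qry _ => false
  | .out j => encode i j
  | .anc _ => false

/-- The state `|φ⟩_out |b⟩_rot`, all other qubits being in state `|0⟩`. -/
def ket (c a : ℕ) (φ : Fin N → ℂ) (b : Bool) : State (Wire (idxLen N) c a) :=
  ∑ i, φ i • basisState (basis c a i b)

/-- The amplitudes of `|w⟩ = ‖w‖₁^(-1/2) ∑ᵢ √wᵢ |i⟩`. -/
def amplitudes (w : Fin N → ℝ≥0) : Fin N → ℂ :=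
  fun i => ((Real.sqrt ((w i : ℝ) / ∑ j, (w j : ℝ)) : ℝ) : ℂ)

/-- `H` is a set of positions of `K` largest entries of `w`. -/
def IsTop (K : ℕ) (w : Fin N → ℝ≥0) (H : Finset (Fin N)) : Prop :=
  H.card = K ∧ ∀ i ∈ H, ∀ j ∉ H, w j ≤ w i

/-- The minimum of `w` over `H` (and `0` if `H` is empty). -/
def minOn (w : Fin N → ℝ≥0) (H : Finset (Fin N)) : ℝ≥0 :=
  if h : H.Nonempty then H.inf' h w else 0

/-- The vector equal to `w` on `H` and to `min_H w` outside `H`; the sum of its coordinates is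
`(N - |H|) min_H w + ∑_{i ∈ H} wᵢ`. -/
def flatten (w : Fin N → ℝ≥0) (H : Finset (Fin N)) : Fin N → ℝ≥0 :=
  fun i => if i ∈ H then w i else minOn w H

/-- The circuit built from a first stage `D`: the gates `ind_H`, query, `Rot_h` controlled by the
qubit `ind`, query, `ind_H` follow `D`. -/
def mainCircuit (D : Circuit N c (Wire (idxLen N) c a)) (H : Finset (Fin N)) (h : ℝ≥0) :
    Circuit N c (Wire (idxLen N) c a) :=
  D ++
    [ Gate.ind H outReg Wire.ind (fun _ e => by injection e),
      Gate.query qryReg outReg (fun _ _ e => by injection e),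
      Gate.crot h Wire.ind Wire.rot qryReg (fun _ e => by injection e) (fun e => by injection e)
        (fun _ e => by injection e),
      Gate.query qryReg outReg (fun _ _ e => by injection e),
      Gate.ind H outReg Wire.ind (fun _ e => by injection e) ]

/-- A top-`K` maximum finding algorithm with failure probability at most `δ`. -/
def FindsTop (val : Format c) (K : ℕ) (δ : ℝ) (A : Algo N c (Finset (Fin N))) : Prop :=
  ∀ x : Fin N → Bits c, 1 - δ ≤ A.prob val x (IsTop K (vec val x))

/-- A procedure which turns a known non-zero vector `u` into a circuit that prepares `|u⟩` in the
register `out`, without queries and by operating only on `out` and the ancillary qubits (which it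
returns to zero). -/
def PreparesStates (val : Format c)
    (prep : (Fin N → ℝ≥0) → Circuit N c (Wire (idxLen N) c a)) : Prop :=
  ∀ u : Fin N → ℝ≥0, u ≠ 0 →
    queryCount (prep u) = 0 ∧
    (∀ g ∈ prep u, ∀ q ∈ g.wires, (∃ j, q = Wire.out j) ∨ ∃ j, q = Wire.anc j) ∧
    ∀ x : Fin N → Bits c, output val x (prep u) = ket c a (amplitudes u) false

/-- The preprocessing algorithm, given a top-`K` maximum finding algorithm and a state preparation
procedure for known vectors: find `H`, read the entries at the positions in `H`, construct the
first stage `D`, and output the circuit. -/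
def preprocessing (val : Format c) (topK : Algo N c (Finset (Fin N)))
    (prep : (Fin N → ℝ≥0) → Circuit N c (Wire (idxLen N) c a)) :
    Algo N c (Circuit N c (Wire (idxLen N) c a)) :=
  topK.bind fun H =>
    (Algo.readList H.toList).bind fun r =>
      Algo.ret (mainCircuit (prep (flatten (vec val r) H)) H (minOn (vec val r) H))

/-- On input `|0…0⟩` the circuit prepares `√p |w⟩|0⟩ + √(1-p) |w⊥⟩|1⟩` (registers `out` and `rot`,
all other qubits in state `|0⟩`) for some `p ∈ [K/N, 1]` and some unit state `|w⊥⟩`. -/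
def PreparesTarget (val : Format c) (K : ℕ) (x : Fin N → Bits c)
    (C : Circuit N c (Wire (idxLen N) c a)) : Prop :=
  ∃ (p : ℝ) (φ : Fin N → ℂ), (K : ℝ) / N ≤ p ∧ p ≤ 1 ∧ ∑ i, ‖φ i‖ ^ 2 = 1 ∧
    output val x C =
      ((Real.sqrt p : ℝ) : ℂ) • ket c a (amplitudes (vec val x)) false +
        ((Real.sqrt (1 - p) : ℝ) : ℂ) • ket c a φ true

end Output

end StatePrep

end

noncomputable section

set_option linter.unusedSectionVars false

namespace StatePrep

/-! ### Gates as permutations of basis states and norm preservation -/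

section GateLemmas

variable {N c : ℕ} {W : Type} [DecidableEq W]

/-! The output circuit. Let `u = flatten w H`, `h = minOn w H`, `S = ‖w‖₁` and `Z = ∑ u`. As `H`
holds largest entries, `w ≤ u`. The controlled rotation turns the amplitude `√(u i / Z)` into `√(w i
/ Z)` on `rot = 0`, so `p = S / Z`. From `K h ≤ ∑_H w ≤ S` follows `K Z = K ∑_H w + (N - K) K h ≤ N
S`, that is `p ≥ K / N` (`preparesTarget_mainCircuit`).

The first stage. The qubits of `out` are rotated from the most significant one down, each rotation
splitting the mass of a block of indices between its two halves. Since `u` is constant outside `H`,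
most blocks are split evenly, so that each qubit needs at most `K + 2` distinct non-zero angles
(`card_angles_le`). One angle costs six gates: an indicator gate into an ancilla, a controlled
rotation, and the indicator gate again.

Finding `H`. Start from any `K` positions and keep replacing a smallest entry by a uniformly random
better one, found by Grover search. If `r` indices are better, the search costs `O(√(N / r))` on
average although `r` is unknown. The total is bounded by amortisation: `potential` is `O(√(K N))`,
and a random exchange lowers it on average by at least `90 √(N / r)`, which pays for the search
(`sum_potential_exchange_le`). For `r ≤ 4 K` the drop comes from the shrinking number of better
indices. For `r > 4 K` it comes from ranks: a constant fraction of the better indices have at most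
half as many entries above them as the discarded one. Markov's inequality (`mul_expect_improve_le`)
shows that a budget of twice the initial bound fails with probability at most `1 / 2`, and `O(log (1
/ δ))` repetitions give `δ`.

Gate counts follow query counts, since each search or read executes at most `gateFactor N c` gates
per query charged to it. -/

theorem ofBits_encode {N : ℕ} (i : Fin N) : Nat.ofBits (encode i) = i := by
  have h : (i : ℕ) < 2 ^ idxLen N := i.2.trans_le (Nat.le_pow_clog (by norm_num) N)
  unfold encode
  rw [Nat.ofBits_testBit, Nat.mod_eq_of_lt h]

theorem encode_ofBits {N : ℕ} (z : Bits (idxLen N)) (h : Nat.ofBits z < N) :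
    encode (⟨Nat.ofBits z, h⟩ : Fin N) = z := by
  funext j
  simp [encode]

theorem encode_injective {N : ℕ} : Function.Injective (encode (N := N)) := by
  intro i j h
  have := congrArg Nat.ofBits h
  rw [ofBits_encode, ofBits_encode] at this
  exact Fin.ext this

theorem eq_encode_iff {N : ℕ} (z : Bits (idxLen N)) (i : Fin N) :
    z = encode i ↔ Nat.ofBits z = i := by
  constructor
  · rintro rfl; exact ofBits_encode i
  · intro h
    have hz : Nat.ofBits z < N := h ▸ i.2
    rw [← encode_ofBits z hz]
    congr 1
    exact Fin.ext h

theorem entryAt_encode (x : Fin N → Bits c) (i : Fin N) : entryAt x (encode i) = x i := by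
  unfold entryAt
  have h : Nat.ofBits (encode i) < N := by rw [ofBits_encode]; exact i.2
  rw [dif_pos h]
  congr 1
  exact Fin.ext (ofBits_encode i)

/-- The action of an indicator gate on basis states. -/
def indMap (S : Finset (Fin N)) (i : Fin (idxLen N) ↪ W) (b : W) (y : W → Bool) : W → Bool :=
  Function.update y b (xor (y b) (decide (¬ ∃ s ∈ S, y ∘ i = encode s)))

theorem apply_cnot (val : Format c) (x : Fin N → Bits c) (ctl q : W) (hq : ctl ≠ q)
    (ψ : State W) :
    (Gate.cnot ctl q hq).apply val x ψ =
      fun y => ψ (Function.update y q (xor (y q) (y ctl))) := by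
  funext y
  cases hc : y ctl <;> cases hb : y q <;> simp [Gate.apply, onWire, hc, hb, pauliX, Matrix.one_apply]

theorem apply_ind (val : Format c) (x : Fin N → Bits c) (S : Finset (Fin N))
    (i : Fin (idxLen N) ↪ W) (b : W) (hb : ∀ k, i k ≠ b) (ψ : State W) :
    (Gate.ind S i b hb).apply val x ψ = fun y => ψ (indMap S i b y) := by
  funext y
  by_cases hc : ∃ s ∈ S, y ∘ i = encode s
  · cases hb : y b <;> simp [Gate.apply, onWire, indMap, hc, hb, Matrix.one_apply]
  · cases hb : y b <;> simp [Gate.apply, onWire, indMap, hc, hb, pauliX]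

theorem apply_query (val : Format c) (x : Fin N → Bits c) (v : Fin c ↪ W)
    (i : Fin (idxLen N) ↪ W) (h : ∀ j k, v j ≠ i k) (ψ : State W) :
    (Gate.query v i h).apply val x ψ = fun y => ψ (queryMap x v i y) := rfl

theorem update_comp_of_ne {κ : Type} (y : W → Bool) (i : κ → W) (b : W) (t : Bool)
    (hb : ∀ k, i k ≠ b) : Function.update y b t ∘ i = y ∘ i := by
  funext k
  simp [hb k]

theorem indMap_indMap (S : Finset (Fin N)) (i : Fin (idxLen N) ↪ W) (b : W)
    (hb : ∀ k, i k ≠ b) (y : W → Bool) : indMap S i b (indMap S i b y) = y := by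
  unfold indMap
  rw [update_comp_of_ne y i b _ hb]
  simp

theorem queryMap_comp (x : Fin N → Bits c) (v : Fin c ↪ W) (i : Fin (idxLen N) ↪ W)
    (h : ∀ j k, v j ≠ i k) (y : W → Bool) : queryMap x v i y ∘ i = y ∘ i := by
  funext k
  simp only [queryMap, Function.comp]
  rw [decide_eq_false]
  · simp
  · rintro ⟨j, hj, -⟩
    exact h j k hj

theorem queryMap_queryMap (x : Fin N → Bits c) (v : Fin c ↪ W) (i : Fin (idxLen N) ↪ W)
    (h : ∀ j k, v j ≠ i k) (y : W → Bool) : queryMap x v i (queryMap x v i y) = y := by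
  funext q
  conv_lhs => unfold queryMap
  rw [show (fun q => xor (y q) (decide (∃ j, v j = q ∧ entryAt x (y ∘ i) j = true))) =
    queryMap x v i y from rfl, queryMap_comp x v i h]
  simp

/-- Apply a circuit to a state. -/
def runOn (val : Format c) (x : Fin N → Bits c) (C : Circuit N c W) (ψ : State W) : State W :=
  C.foldl (fun ψ g => g.apply val x ψ) ψ

theorem runOn_nil (val : Format c) (x : Fin N → Bits c) (ψ : State W) :
    runOn val x [] ψ = ψ := rfl

theorem runOn_cons (val : Format c) (x : Fin N → Bits c) (g : Gate N c W) (C : Circuit N c W)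
    (ψ : State W) : runOn val x (g :: C) ψ = runOn val x C (g.apply val x ψ) := rfl

theorem runOn_append (val : Format c) (x : Fin N → Bits c) (C D : Circuit N c W) (ψ : State W) :
    runOn val x (C ++ D) ψ = runOn val x D (runOn val x C ψ) := List.foldl_append

theorem output_eq_runOn (val : Format c) (x : Fin N → Bits c) (C : Circuit N c W) :
    output val x C = runOn val x C (basisState (fun _ => false)) := rfl

variable [Fintype W]

/-- The squared norm of a state. -/
def normSq (ψ : State W) : ℝ := ∑ y, ‖ψ y‖ ^ 2

theorem normSq_comp_involutive (f : (W → Bool) → (W → Bool)) (hf : Function.Involutive f)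
    (ψ : State W) : normSq (fun y => ψ (f y)) = normSq ψ :=
  Equiv.sum_comp hf.toPerm (fun y => ‖ψ y‖ ^ 2)

/-- Summing over both values of one bit counts every string twice. This reduces sums involving a
one-qubit gate to two-dimensional blocks. -/
theorem sum_eq_half_sum_update {β : Type} [AddCommMonoid β] [Module ℝ β] (q : W)
    (f : (W → Bool) → β) :
    ∑ y, f y = (1 / 2 : ℝ) • ∑ y, ∑ b : Bool, f (Function.update y q b) := by
  have hinv : Function.Involutive (fun y : W → Bool => Function.update y q (!(y q))) := by
    intro y; simp
  have h2 : ∑ y, f (Function.update y q (!(y q))) = ∑ y, f y :=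
    Equiv.sum_comp hinv.toPerm f
  have h3 : ∀ y : W → Bool, ∑ b : Bool, f (Function.update y q b) =
      f y + f (Function.update y q (!(y q))) := by
    intro y
    rw [Fintype.sum_bool]
    have h4 : f y = f (Function.update y q (y q)) := by rw [Function.update_eq_self]
    cases h : y q
    · rw [h4, h, Bool.not_false, add_comm]
    · rw [h4, h, Bool.not_true]
  simp_rw [h3]
  rw [Finset.sum_add_distrib, h2, ← two_smul ℝ, smul_smul]
  norm_num

theorem unitary_normSq (U : Matrix Bool Bool ℂ) (hU : U ∈ Matrix.unitaryGroup Bool ℂ)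
    (a : Bool → ℂ) : ∑ s, ‖∑ b, U s b * a b‖ ^ 2 = ∑ b, ‖a b‖ ^ 2 := by
  have h := Matrix.mem_unitaryGroup_iff'.1 hU
  have h1 : star (U.mulVec a) ⬝ᵥ (U.mulVec a) = star a ⬝ᵥ a := by
    rw [Matrix.star_mulVec, Matrix.dotProduct_mulVec, Matrix.vecMul_vecMul]
    rw [show U.conjTranspose * U = 1 from h, Matrix.vecMul_one]
  have h2 : ∀ v : Bool → ℂ, star v ⬝ᵥ v = ((∑ s, ‖v s‖ ^ 2 : ℝ) : ℂ) := by
    intro v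
    push_cast
    refine Finset.sum_congr rfl fun s _ => ?_
    exact Complex.conj_mul' (v s)
  rw [h2, h2] at h1
  exact_mod_cast h1

/-- As `M` does not depend on its own target, the state space splits into two-dimensional blocks on
each of which one fixed unitary acts. -/
theorem normSq_onWire (q : W) (M : (W → Bool) → Matrix Bool Bool ℂ)
    (hM : ∀ y, M y ∈ Matrix.unitaryGroup Bool ℂ) (hq : ∀ y b, M (Function.update y q b) = M y)
    (ψ : State W) : normSq (onWire q M ψ) = normSq ψ := by
  unfold normSq
  rw [sum_eq_half_sum_update q, sum_eq_half_sum_update q (fun y => ‖ψ y‖ ^ 2)]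
  congr 1
  refine Finset.sum_congr rfl fun y _ => ?_
  rw [← unitary_normSq (M y) (hM y) (fun b => ψ (Function.update y q b))]
  refine Finset.sum_congr rfl fun s _ => ?_
  simp [onWire, hq]

/-- The real matrix with columns `(C, S)` and `(-S, C)`. -/
def planeMatrix (C S : ℝ) : Matrix Bool Bool ℂ :=
  fun a b => if a = b then (C : ℂ) else if b then -(S : ℂ) else (S : ℂ)

theorem planeMatrix_mem {C S : ℝ} (h : C * C + S * S = 1) :
    planeMatrix C S ∈ Matrix.unitaryGroup Bool ℂ := by
  have e : (C : ℂ) * C + S * S = 1 := by exact_mod_cast h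
  rw [Matrix.mem_unitaryGroup_iff]
  ext a b
  cases a <;> cases b <;>
    simp [Matrix.mul_apply, Matrix.star_apply, planeMatrix] <;>
    first | ring1 | linear_combination e

theorem rotMatrix_of_pos {h v : ℝ≥0} (hv : 0 < h ∧ v ≤ h) :
    rotMatrix h v = planeMatrix (Real.sqrt ((v : ℝ) / h)) (Real.sqrt (1 - (v : ℝ) / h)) :=
  if_pos hv

theorem rotMatrix_of_neg {h v : ℝ≥0} (hv : ¬(0 < h ∧ v ≤ h)) : rotMatrix h v = 1 := if_neg hv

theorem rotMatrix_mem (h v : ℝ≥0) : rotMatrix h v ∈ Matrix.unitaryGroup Bool ℂ := by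
  by_cases hv : 0 < h ∧ v ≤ h
  · have h0 : (0 : ℝ) ≤ (v : ℝ) / h := by positivity
    have h1 : (0 : ℝ) ≤ 1 - (v : ℝ) / h := by
      rw [sub_nonneg, div_le_one (by exact_mod_cast hv.1)]
      exact_mod_cast hv.2
    rw [rotMatrix_of_pos hv]
    refine planeMatrix_mem ?_
    rw [Real.mul_self_sqrt h0, Real.mul_self_sqrt h1]
    ring
  · rw [rotMatrix_of_neg hv]
    exact one_mem _

theorem normSq_apply (val : Format c) (x : Fin N → Bits c) (g : Gate N c W) (ψ : State W) :
    normSq (g.apply val x ψ) = normSq ψ := by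
  cases g with
  | one U q => exact normSq_onWire q _ (fun _ => U.2) (fun _ _ => rfl) ψ
  | cnot ctl q hq =>
    rw [apply_cnot]
    refine normSq_comp_involutive _ (fun y => ?_) ψ
    simp [hq]
  | ind S i b hb =>
    rw [apply_ind]
    exact normSq_comp_involutive _ (indMap_indMap S i b hb) ψ
  | query v i h =>
    exact normSq_comp_involutive _ (queryMap_queryMap x v i h) ψ
  | rot h b v hb =>
    refine normSq_onWire b _ (fun _ => rotMatrix_mem _ _) (fun y t => ?_) ψ
    rw [update_comp_of_ne y v b t hb]
  | crot h ctl b v hb hctl hv =>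
    refine normSq_onWire b _ (fun y => ?_) (fun y t => ?_) ψ
    · split_ifs
      · exact rotMatrix_mem _ _
      · exact one_mem _
    · simp only [update_comp_of_ne y v b t hb, Function.update_of_ne hctl]

theorem normSq_runOn (val : Format c) (x : Fin N → Bits c) (C : Circuit N c W) (ψ : State W) :
    normSq (runOn val x C ψ) = normSq ψ := by
  induction C generalizing ψ with
  | nil => rfl
  | cons g C ih => rw [runOn_cons, ih, normSq_apply]

theorem normSq_basisState (y : W → Bool) : normSq (basisState y) = 1 := by
  rw [normSq, Finset.sum_eq_single y]
  · simp [basisState]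
  · intro z _ hz
    simp [basisState, hz]
  · simp

/-- The outcomes of a measurement have total probability one; `expect_const` rests on this. -/
theorem normSq_output (val : Format c) (x : Fin N → Bits c) (C : Circuit N c W) :
    ∑ y, ‖output val x C y‖ ^ 2 = 1 := by
  have := normSq_runOn val x C (basisState (fun _ => false))
  rw [normSq_basisState] at this
  exact this

end GateLemmas

namespace Algo

/-! ### Expectations and costs of algorithms -/

variable {N c : ℕ} {α β : Type}

/-- The expectation of a function of the output, when the input is `x`. -/
def expect (val : Format c) (x : Fin N → Bits c) (F : α → ℝ) : Algo N c α → ℝ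
  | ret a => F a
  | run W C next => ∑ y : W → Bool, ‖output val x C y‖ ^ 2 * expect val x F (next y)

open Classical in
theorem prob_eq_expect (val : Format c) (x : Fin N → Bits c) (P : α → Prop) (A : Algo N c α) :
    A.prob val x P = A.expect val x (fun a => if P a then 1 else 0) := by
  induction A with
  | ret a => rfl
  | run W C next ih => simp only [prob, expect, ih]

/-- Expectations of arbitrary functions, unlike probabilities of events, are closed under sequential
composition; hence the detour through `expect`. -/
theorem expect_bind (val : Format c) (x : Fin N → Bits c) (F : β → ℝ) (A : Algo N c α)
    (f : α → Algo N c β) :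
    (A.bind f).expect val x F = A.expect val x (fun a => (f a).expect val x F) := by
  induction A with
  | ret a => rfl
  | run W C next ih => simp only [bind, expect, ih]

theorem expect_mono (val : Format c) (x : Fin N → Bits c) {F G : α → ℝ} (h : ∀ a, F a ≤ G a)
    (A : Algo N c α) : A.expect val x F ≤ A.expect val x G := by
  induction A with
  | ret a => exact h a
  | run W C next ih =>
    exact Finset.sum_le_sum fun y _ => mul_le_mul_of_nonneg_left (ih y) (by positivity)

theorem expect_const (val : Format c) (x : Fin N → Bits c) (r : ℝ) (A : Algo N c α) :
    A.expect val x (fun _ => r) = r := by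
  induction A with
  | ret a => rfl
  | run W C next ih =>
    simp only [expect, ih]
    rw [← Finset.sum_mul, normSq_output, one_mul]

theorem expect_sub (val : Format c) (x : Fin N → Bits c) (F G : α → ℝ) (A : Algo N c α) :
    A.expect val x (fun a => F a - G a) = A.expect val x F - A.expect val x G := by
  induction A with
  | ret a => rfl
  | run W C next ih => simp only [expect, ih, mul_sub, Finset.sum_sub_distrib]

theorem expect_smul (val : Format c) (x : Fin N → Bits c) (r : ℝ) (F : α → ℝ) (A : Algo N c α) :
    A.expect val x (fun a => r * F a) = r * A.expect val x F := by
  induction A with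
  | ret a => rfl
  | run W C next ih =>
    simp only [expect, ih, Finset.mul_sum]
    exact Finset.sum_congr rfl fun y _ => by ring

/-- All returned values satisfy `P`. -/
def AllRet (P : α → Prop) : Algo N c α → Prop
  | ret a => P a
  | run _ _ next => ∀ y, AllRet P (next y)

theorem allRet_bind {P : β → Prop} (A : Algo N c α) (f : α → Algo N c β)
    (h : ∀ a, AllRet P (f a)) : AllRet P (A.bind f) := by
  induction A with
  | ret a => exact h a
  | run W C next ih => exact fun y => ih y

/-- The algorithm makes at most `q` queries and executes at most `g * q` gates. -/
def CostLE (g q : ℕ) (A : Algo N c α) : Prop := A.queries ≤ q ∧ A.gates ≤ g * q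

theorem CostLE.mono {g q q' : ℕ} {A : Algo N c α} (h : CostLE g q A) (hq : q ≤ q') :
    CostLE g q' A :=
  ⟨h.1.trans hq, h.2.trans (Nat.mul_le_mul_left g hq)⟩

theorem costLE_ret (g : ℕ) (q : ℕ) (a : α) : CostLE g q (ret a : Algo N c α) :=
  ⟨Nat.zero_le _, Nat.zero_le _⟩

theorem costLE_run {g q q' : ℕ} (W : Type) [Fintype W] [DecidableEq W] (C : Circuit N c W)
    (next : (W → Bool) → Algo N c α) (hq : queryCount C ≤ q) (hg : C.length ≤ g * q)
    (h : ∀ y, CostLE g q' (next y)) : CostLE g (q + q') (run W C next) := by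
  constructor
  · exact Nat.add_le_add hq (Finset.sup_le fun y _ => (h y).1)
  · rw [mul_add]
    exact Nat.add_le_add hg (Finset.sup_le fun y _ => (h y).2)

/-- Costs are suprema over all outcomes, even those of probability zero, so what is assumed about
intermediate values must hold for every returned value. -/
theorem queries_bind_le {P : α → Prop} {A : Algo N c α} (hA : AllRet P A) (f : α → Algo N c β)
    {q : ℕ} (hf : ∀ a, P a → (f a).queries ≤ q) : (A.bind f).queries ≤ A.queries + q := by
  induction A with
  | ret a => simpa [bind, queries] using hf a hA
  | run W C next ih =>
    simp only [bind, queries, add_assoc]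
    refine Nat.add_le_add_left (Finset.sup_le fun y _ => (ih y (hA y)).trans ?_) _
    exact Nat.add_le_add_right
      (Finset.le_sup (f := fun y => (next y).queries) (Finset.mem_univ y)) q

theorem gates_bind_le {P : α → Prop} {A : Algo N c α} (hA : AllRet P A) (f : α → Algo N c β)
    {q : ℕ} (hf : ∀ a, P a → (f a).gates ≤ q) : (A.bind f).gates ≤ A.gates + q := by
  induction A with
  | ret a => simpa [bind, gates] using hf a hA
  | run W C next ih =>
    simp only [bind, gates, add_assoc]
    refine Nat.add_le_add_left (Finset.sup_le fun y _ => (ih y (hA y)).trans ?_) _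
    exact Nat.add_le_add_right
      (Finset.le_sup (f := fun y => (next y).gates) (Finset.mem_univ y)) q

theorem allRet_true (A : Algo N c α) : AllRet (fun _ => True) A := by
  induction A with
  | ret a => trivial
  | run W C next ih => exact ih

theorem costLE_bind_of {P : α → Prop} {g q q' : ℕ} {A : Algo N c α} (hP : AllRet P A)
    (hA : CostLE g q A) (f : α → Algo N c β) (hf : ∀ a, P a → CostLE g q' (f a)) :
    CostLE g (q + q') (A.bind f) := by
  constructor
  · exact (queries_bind_le hP f fun a ha => (hf a ha).1).trans (Nat.add_le_add_right hA.1 _)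
  · rw [mul_add]
    exact (gates_bind_le hP f fun a ha => (hf a ha).2).trans (Nat.add_le_add_right hA.2 _)

theorem costLE_bind {g q q' : ℕ} {A : Algo N c α} (hA : CostLE g q A) (f : α → Algo N c β)
    (hf : ∀ a, CostLE g q' (f a)) : CostLE g (q + q') (A.bind f) :=
  costLE_bind_of (allRet_true A) hA f fun a _ => hf a

/-! ### Reading entries -/

theorem basisState_comp_involutive {W : Type} (f : (W → Bool) → (W → Bool))
    (hf : Function.Involutive f) (y : W → Bool) :
    (fun z => basisState y (f z)) = basisState (f y) := by
  funext z
  simp only [basisState]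
  congr 1
  apply propext
  constructor
  · rintro rfl; exact (hf z).symm
  · rintro rfl; exact hf y

theorem apply_pauliX {W : Type} [DecidableEq W] (val : Format c) (x : Fin N → Bits c) (q : W)
    (ψ : State W) : (Gate.one ⟨pauliX, pauliX_mem⟩ q).apply val x ψ =
      fun y => ψ (Function.update y q (!(y q))) := by
  funext y
  cases hb : y q <;> simp [Gate.apply, onWire, hb, pauliX]

theorem runOn_pauliX_list {W κ : Type} [DecidableEq W] (val : Format c) (x : Fin N → Bits c)
    (i : κ ↪ W) (l : List κ) (hl : l.Nodup) (y : W → Bool) (hy : ∀ k ∈ l, y (i k) = false) :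
    ∃ z, runOn val x (l.map fun j => Gate.one ⟨pauliX, pauliX_mem⟩ (i j)) (basisState y) =
        basisState z ∧ (∀ k ∈ l, z (i k) = true) ∧ ∀ q, (∀ k ∈ l, q ≠ i k) → z q = y q := by
  induction l generalizing y with
  | nil => exact ⟨y, rfl, by simp, fun _ _ => rfl⟩
  | cons a l ih =>
    have hinv : Function.Involutive
        (fun y : W → Bool => Function.update y (i a) (!(y (i a)))) := by
      intro y; simp
    have ha : a ∉ l := (List.nodup_cons.1 hl).1
    obtain ⟨z, hz, h1, h2⟩ := ih (List.nodup_cons.1 hl).2 (Function.update y (i a) (!(y (i a))))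
      (fun k hk => by
        have : k ≠ a := fun e => ha (e ▸ hk)
        rw [Function.update_of_ne (fun e => this (i.injective e))]
        exact hy k (List.mem_cons_of_mem _ hk))
    refine ⟨z, ?_, ?_, ?_⟩
    · rw [List.map_cons, runOn_cons, apply_pauliX,
        basisState_comp_involutive (fun y : W → Bool => Function.update y (i a) (!(y (i a)))) hinv,
        hz]
    · intro k hk
      rcases List.mem_cons.1 hk with rfl | hk
      · rw [h2 _ fun k' hk' e => ha (by rwa [i.injective e]), Function.update_self,
          hy k (List.mem_cons_self)]
        rfl
      · exact h1 k hk
    · intro q hq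
      rw [h2 q fun k hk => hq k (List.mem_cons_of_mem _ hk),
        Function.update_of_ne (hq a List.mem_cons_self)]

theorem expect_run_basisState (val : Format c) (x : Fin N → Bits c) (F : α → ℝ) (W : Type)
    [Fintype W] [DecidableEq W] (C : Circuit N c W) (next : (W → Bool) → Algo N c α)
    (z : W → Bool) (h : output val x C = basisState z) :
    (run W C next).expect val x F = (next z).expect val x F := by
  rw [expect, h, Finset.sum_eq_single z]
  · simp [basisState]
  · intro y _ hy
    simp [basisState, hy]
  · simp

theorem expect_readEntry (val : Format c) (x : Fin N → Bits c) (F : Bits c → ℝ) (i : Fin N) :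
    (readEntry i).expect val x F = F (x i) := by
  obtain ⟨z, hz, h1, h2⟩ := runOn_pauliX_list val x
    (Function.Embedding.inr : Fin (idxLen N) ↪ Fin c ⊕ Fin (idxLen N))
    ((List.finRange (idxLen N)).filter (fun j => encode i j))
    ((List.nodup_finRange _).filter _) (fun _ => false) (fun _ _ => rfl)
  have hidx : z ∘ (Function.Embedding.inr : Fin (idxLen N) ↪ Fin c ⊕ Fin (idxLen N)) =
      encode i := by
    funext k
    by_cases hk : encode i k = true
    · simp only [Function.comp, hk]
      exact h1 k (by simp [hk])
    · simp only [Function.comp]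
      rw [h2 _ fun k' hk' e => hk ?_]
      · simpa using hk
      · rw [Function.Embedding.inr.injective e]
        simpa using hk'
  have hval : ∀ j, z (Sum.inl j) = false := fun j => h2 _ (by simp)
  rw [readEntry, expect_run_basisState val x F _ _ _
    (queryMap x Function.Embedding.inl Function.Embedding.inr z)]
  · simp only [expect]
    congr 1
    funext j
    have : ∀ j' : Fin c, (Function.Embedding.inl j' : Fin c ⊕ Fin (idxLen N)) = Sum.inl j ↔
        j' = j := by
      intro j'; simp
    simp [queryMap, hidx, entryAt_encode, hval]
  · rw [output_eq_runOn, runOn_append]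
    refine (congrArg _ hz).trans ?_
    rw [runOn_cons, runOn_nil]
    exact basisState_comp_involutive _
      (queryMap_queryMap x _ _ fun _ _ => Sum.inl_ne_inr) z

theorem expect_readList (val : Format c) (x : Fin N → Bits c) (F : (Fin N → Bits c) → ℝ)
    (l : List (Fin N)) :
    (readList l).expect val x F = F (fun i => if i ∈ l then x i else fun _ => false) := by
  induction l generalizing F with
  | nil => simp [readList, expect]
  | cons i l ih =>
    rw [readList, expect_bind, expect_readEntry, expect_bind, ih]
    simp only [expect]
    congr 1
    funext k
    by_cases h : k = i
    · subst h; simp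
    · simp [h]

theorem costLE_readEntry (i : Fin N) :
    CostLE (idxLen N + 1) 1 (readEntry i : Algo N c (Bits c)) := by
  have := costLE_run (g := idxLen N + 1) (q := 1) (q' := 0) (Fin c ⊕ Fin (idxLen N))
    (((List.finRange (idxLen N)).filter (fun j => encode i j)).map
        (fun j => (Gate.one ⟨pauliX, pauliX_mem⟩ (Sum.inr j) : Gate N c _)) ++
      [Gate.query Function.Embedding.inl Function.Embedding.inr (fun _ _ => Sum.inl_ne_inr)])
    (fun y => ret (fun j => y (Sum.inl j))) ?_ ?_ (fun y => costLE_ret _ _ _)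
  · exact this
  · simp only [queryCount, List.countP_append, List.countP_map]
    have : (Gate.isQuery ∘ fun j : Fin (idxLen N) =>
        (Gate.one ⟨pauliX, pauliX_mem⟩ (Sum.inr j) : Gate N c (Fin c ⊕ Fin (idxLen N)))) =
        fun _ => false := by
      funext j; rfl
    rw [this]
    simp [Gate.isQuery]
  · have := List.length_filter_le (fun j => encode i j) (List.finRange (idxLen N))
    rw [List.length_finRange] at this
    simpa using this

theorem costLE_readList (l : List (Fin N)) :
    CostLE (idxLen N + 1) l.length (readList l : Algo N c (Fin N → Bits c)) := by
  induction l with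
  | nil => exact costLE_ret _ _ _
  | cons i l ih =>
    rw [List.length_cons, add_comm l.length 1]
    refine costLE_bind (costLE_readEntry i) _ fun b => ?_
    exact costLE_bind (q' := 0) ih _ fun r => costLE_ret _ _ _

end Algo

/-! ### Diagonal operators -/

section Diagonal

variable {N c : ℕ} {W : Type} [DecidableEq W]

/-- The circuit multiplies each amplitude by the value of `D`. -/
def ActsDiag (val : Format c) (x : Fin N → Bits c) (C : Circuit N c W) (D : (W → Bool) → ℂ) :
    Prop := ∀ ψ y, runOn val x C ψ y = D y * ψ y

theorem ActsDiag.append {val : Format c} {x : Fin N → Bits c} {C₁ C₂ : Circuit N c W}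
    {D₁ D₂ : (W → Bool) → ℂ} (h₁ : ActsDiag val x C₁ D₁) (h₂ : ActsDiag val x C₂ D₂) :
    ActsDiag val x (C₁ ++ C₂) (fun y => D₁ y * D₂ y) := by
  intro ψ y
  rw [runOn_append, h₂, h₁]
  ring

/-- Compute, apply phases, uncompute: a diagonal operator conjugated by a permutation of basis
states stays diagonal. -/
theorem ActsDiag.conj {val : Format c} {x : Fin N → Bits c} {P P' C : Circuit N c W}
    {D : (W → Bool) → ℂ} {f g : (W → Bool) → (W → Bool)} (hfg : ∀ y, f (g y) = y)
    (hP : ∀ ψ, runOn val x P ψ = fun y => ψ (f y))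
    (hP' : ∀ ψ, runOn val x P' ψ = fun y => ψ (g y)) (h : ActsDiag val x C D) :
    ActsDiag val x (P ++ C ++ P') (fun y => D (g y)) := by
  intro ψ y
  rw [runOn_append, runOn_append, hP', hP]
  simp only [h _ (g y), hfg]

theorem diagonal_mem {d : Bool → ℂ} (hd : ∀ b, ‖d b‖ = 1) :
    Matrix.diagonal d ∈ Matrix.unitaryGroup Bool ℂ := by
  rw [Matrix.mem_unitaryGroup_iff, Matrix.star_eq_conjTranspose, Matrix.diagonal_conjTranspose,
    Matrix.diagonal_mul_diagonal, ← Matrix.diagonal_one]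
  congr 1
  funext b
  simp [Complex.mul_conj', hd]

theorem actsDiag_diagonal (val : Format c) (x : Fin N → Bits c) {d : Bool → ℂ}
    (hd : ∀ b, ‖d b‖ = 1) (q : W) :
    ActsDiag val x [(Gate.one ⟨Matrix.diagonal d, diagonal_mem hd⟩ q : Gate N c W)]
      (fun y => d (y q)) := by
  intro ψ y
  rw [runOn_cons, runOn_nil]
  have h : ψ y = ψ (Function.update y q (y q)) := by rw [Function.update_eq_self]
  rw [h]
  cases hb : y q <;> simp [Gate.apply, onWire, hb]

/-! ### Walsh expansion of Boolean functions -/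

/-- The sign of a bit. -/
def bitSign (b : Bool) : ℝ := if b then -1 else 1

theorem bitSign_xor (a b : Bool) : bitSign (xor a b) = bitSign a * bitSign b := by
  cases a <;> cases b <;> simp [bitSign]

/-- The Walsh coefficients of a real function on bit strings. -/
def walshCoeff {κ : Type} [Fintype κ] [DecidableEq κ] (f : (κ → Bool) → ℝ) (S : Finset κ) : ℝ :=
  (1 / 2) ^ Fintype.card κ * ∑ u, f u * ∏ k ∈ S, bitSign (u k)

/-- Orthogonality of characters: the sum over `S` of the products of characters at `u` and `z`
factors as `∏ k, (1 ± 1)`, which vanishes unless `u = z`. -/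
theorem walsh_expansion {κ : Type} [Fintype κ] [DecidableEq κ] (f : (κ → Bool) → ℝ)
    (z : κ → Bool) : ∑ S : Finset κ, walshCoeff f S * ∏ k ∈ S, bitSign (z k) = f z := by
  have h1 : ∀ u : κ → Bool, ∑ S : Finset κ, (∏ k ∈ S, bitSign (u k)) * ∏ k ∈ S, bitSign (z k) =
      if u = z then 2 ^ Fintype.card κ else 0 := by
    intro u
    have h2 : ∏ k, (1 + bitSign (u k) * bitSign (z k)) =
        ∑ S : Finset κ, (∏ k ∈ S, bitSign (u k)) * ∏ k ∈ S, bitSign (z k) := by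
      rw [Finset.prod_one_add, Finset.powerset_univ]
      exact Finset.sum_congr rfl fun S _ => Finset.prod_mul_distrib
    rw [← h2]
    split_ifs with h
    · subst h
      have : ∀ b, 1 + bitSign b * bitSign b = 2 := by
        intro b; cases b <;> norm_num [bitSign]
      simp [this]
    · obtain ⟨k, hk⟩ := Function.ne_iff.1 h
      refine Finset.prod_eq_zero (Finset.mem_univ k) ?_
      revert hk
      cases u k <;> cases z k <;> simp [bitSign]
  calc ∑ S : Finset κ, walshCoeff f S * ∏ k ∈ S, bitSign (z k)
      = (1 / 2) ^ Fintype.card κ * ∑ u, f u *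
          ∑ S : Finset κ, (∏ k ∈ S, bitSign (u k)) * ∏ k ∈ S, bitSign (z k) := by
        simp only [walshCoeff, Finset.mul_sum, Finset.sum_mul]
        rw [Finset.sum_comm]
        exact Finset.sum_congr rfl fun u _ => Finset.sum_congr rfl fun S _ => by ring
    _ = f z := by
        simp only [h1, mul_ite, mul_zero]
        rw [Finset.sum_ite_eq' Finset.univ z, if_pos (Finset.mem_univ _)]
        rw [mul_comm (f z), ← mul_assoc, ← mul_pow]
        norm_num

/-! ### Phase oracles for Boolean functions of registers -/

variable {κ : Type}

/-- Add the parity of the listed qubits to the qubit `w`. -/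
def parityCircuit (r : κ → W) (w : W) (hr : ∀ k, r k ≠ w) (l : List κ) : Circuit N c W :=
  l.map fun k => Gate.cnot (r k) w (hr k)

/-- The parity of the listed bits. -/
def parity (r : κ → W) (y : W → Bool) (l : List κ) : Bool :=
  l.foldr (fun k b => xor (y (r k)) b) false

theorem parity_update (r : κ → W) (w : W) (hr : ∀ k, r k ≠ w) (l : List κ) (y : W → Bool)
    (b : Bool) : parity r (Function.update y w b) l = parity r y l := by
  simp [parity, hr]

theorem bitSign_parity (r : κ → W) (y : W → Bool) (l : List κ) :
    bitSign (parity r y l) = (l.map fun k => bitSign (y (r k))).prod := by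
  induction l with
  | nil => simp [parity, bitSign]
  | cons k l ih =>
    rw [List.map_cons, List.prod_cons, ← ih, ← bitSign_xor]
    rfl

theorem runOn_parityCircuit (val : Format c) (x : Fin N → Bits c) (r : κ → W) (w : W)
    (hr : ∀ k, r k ≠ w) (l : List κ) (ψ : State W) :
    runOn val x (parityCircuit r w hr l) ψ =
      fun y => ψ (Function.update y w (xor (y w) (parity r y l))) := by
  induction l generalizing ψ with
  | nil => funext y; simp [parityCircuit, parity, runOn_nil]
  | cons k l ih =>
    funext y
    have : parityCircuit (N := N) (c := c) r w hr (k :: l) =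
      Gate.cnot (r k) w (hr k) :: parityCircuit r w hr l := rfl
    rw [this, runOn_cons, ih, apply_cnot]
    simp only [Function.update_self, Function.update_idem, Function.update_of_ne (hr k)]
    congr 2
    simp only [parity, List.foldr_cons]
    cases y w <;> cases y (r k) <;> simp

/-- The diagonal one-qubit gate with entries `exp (iα)` and `exp (-iα)`. -/
def phaseGate (α : ℝ) (q : W) : Gate N c W :=
  Gate.one ⟨Matrix.diagonal fun b => Complex.exp ((α * bitSign b : ℝ) * Complex.I),
    diagonal_mem fun _ => Complex.norm_exp_ofReal_mul_I _⟩ q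

/-- Multiply by `exp (iα)` or `exp (-iα)` depending on the parity of a set of qubits. -/
def parityPhase (r : κ → W) (w : W) (hr : ∀ k, r k ≠ w) (S : Finset κ) (α : ℝ) :
    Circuit N c W :=
  parityCircuit r w hr S.toList ++ [phaseGate α w] ++ parityCircuit r w hr S.toList

/-- The CNOT gates add the parity of `S` to the work qubit, so the phase gate sees the corresponding
character; repeating them restores the work qubit. -/
theorem actsDiag_parityPhase (val : Format c) (x : Fin N → Bits c) (r : κ → W) (w : W)
    (hr : ∀ k, r k ≠ w) (S : Finset κ) (α : ℝ) :
    ActsDiag val x (parityPhase r w hr S α)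
      (fun y => Complex.exp ((α * bitSign (y w) * ∏ k ∈ S, bitSign (y (r k)) : ℝ) *
        Complex.I)) := by
  have h := ActsDiag.conj (val := val) (x := x) (f := fun y : W → Bool =>
      Function.update y w (xor (y w) (parity r y S.toList)))
    (g := fun y : W → Bool => Function.update y w (xor (y w) (parity r y S.toList)))
    (fun y => by simp [parity_update r w hr])
    (runOn_parityCircuit val x r w hr S.toList) (runOn_parityCircuit val x r w hr S.toList)
    (actsDiag_diagonal val x (d := fun b => Complex.exp ((α * bitSign b : ℝ) * Complex.I))
      (fun _ => Complex.norm_exp_ofReal_mul_I _) w)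
  intro ψ y
  refine (h ψ y).trans ?_
  simp only [Function.update_self, bitSign_xor, bitSign_parity, Finset.prod_map_toList, mul_assoc]

/-- Multiply the basis states for which `f` holds on the register `r` by `-1`, using a clean
work qubit `w`. -/
def signCircuit [Fintype κ] [DecidableEq κ] (r : κ → W) (w : W) (hr : ∀ k, r k ≠ w) (f : (κ → Bool) → Prop)
    [DecidablePred f] : Circuit N c W :=
  (Finset.univ : Finset (Finset κ)).toList.flatMap fun S =>
    parityPhase r w hr S (Real.pi * walshCoeff (fun u => if f u then 1 else 0) S)

theorem actsDiag_flatMap {ι : Type} (val : Format c) (x : Fin N → Bits c)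
    (C : ι → Circuit N c W) (D : ι → (W → Bool) → ℂ) (h : ∀ i, ActsDiag val x (C i) (D i))
    (l : List ι) : ActsDiag val x (l.flatMap C) (fun y => (l.map fun i => D i y).prod) := by
  induction l with
  | nil => intro ψ y; simp [runOn_nil]
  | cons i l ih => exact (h i).append ih

/-- The phases `exp (iπ · coefficient · character)` multiply to `exp (iπ f) = ±1` by the Walsh
expansion, the clean work qubit contributing the sign `+1`. The number of factors is exponential in
the size of the register, but that size will be `c + 1`. -/
theorem exists_actsDiag_signCircuit [Fintype κ] [DecidableEq κ] (val : Format c)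
    (x : Fin N → Bits c) (r : κ → W) (w : W) (hr : ∀ k, r k ≠ w) (f : (κ → Bool) → Prop)
    [DecidablePred f] :
    ∃ D, ActsDiag val x (signCircuit r w hr f) D ∧
      ∀ y, y w = false → D y = if f (y ∘ r) then -1 else 1 := by
  refine ⟨_, actsDiag_flatMap val x _ _ (fun S => actsDiag_parityPhase val x r w hr S _) _, ?_⟩
  intro y hy
  rw [Finset.prod_map_toList, ← Complex.exp_sum, ← Finset.sum_mul, ← Complex.ofReal_sum]
  have h : ∑ S : Finset κ, Real.pi * walshCoeff (fun u => if f u then 1 else 0) S *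
      bitSign (y w) * ∏ k ∈ S, bitSign (y (r k)) =
      Real.pi * if f (y ∘ r) then 1 else 0 := by
    rw [← walsh_expansion (fun u => if f u then (1 : ℝ) else 0) (y ∘ r), Finset.mul_sum]
    refine Finset.sum_congr rfl fun S _ => ?_
    simp [hy, bitSign, mul_assoc]
  rw [h]
  split_ifs
  · simp [Complex.exp_pi_mul_I]
  · simp

theorem length_parityPhase_le [Fintype κ] (r : κ → W) (w : W) (hr : ∀ k, r k ≠ w) (S : Finset κ)
    (α : ℝ) : (parityPhase (N := N) (c := c) r w hr S α).length ≤ 2 * Fintype.card κ + 1 := by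
  have := S.card_le_univ
  simp only [parityPhase, parityCircuit, List.length_append, List.length_map, List.length_cons,
    List.length_nil, Finset.length_toList]
  omega

theorem length_signCircuit_le [Fintype κ] [DecidableEq κ] (r : κ → W) (w : W) (hr : ∀ k, r k ≠ w)
    (f : (κ → Bool) → Prop) [DecidablePred f] :
    (signCircuit (N := N) (c := c) r w hr f).length ≤
      2 ^ Fintype.card κ * (2 * Fintype.card κ + 1) := by
  rw [signCircuit, List.length_flatMap]
  refine (List.sum_le_card_nsmul _ (2 * Fintype.card κ + 1) ?_).trans_eq ?_
  · intro m hm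
    obtain ⟨S, -, rfl⟩ := List.mem_map.1 hm
    exact length_parityPhase_le r w hr S _
  · simp [Fintype.card_finset]

theorem queryCount_eq_zero {C : Circuit N c W} (h : ∀ g ∈ C, g.isQuery = false) :
    queryCount C = 0 := by
  rw [queryCount, List.countP_eq_zero]
  intro g hg
  simp [h g hg]

theorem queryCount_append (C D : Circuit N c W) :
    queryCount (C ++ D) = queryCount C + queryCount D := List.countP_append

theorem queryCount_signCircuit [Fintype κ] [DecidableEq κ] (r : κ → W) (w : W) (hr : ∀ k, r k ≠ w)
    (f : (κ → Bool) → Prop) [DecidablePred f] :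
    queryCount (signCircuit (N := N) (c := c) r w hr f) = 0 := by
  refine queryCount_eq_zero fun g hg => ?_
  simp only [signCircuit, List.mem_flatMap, parityPhase, parityCircuit, List.mem_append,
    List.mem_map, List.mem_singleton] at hg
  obtain ⟨S, -, (⟨k, -, rfl⟩ | rfl) | ⟨k, -, rfl⟩⟩ := hg <;> rfl

end Diagonal

/-! ### States of the index register -/

section Embed

variable {n c a : ℕ}

theorem outReg_apply (j : Fin n) : (outReg j : Wire n c a) = .out j := rfl

theorem qryReg_apply (j : Fin c) : (qryReg j : Wire n c a) = .qry j := rfl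

/-- All qubits outside the register `out` are `0`. -/
def Clean (y : Wire n c a → Bool) : Prop :=
  y .rot = false ∧ y .ind = false ∧ (∀ j, y (.qry j) = false) ∧ ∀ j, y (.anc j) = false

/-- Contents `z` in the register `out` and zeros elsewhere. -/
def place (c a : ℕ) (z : Bits n) : Wire n c a → Bool
  | .out j => z j
  | _ => false

open Classical in
/-- The state `|φ⟩` of the register `out`, all other qubits being in state `|0⟩`. -/
def embed (c a : ℕ) (φ : State (Fin n)) : State (Wire n c a) :=
  fun y => if Clean y then φ (y ∘ outReg) else 0

theorem place_clean (z : Bits n) : Clean (place c a z) := ⟨rfl, rfl, fun _ => rfl, fun _ => rfl⟩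

theorem place_comp_out (z : Bits n) : place c a z ∘ outReg = z := rfl

theorem Clean.eq_place {y : Wire n c a → Bool} (h : Clean y) : y = place c a (y ∘ outReg) := by
  funext q
  cases q with
  | rot => exact h.1
  | ind => exact h.2.1
  | qry j => exact h.2.2.1 j
  | out j => rfl
  | anc j => exact h.2.2.2 j

theorem place_injective : Function.Injective (place c a : Bits n → _) := fun z z' h => by
  rw [← place_comp_out (c := c) (a := a) z, h, place_comp_out]

theorem embed_of_clean (φ : State (Fin n)) {y : Wire n c a → Bool} (h : Clean y) :
    embed c a φ y = φ (y ∘ outReg) := if_pos h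

theorem embed_of_not_clean (φ : State (Fin n)) {y : Wire n c a → Bool} (h : ¬ Clean y) :
    embed c a φ y = 0 := if_neg h

theorem basisState_zero_eq_embed :
    basisState (fun _ : Wire n c a => false) = embed c a (basisState fun _ => false) := by
  funext y
  by_cases h : Clean y
  · rw [embed_of_clean _ h]
    simp only [basisState]
    congr 1
    apply propext
    constructor
    · rintro rfl; rfl
    · intro e
      rw [h.eq_place, e]
      funext q
      cases q <;> rfl
  · rw [embed_of_not_clean _ h]
    refine if_neg ?_
    rintro rfl
    exact h ⟨rfl, rfl, fun _ => rfl, fun _ => rfl⟩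

theorem sum_embed (φ : State (Fin n)) (G : (Wire n c a → Bool) → ℝ) :
    ∑ y, ‖embed c a φ y‖ ^ 2 * G y = ∑ z, ‖φ z‖ ^ 2 * G (place c a z) := by
  symm
  refine Fintype.sum_of_injective (place c a) place_injective _ _ ?_ ?_
  · intro y hy
    rw [embed_of_not_clean]
    · simp
    · exact fun h => hy ⟨_, h.eq_place.symm⟩
  · intro z
    rw [embed_of_clean _ (place_clean z), place_comp_out]

theorem clean_update_out (y : Wire n c a → Bool) (j : Fin n) (b : Bool) :
    Clean (Function.update y (.out j) b) ↔ Clean y := by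
  simp [Clean]

theorem update_out_comp (y : Wire n c a → Bool) (j : Fin n) (b : Bool) :
    Function.update y (.out j) b ∘ outReg = Function.update (y ∘ outReg) j b := by
  funext k
  by_cases h : k = j
  · subst h; simp [outReg_apply]
  · simp [outReg_apply, h]

/-- A gate on `out` preserves the zeros elsewhere, so its matrix matters only on clean contents. The
analysis thereby reduces to the index register alone. -/
theorem onWire_embed (j : Fin n) (M : (Wire n c a → Bool) → Matrix Bool Bool ℂ)
    (M' : Bits n → Matrix Bool Bool ℂ) (h : ∀ y, Clean y → M y = M' (y ∘ outReg))
    (φ : State (Fin n)) :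
    onWire (.out j) M (embed c a φ) = embed c a (onWire j M' φ) := by
  funext y
  by_cases hy : Clean y
  · rw [embed_of_clean _ hy]
    simp only [onWire, h y hy]
    refine Finset.sum_congr rfl fun b _ => ?_
    rw [embed_of_clean _ ((clean_update_out y j b).2 hy), update_out_comp]
    rfl
  · rw [embed_of_not_clean _ hy]
    refine Finset.sum_eq_zero fun b _ => ?_
    rw [embed_of_not_clean _ (fun h => hy ((clean_update_out y j b).1 h)), mul_zero]

theorem ActsDiag.embed {N : ℕ} {val : Format c} {x : Fin N → Bits c}
    {C : Circuit N c (Wire n c a)} {D : (Wire n c a → Bool) → ℂ} (h : ActsDiag val x C D)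
    (d : Bits n → ℂ) (hd : ∀ y, Clean y → D y = d (y ∘ outReg)) (φ : State (Fin n)) :
    runOn val x C (embed c a φ) = StatePrep.embed c a (fun z => d z * φ z) := by
  funext y
  rw [h]
  by_cases hy : Clean y
  · rw [embed_of_clean _ hy, embed_of_clean _ hy, hd y hy]
  · rw [embed_of_not_clean _ hy, embed_of_not_clean _ hy, mul_zero]

end Embed

/-! ### Layers of Hadamard gates and the reflection about the uniform superposition -/

section Hadamard

/-- The Hadamard matrix. -/
def hadamard : Matrix Bool Bool ℂ :=
  fun a b => ((if a && b then -(1 / Real.sqrt 2) else 1 / Real.sqrt 2 : ℝ) : ℂ)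

theorem hadamard_symm (a b : Bool) : hadamard a b = hadamard b a := by
  simp [hadamard, Bool.and_comm]

theorem half_add_half_sqrt_two :
    ((1 / Real.sqrt 2 : ℝ) : ℂ) * ((1 / Real.sqrt 2 : ℝ) : ℂ) +
      ((1 / Real.sqrt 2 : ℝ) : ℂ) * ((1 / Real.sqrt 2 : ℝ) : ℂ) = 1 := by
  rw [← Complex.ofReal_mul, ← Complex.ofReal_add, div_mul_div_comm,
    Real.mul_self_sqrt (by norm_num)]
  norm_num

theorem hadamard_mul_self : hadamard * hadamard = 1 := by
  have e := half_add_half_sqrt_two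
  ext a b
  cases a <;> cases b <;>
    simp only [Matrix.mul_apply, Fintype.sum_bool, hadamard, Matrix.one_apply, Bool.and_true,
      Bool.and_false, Bool.false_and, Bool.false_eq_true, if_false, if_true, Complex.ofReal_neg,
      reduceCtorEq] <;>
    first | ring1 | linear_combination e

theorem hadamard_mem : hadamard ∈ Matrix.unitaryGroup Bool ℂ := by
  rw [Matrix.mem_unitaryGroup_iff, show star hadamard = hadamard from ?_, hadamard_mul_self]
  ext a b
  rw [Matrix.star_apply, hadamard_symm b a, hadamard, Complex.star_def, Complex.conj_ofReal]

variable {W : Type} [DecidableEq W]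

theorem onWire_onWire (q : W) (M M' : (W → Bool) → Matrix Bool Bool ℂ)
    (h : ∀ y b, M' (Function.update y q b) = M' y) (ψ : State W) :
    onWire q M (onWire q M' ψ) = onWire q (fun y => M y * M' y) ψ := by
  funext y
  simp only [onWire, Function.update_self, Function.update_idem, h, Matrix.mul_apply,
    Finset.mul_sum, Finset.sum_mul]
  rw [Finset.sum_comm]
  simp only [mul_assoc]

theorem onWire_one (q : W) (ψ : State W) : onWire q (fun _ => 1) ψ = ψ := by
  funext y
  simp [onWire, Matrix.one_apply]

theorem onWire_add (q : W) (M : (W → Bool) → Matrix Bool Bool ℂ) (ψ ψ' : State W) :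
    onWire q M (fun y => ψ y + ψ' y) = fun y => onWire q M ψ y + onWire q M ψ' y := by
  funext y
  simp only [onWire, mul_add, Finset.sum_add_distrib]

theorem onWire_smul (q : W) (M : (W → Bool) → Matrix Bool Bool ℂ) (r : ℂ) (ψ : State W) :
    onWire q M (fun y => r * ψ y) = fun y => r * onWire q M ψ y := by
  funext y
  simp only [onWire, Finset.mul_sum]
  exact Finset.sum_congr rfl fun b _ => by ring

/-- Apply a Hadamard gate to each of the listed qubits. -/
def hadLayer (l : List W) (ψ : State W) : State W :=
  l.foldl (fun ψ q => onWire q (fun _ => hadamard) ψ) ψ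

theorem hadLayer_cons (q : W) (l : List W) (ψ : State W) :
    hadLayer (q :: l) ψ = hadLayer l (onWire q (fun _ => hadamard) ψ) := rfl

theorem hadLayer_singleton (q : W) (ψ : State W) :
    hadLayer [q] ψ = onWire q (fun _ => hadamard) ψ := rfl

theorem hadLayer_append (l l' : List W) (ψ : State W) :
    hadLayer (l ++ l') ψ = hadLayer l' (hadLayer l ψ) := List.foldl_append

/-- In reverse order each Hadamard gate meets itself, so no commutation between different qubits is
needed. -/
theorem hadLayer_reverse (l : List W) (ψ : State W) : hadLayer l (hadLayer l.reverse ψ) = ψ := by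
  induction l generalizing ψ with
  | nil => rfl
  | cons q l ih =>
    rw [List.reverse_cons, hadLayer_append, hadLayer_cons]
    change hadLayer l (onWire q _ (onWire q _ _)) = ψ
    rw [onWire_onWire _ _ _ fun _ _ => rfl]
    simp only [hadamard_mul_self]
    rw [onWire_one, ih]

theorem hadLayer_linear (l : List W) (r r' : ℂ) (ψ ψ' : State W) :
    hadLayer l (fun y => r * ψ y + r' * ψ' y) =
      fun y => r * hadLayer l ψ y + r' * hadLayer l ψ' y := by
  induction l generalizing ψ ψ' with
  | nil => rfl
  | cons q l ih =>
    simp only [hadLayer_cons]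
    rw [onWire_add, onWire_smul, onWire_smul, ih]

variable [Fintype W]

theorem sum_mul_onWire_hadamard (q : W) (α ψ : State W) :
    ∑ y, α y * onWire q (fun _ => hadamard) ψ y =
      ∑ y, onWire q (fun _ => hadamard) α y * ψ y := by
  rw [sum_eq_half_sum_update q, sum_eq_half_sum_update q
    (fun y => onWire q (fun _ => hadamard) α y * ψ y)]
  congr 1
  refine Finset.sum_congr rfl fun y _ => ?_
  simp only [onWire, Function.update_self, Function.update_idem, Fintype.sum_bool,
    hadamard_symm true false]
  ring

/-- Transposition reverses a product of symmetric matrices. With `α` the zero basis state, this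
expresses the amplitude of `|0…0⟩` after the layer through the sum of all amplitudes. -/
theorem sum_mul_hadLayer_reverse (l : List W) (α ψ : State W) :
    ∑ y, α y * hadLayer l.reverse ψ y = ∑ y, hadLayer l α y * ψ y := by
  induction l generalizing α ψ with
  | nil => rfl
  | cons q l ih =>
    rw [List.reverse_cons, hadLayer_append]
    simp only [hadLayer_singleton]
    rw [sum_mul_onWire_hadamard, ih, hadLayer_cons]

open Classical in
theorem hadLayer_basisState_zero (l : List W) (hl : l.Nodup) :
    hadLayer l (basisState fun _ => false) =
      fun y => if ∀ q, q ∉ l → y q = false then ((1 / Real.sqrt 2 : ℝ) : ℂ) ^ l.length else 0 := by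
  induction l using List.reverseRecOn with
  | nil =>
    funext y
    simp [hadLayer, basisState, funext_iff]
  | append_singleton l q ih =>
    rw [List.nodup_append] at hl
    have hq : q ∉ l := fun h => hl.2.2 q h q (by simp) rfl
    rw [hadLayer_append, hadLayer_singleton, ih hl.1]
    funext y
    have ht : ¬ ∀ p, p ∉ l → Function.update y q true p = false := by
      intro h
      simpa using h q hq
    have hf : (∀ p, p ∉ l → Function.update y q false p = false) ↔
        ∀ p, p ∉ l ++ [q] → y p = false := by
      refine forall_congr' fun p => ?_
      by_cases hp : p = q
      · subst hp; simp
      · simp [hp]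
    simp only [onWire, Fintype.sum_bool, if_neg ht, mul_zero, zero_add, hf, hadamard,
      Bool.and_false, Bool.false_eq_true, if_false, mul_ite, List.length_append,
      List.length_singleton, pow_succ']

end Hadamard

/-! ### Grover search -/

section Circuits

variable {N c a : ℕ}

/-- Hadamard gates on the listed qubits of the register `out`. -/
def hadCircuit (l : List (Fin (idxLen N))) : Circuit N c (Wire (idxLen N) c a) :=
  l.map fun j => Gate.one ⟨hadamard, hadamard_mem⟩ (.out j)

theorem runOn_hadCircuit (val : Format c) (x : Fin N → Bits c) (l : List (Fin (idxLen N)))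
    (φ : State (Fin (idxLen N))) :
    runOn val x (hadCircuit l) (embed c a φ) = embed c a (hadLayer l φ) := by
  induction l generalizing φ with
  | nil => rfl
  | cons j l ih =>
    rw [hadLayer_cons, ← ih, ← onWire_embed j (fun _ => hadamard) (fun _ => hadamard)
      (fun _ _ => rfl)]
    rfl

/-- The register which holds the qubit `ind` and the register `qry`. -/
def flagQry : Option (Fin c) → Wire (idxLen N) c a
  | none => .ind
  | some j => .qry j

theorem flagQry_ne (k : Option (Fin c)) : (flagQry k : Wire (idxLen N) c a) ≠ .rot := by
  cases k <;> simp [flagQry]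

/-- The indicator gate from `out` to `ind`. -/
def indGate (S : Finset (Fin N)) : Gate N c (Wire (idxLen N) c a) :=
  Gate.ind S outReg Wire.ind (fun _ e => by injection e)

/-- The query gate from `out` to `qry`. -/
def queryGate : Gate N c (Wire (idxLen N) c a) :=
  Gate.query qryReg outReg (fun _ _ e => by injection e)

/-- The action of `indGate` on basis states. -/
def indPerm (S : Finset (Fin N)) : (Wire (idxLen N) c a → Bool) → Wire (idxLen N) c a → Bool :=
  indMap S outReg Wire.ind

/-- The action of `queryGate` on basis states. -/
def queryPerm (x : Fin N → Bits c) :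
    (Wire (idxLen N) c a → Bool) → Wire (idxLen N) c a → Bool :=
  queryMap x qryReg outReg

theorem apply_indGate (val : Format c) (x : Fin N → Bits c) (S : Finset (Fin N))
    (ψ : State (Wire (idxLen N) c a)) :
    (indGate S).apply val x ψ = fun y => ψ (indPerm S y) := apply_ind _ _ _ _ _ _ _

theorem apply_queryGate (val : Format c) (x : Fin N → Bits c)
    (ψ : State (Wire (idxLen N) c a)) :
    queryGate.apply val x ψ = fun y => ψ (queryPerm x y) := apply_query _ _ _ _ _ _

theorem indPerm_indPerm (S : Finset (Fin N)) (y : Wire (idxLen N) c a → Bool) :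
    indPerm S (indPerm S y) = y := indMap_indMap _ _ _ (fun _ e => by injection e) _

theorem queryPerm_queryPerm (x : Fin N → Bits c) (y : Wire (idxLen N) c a → Bool) :
    queryPerm x (queryPerm x y) = y := queryMap_queryMap _ _ _ (fun _ _ e => by injection e) _

theorem indPerm_ind (S : Finset (Fin N)) (y : Wire (idxLen N) c a → Bool) :
    indPerm S y .ind = xor (y .ind) (decide (¬ ∃ s ∈ S, y ∘ outReg = encode s)) := by
  simp [indPerm, indMap]

theorem indPerm_of_ne (S : Finset (Fin N)) (y : Wire (idxLen N) c a → Bool)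
    {q : Wire (idxLen N) c a} (hq : q ≠ .ind) : indPerm S y q = y q :=
  Function.update_of_ne hq _ _

theorem indPerm_comp_out (S : Finset (Fin N)) (y : Wire (idxLen N) c a → Bool) :
    indPerm S y ∘ outReg = y ∘ outReg := by
  funext j
  exact indPerm_of_ne S y (by simp [outReg_apply])

theorem queryPerm_comp_out (x : Fin N → Bits c) (y : Wire (idxLen N) c a → Bool) :
    queryPerm x y ∘ outReg = y ∘ outReg :=
  queryMap_comp x _ _ (fun _ _ e => by injection e) y

theorem queryPerm_qry (x : Fin N → Bits c) (y : Wire (idxLen N) c a → Bool) (j : Fin c) :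
    queryPerm x y (.qry j) = xor (y (.qry j)) (entryAt x (y ∘ outReg) j) := by
  have : ∀ j' : Fin c, (qryReg j' : Wire (idxLen N) c a) = .qry j ↔ j' = j := by
    intro j'; simp [qryReg_apply]
  simp [queryPerm, queryMap, this]

theorem queryPerm_of_ne (x : Fin N → Bits c) (y : Wire (idxLen N) c a → Bool)
    {q : Wire (idxLen N) c a} (hq : ∀ j, q ≠ .qry j) : queryPerm x y q = y q := by
  have : ∀ j' : Fin c, (qryReg j' : Wire (idxLen N) c a) ≠ q := fun j' e => hq j' e.symm
  simp [queryPerm, queryMap, this]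

variable (A : Finset (Fin N)) (V : Bits c → Prop) [DecidablePred V]

/-- Flip the sign of the indices in `A` whose entries satisfy `V`. -/
def oracleCircuit : Circuit N c (Wire (idxLen N) c a) :=
  [queryGate, indGate A] ++
    signCircuit flagQry Wire.rot flagQry_ne
      (fun u => u none = false ∧ V (fun j => u (some j))) ++ [indGate A, queryGate]

/-- The register contents `z` encode an index in `A` whose entry satisfies `V`. -/
def Marked (x : Fin N → Bits c) (z : Bits (idxLen N)) : Prop :=
  ∃ i ∈ A, z = encode i ∧ V (x i)

instance (x : Fin N → Bits c) (z : Bits (idxLen N)) : Decidable (Marked A V x z) :=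
  inferInstanceAs (Decidable (∃ i ∈ A, z = encode i ∧ V (x i)))

/-- After the query and the indicator gate, `ind` and `qry` hold all that decides whether the index
is marked. The indicator gate flips outside `A`, so `ind = 0` means membership, and contents that
encode no index are never marked. The qubit `rot` is the clean work qubit. -/
theorem runOn_oracleCircuit (val : Format c) (x : Fin N → Bits c) (φ : State (Fin (idxLen N))) :
    runOn val x (oracleCircuit A V) (embed c a φ) =
      embed c a (fun z => (if Marked A V x z then -1 else 1) * φ z) := by
  obtain ⟨D, hD, hD'⟩ := exists_actsDiag_signCircuit val x
    (flagQry : Option (Fin c) → Wire (idxLen N) c a) Wire.rot flagQry_ne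
    (fun u => u none = false ∧ V (fun j => u (some j)))
  have h := ActsDiag.conj (P := [queryGate, indGate A]) (P' := [indGate A, queryGate])
    (f := fun y => queryPerm x (indPerm A y)) (g := fun y => indPerm A (queryPerm x y))
    (fun y => by simp only [indPerm_indPerm, queryPerm_queryPerm])
    (fun ψ => by rw [runOn_cons, runOn_cons, runOn_nil, apply_queryGate, apply_indGate])
    (fun ψ => by rw [runOn_cons, runOn_cons, runOn_nil, apply_indGate, apply_queryGate]) hD
  refine h.embed _ (fun y hy => ?_) φ
  rw [hD']
  · have e1 : (indPerm A (queryPerm x y) ∘ flagQry) none =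
        decide (¬ ∃ s ∈ A, y ∘ outReg = encode s) := by
      simp only [Function.comp_apply, flagQry]
      rw [indPerm_ind, queryPerm_comp_out, queryPerm_of_ne x y (by simp), hy.2.1, Bool.false_xor]
    have e2 : (fun j => (indPerm A (queryPerm x y) ∘ flagQry) (some j)) =
        entryAt x (y ∘ outReg) := by
      funext j
      simp only [Function.comp_apply, flagQry]
      rw [indPerm_of_ne _ _ (by simp), queryPerm_qry, hy.2.2.1, Bool.false_xor]
    rw [e1, e2]
    congr 1
    apply propext
    simp only [decide_eq_false_iff_not, not_not]
    constructor
    · rintro ⟨⟨i, hi, e⟩, hv⟩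
      rw [e, entryAt_encode] at hv
      exact ⟨i, hi, e, hv⟩
    · rintro ⟨i, hi, e, hv⟩
      refine ⟨⟨i, hi, e⟩, ?_⟩
      rwa [e, entryAt_encode]
  · rw [indPerm_of_ne _ _ (by simp), queryPerm_of_ne x y (by simp), hy.1]

/-- The reflection about the state `|0…0⟩` of the register `out`. -/
def reflectZero : Circuit N c (Wire (idxLen N) c a) :=
  [indGate (Finset.univ.filter fun i => (i : ℕ) = 0)] ++
    [Gate.one ⟨Matrix.diagonal fun b => if b then -1 else 1,
      diagonal_mem fun b => by cases b <;> simp⟩ .ind] ++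
    [indGate (Finset.univ.filter fun i => (i : ℕ) = 0)]

theorem eq_encode_zero_iff (hN : 0 < N) (z : Bits (idxLen N)) :
    (∃ s ∈ Finset.univ.filter (fun i : Fin N => (i : ℕ) = 0), z = encode s) ↔
      z = fun _ => false := by
  have h0 : encode (⟨0, hN⟩ : Fin N) = fun _ => false := by
    funext j; simp [encode]
  constructor
  · rintro ⟨s, hs, rfl⟩
    rw [← h0]
    congr 1
    exact Fin.ext (by simpa using hs)
  · rintro rfl
    exact ⟨⟨0, hN⟩, by simp, h0.symm⟩

/-- The sign falls on everything except index `0`, including contents that encode no index. The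
condition `0 < N` makes the zero string an index. -/
theorem runOn_reflectZero (hN : 0 < N) (val : Format c) (x : Fin N → Bits c)
    (φ : State (Fin (idxLen N))) :
    runOn val x reflectZero (embed c a φ) =
      embed c a (fun z => (if z = fun _ => false then 1 else -1) * φ z) := by
  have h := ActsDiag.conj (val := val) (x := x) (W := Wire (idxLen N) c a)
    (P := [indGate (Finset.univ.filter fun i => (i : ℕ) = 0)])
    (P' := [indGate (Finset.univ.filter fun i => (i : ℕ) = 0)])
    (f := indPerm _) (g := indPerm _) (indPerm_indPerm _)
    (fun ψ => by rw [runOn_cons, runOn_nil, apply_indGate])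
    (fun ψ => by rw [runOn_cons, runOn_nil, apply_indGate])
    (actsDiag_diagonal val x (d := fun b => if b then -1 else 1)
      (fun b => by cases b <;> simp) Wire.ind)
  refine h.embed _ (fun y hy => ?_) φ
  rw [indPerm_ind, hy.2.1, Bool.false_xor]
  simp only [decide_eq_true_eq, eq_encode_zero_iff hN, ite_not]

/-- The reflection about the uniform superposition in the register `out`. -/
def diffusion : Circuit N c (Wire (idxLen N) c a) :=
  hadCircuit (List.finRange (idxLen N)).reverse ++ reflectZero ++
    hadCircuit (List.finRange (idxLen N))

theorem hadLayer_finRange_zero (n : ℕ) :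
    hadLayer (List.finRange n) (basisState fun _ => false) =
      fun _ => ((1 / Real.sqrt 2 : ℝ) : ℂ) ^ n := by
  rw [hadLayer_basisState_zero _ (List.nodup_finRange n)]
  funext y
  simp

/-- Conjugating `2 |0⟩⟨0| - 1` by the Hadamard layer gives `2 |s⟩⟨s| - 1`, where `s` is uniform over
all `2 ^ idxLen N` register contents rather than over the `N` indices. -/
theorem runOn_diffusion (hN : 0 < N) (val : Format c) (x : Fin N → Bits c)
    (φ : State (Fin (idxLen N))) :
    runOn val x diffusion (embed c a φ) =
      embed c a (fun z => 2 / 2 ^ idxLen N * ∑ z', φ z' - φ z) := by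
  rw [diffusion, runOn_append, runOn_append, runOn_hadCircuit, runOn_reflectZero hN,
    runOn_hadCircuit]
  congr 1
  set χ := hadLayer (List.finRange (idxLen N)).reverse φ with hχ
  have h0 : χ (fun _ => false) = ((1 / Real.sqrt 2 : ℝ) : ℂ) ^ idxLen N * ∑ z, φ z := by
    have h := sum_mul_hadLayer_reverse (List.finRange (idxLen N)) (basisState fun _ => false) φ
    rw [hadLayer_finRange_zero, ← Finset.mul_sum, ← hχ] at h
    rw [← h]
    simp [basisState]
  have h1 : (fun z => (if z = fun _ => false then (1 : ℂ) else -1) * χ z) =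
      fun z => 2 * χ (fun _ => false) * basisState (fun _ => false) z + (-1) * χ z := by
    funext z
    by_cases hz : z = fun _ => false
    · subst hz; simp [basisState]; ring
    · simp [basisState, hz]
  rw [h1, hadLayer_linear, hadLayer_reverse, hadLayer_finRange_zero, h0]
  funext z
  have h2 : ((1 / Real.sqrt 2 : ℝ) : ℂ) ^ idxLen N * ((1 / Real.sqrt 2 : ℝ) : ℂ) ^ idxLen N =
      1 / 2 ^ idxLen N := by
    rw [← mul_pow, ← Complex.ofReal_mul, div_mul_div_comm, Real.mul_self_sqrt (by norm_num)]
    simp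
  linear_combination 2 * (∑ z, φ z) * h2

/-- Grover search with `t` iterations. -/
def groverCircuit : ℕ → Circuit N c (Wire (idxLen N) c a)
  | 0 => hadCircuit (List.finRange (idxLen N))
  | t + 1 => groverCircuit t ++ oracleCircuit A V ++ diffusion

/-- The gates of an oracle call that are not counted by the size of the index register. -/
def oracleSize (c : ℕ) : ℕ := 2 ^ (c + 1) * (2 * (c + 1) + 1)

theorem length_groverCircuit_le (t : ℕ) :
    (groverCircuit (a := a) A V t).length ≤
      idxLen N + t * (2 * idxLen N + oracleSize c + 7) := by
  induction t with
  | zero => simp [groverCircuit, hadCircuit]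
  | succ t ih =>
    have h := length_signCircuit_le (N := N) (c := c)
      (flagQry : Option (Fin c) → Wire (idxLen N) c a) Wire.rot flagQry_ne
      (fun u => u none = false ∧ V (fun j => u (some j)))
    rw [Fintype.card_option, Fintype.card_fin] at h
    change _ ≤ oracleSize c at h
    simp only [groverCircuit, oracleCircuit, diffusion, reflectZero, hadCircuit,
      List.length_append, List.length_map, List.length_reverse, List.length_finRange,
      List.length_cons, List.length_nil]
    rw [add_mul]
    omega

theorem queryCount_hadCircuit (l : List (Fin (idxLen N))) :
    queryCount (hadCircuit (c := c) (a := a) l) = 0 := by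
  refine queryCount_eq_zero fun g hg => ?_
  obtain ⟨j, -, rfl⟩ := List.mem_map.1 hg
  rfl

theorem queryCount_groverCircuit (t : ℕ) :
    queryCount (groverCircuit (a := a) A V t) = 2 * t := by
  induction t with
  | zero => exact queryCount_hadCircuit _
  | succ t ih =>
    simp only [groverCircuit, oracleCircuit, diffusion, queryCount_append, queryCount_hadCircuit,
      queryCount_signCircuit, ih]
    rfl

end Circuits

/-! ### Success probability, uniformity and cost of Grover runs -/

section Search

variable {N c a : ℕ} (A : Finset (Fin N)) (V : Bits c → Prop) [DecidablePred V]

/-- The indices in `A` whose entries satisfy `V`. -/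
def markedSet (x : Fin N → Bits c) : Finset (Fin N) := A.filter fun i => V (x i)

theorem marked_encode_iff (x : Fin N → Bits c) (i : Fin N) :
    Marked A V x (encode i) ↔ i ∈ markedSet A V x := by
  simp only [Marked, markedSet, Finset.mem_filter]
  constructor
  · rintro ⟨j, hj, e, hv⟩
    rw [encode_injective e]
    exact ⟨hj, hv⟩
  · rintro ⟨hi, hv⟩
    exact ⟨i, hi, rfl, hv⟩

theorem sum_marked {β : Type} [AddCommMonoid β] (x : Fin N → Bits c) (f : Bits (idxLen N) → β) :
    ∑ z, (if Marked A V x z then f z else 0) = ∑ i ∈ markedSet A V x, f (encode i) := by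
  rw [← Finset.sum_filter]
  symm
  refine Finset.sum_bij (fun i _ => encode i) ?_ (fun _ _ _ _ e => encode_injective e) ?_
    (fun _ _ => rfl)
  · intro i hi
    simp [marked_encode_iff, hi]
  · intro z hz
    obtain ⟨i, hi, e, hv⟩ := (Finset.mem_filter.1 hz).2
    exact ⟨i, by simp [markedSet, hi, hv], e.symm⟩

/-- The angle `θ` with `sin² θ = r / 2ⁿ`. -/
def groverAngle (n r : ℕ) : ℝ := Real.arcsin (Real.sqrt (r / 2 ^ n))

theorem sin_groverAngle {n r : ℕ} (h : r < 2 ^ n) :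
    Real.sin (groverAngle n r) = Real.sqrt (r / 2 ^ n) := by
  have h1 : (r : ℝ) / 2 ^ n ≤ 1 := by
    rw [div_le_one (by positivity)]
    exact_mod_cast h.le
  refine Real.sin_arcsin ?_ (Real.sqrt_le_one.2 h1)
  linarith [Real.sqrt_nonneg ((r : ℝ) / 2 ^ n)]

theorem sin_sq_groverAngle {n r : ℕ} (h : r < 2 ^ n) :
    Real.sin (groverAngle n r) ^ 2 = r / 2 ^ n := by
  rw [sin_groverAngle h, Real.sq_sqrt (by positivity)]

theorem cos_groverAngle_ne_zero {n r : ℕ} (h : r < 2 ^ n) : Real.cos (groverAngle n r) ≠ 0 := by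
  intro h0
  have h1 := Real.sin_sq_add_cos_sq (groverAngle n r)
  rw [h0, sin_sq_groverAngle h, zero_pow two_ne_zero, add_zero,
    div_eq_one_iff_eq (by positivity)] at h1
  have : r = 2 ^ n := by exact_mod_cast h1
  omega

theorem sin_groverAngle_ne_zero {n r : ℕ} (h : r < 2 ^ n) (hr : 0 < r) :
    Real.sin (groverAngle n r) ≠ 0 := by
  rw [sin_groverAngle h]
  positivity

/-- The state after `t` Grover iterations, for the angle `θ`. -/
def groverState (x : Fin N → Bits c) (θ : ℝ) (t : ℕ) : State (Fin (idxLen N)) := fun z =>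
  (((1 / Real.sqrt 2) ^ idxLen N * if Marked A V x z then Real.sin ((2 * t + 1) * θ) / Real.sin θ
    else Real.cos ((2 * t + 1) * θ) / Real.cos θ : ℝ) : ℂ)

theorem sum_groverState_flip (x : Fin N → Bits c) (p q : ℝ) :
    ∑ z : Bits (idxLen N), (if Marked A V x z then -p else q) =
      2 ^ idxLen N * q - (markedSet A V x).card * (p + q) := by
  have h : ∀ z, (if Marked A V x z then -p else q) = q - if Marked A V x z then p + q else 0 := by
    intro z; split_ifs <;> ring
  simp only [h, Finset.sum_sub_distrib]
  rw [sum_marked A V x fun _ => p + q]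
  simp [mul_add]

/-- Oracle and diffusion preserve the plane spanned by the uniform superpositions of marked and of
unmarked contents, and rotate it by `2 θ`. Both kinds of contents must exist for the divisions by
`sin θ` and `cos θ` to make sense. -/
theorem output_groverCircuit (val : Format c) (x : Fin N → Bits c)
    (hr : 0 < (markedSet A V x).card) (hN : (markedSet A V x).card < N) (t : ℕ) :
    output val x (groverCircuit A V t) = embed c a
      (groverState A V x (groverAngle (idxLen N) (markedSet A V x).card) t) := by
  have hr2 : (markedSet A V x).card < 2 ^ idxLen N :=
    hN.trans_le (Nat.le_pow_clog (by norm_num) N)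
  have hs := sin_groverAngle_ne_zero hr2 hr
  have hc := cos_groverAngle_ne_zero hr2
  have hs2 := sin_sq_groverAngle hr2
  set r := (markedSet A V x).card with hr_def
  set θ := groverAngle (idxLen N) r with hθ
  induction t with
  | zero =>
    rw [output_eq_runOn, basisState_zero_eq_embed, groverCircuit, runOn_hadCircuit,
      hadLayer_finRange_zero]
    congr 1
    funext z
    simp [groverState, div_self hs, div_self hc]
  | succ t ih =>
    rw [output_eq_runOn] at ih ⊢
    rw [groverCircuit, runOn_append, runOn_append, ih, runOn_oracleCircuit,
      runOn_diffusion (by omega)]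
    congr 1
    funext z
    set α := (2 * t + 1) * θ with hα
    have h1 : ∀ z, (if Marked A V x z then (-1 : ℂ) else 1) * groverState A V x θ t z =
        (((1 / Real.sqrt 2) ^ idxLen N * if Marked A V x z then -(Real.sin α / Real.sin θ)
          else Real.cos α / Real.cos θ : ℝ) : ℂ) := by
      intro z
      rw [groverState, ← hα]
      split_ifs <;> push_cast <;> ring
    simp only [h1]
    rw [← Complex.ofReal_sum, ← Finset.mul_sum, sum_groverState_flip, ← hr_def, groverState]
    have h2 : (2 / 2 ^ idxLen N : ℂ) = ((2 / 2 ^ idxLen N : ℝ) : ℂ) := by push_cast; rfl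
    rw [h2, ← Complex.ofReal_mul, ← Complex.ofReal_sub]
    congr 1
    have h3 : (2 * ((t + 1 : ℕ) : ℝ) + 1) * θ = α + 2 * θ := by
      rw [hα]; push_cast; ring
    rw [h3]
    -- Up to normalisation, this is twice the mean amplitude after the sign flip.
    have h4 : 2 / 2 ^ idxLen N * (2 ^ idxLen N * (Real.cos α / Real.cos θ) -
        r * (Real.sin α / Real.sin θ + Real.cos α / Real.cos θ)) =
        2 * Real.cos (α + θ) := by
      have h5 : (r : ℝ) = 2 ^ idxLen N * Real.sin θ ^ 2 := by
        rw [hs2]; field_simp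
      rw [h5, Real.cos_add]
      field_simp
      have := Real.sin_sq_add_cos_sq θ
      linear_combination (-Real.cos α) * this
    -- With `β = α + θ` the goals become `sin (β + θ) = 2 cos β sin θ + sin (β - θ)` and `cos (β +
    -- θ) = 2 cos β cos θ - cos (β - θ)`.
    have h6 : α + 2 * θ = (α + θ) + θ := by ring
    have h7 : Real.sin α = Real.sin (α + θ - θ) := by rw [add_sub_cancel_right]
    have h8 : Real.cos α = Real.cos (α + θ - θ) := by rw [add_sub_cancel_right]
    rw [mul_left_comm, h4, ← mul_sub]
    congr 1
    split_ifs
    · rw [h6, h7, Real.sin_add (α + θ), Real.sin_sub]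
      field_simp
      ring
    · rw [h6, h8, Real.cos_add (α + θ), Real.cos_sub]
      field_simp
      ring

/-- One run of Grover search, followed by a check of the measured index. -/
def groverRun (t : ℕ) : Algo N c (Option (Fin N × Bits c)) :=
  .run (Wire (idxLen N) c 0) (groverCircuit A V t) fun y =>
    if h : Nat.ofBits (y ∘ outReg) < N then
      (Algo.readEntry ⟨Nat.ofBits (y ∘ outReg), h⟩).bind fun b =>
        .ret (if ⟨Nat.ofBits (y ∘ outReg), h⟩ ∈ A ∧ V b then
          some (⟨Nat.ofBits (y ∘ outReg), h⟩, b) else none)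
    else .ret none

/-- The algorithm returns each element of `T` together with its entry with the same probability,
the sum of these probabilities being `s`, and otherwise returns `none`. -/
def SearchesUniformly (val : Format c) (x : Fin N → Bits c) (T : Finset (Fin N)) (s : ℝ)
    (B : Algo N c (Option (Fin N × Bits c))) : Prop :=
  ∀ F, B.expect val x F = s * ((∑ i ∈ T, F (some (i, x i))) / T.card) + (1 - s) * F none

theorem expect_groverRun_next (val : Format c) (x : Fin N → Bits c)
    (F : Option (Fin N × Bits c) → ℝ) (t : ℕ) :
    (groverRun A V t).expect val x F =
      ∑ y, ‖output val x (groverCircuit (a := 0) A V t) y‖ ^ 2 *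
        (F none + if Marked A V x (y ∘ outReg) then
          (if h : Nat.ofBits (y ∘ outReg) < N then
            F (some (⟨_, h⟩, x ⟨Nat.ofBits (y ∘ outReg), h⟩)) - F none else 0) else 0) := by
  rw [groverRun, Algo.expect]
  refine Finset.sum_congr rfl fun y _ => ?_
  congr 1
  split_ifs with h hm hm
  · rw [Algo.expect_bind, Algo.expect_readEntry, Algo.expect]
    rw [← encode_ofBits _ h, marked_encode_iff] at hm
    rw [if_pos (by simpa [markedSet] using hm)]
    ring
  · rw [Algo.expect_bind, Algo.expect_readEntry, Algo.expect]
    rw [← encode_ofBits _ h, marked_encode_iff] at hm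
    rw [if_neg (by simpa [markedSet] using hm), add_zero]
  · rw [Algo.expect, add_zero]
  · rw [Algo.expect, add_zero]

theorem groverRun_of_no_marked (val : Format c) (x : Fin N → Bits c) (t : ℕ)
    (h : markedSet A V x = ∅) : SearchesUniformly val x (markedSet A V x) 0 (groverRun A V t) := by
  intro F
  rw [expect_groverRun_next]
  have : ∀ z, ¬ Marked A V x z := by
    rintro z ⟨i, hi, -, hv⟩
    have : i ∈ markedSet A V x := by simp [markedSet, hi, hv]
    simp [h] at this
  simp only [this, if_false, add_zero]
  rw [← Finset.sum_mul, normSq_output]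
  ring

/-- All marked amplitudes are equal, so a measured marked index is uniform. With `sin² θ = r / 2ⁿ`
the total probability of the `r` marked indices is `sin² ((2 t + 1) θ)`. -/
theorem searchesUniformly_groverRun (val : Format c) (x : Fin N → Bits c)
    (hr : 0 < (markedSet A V x).card) (hN : (markedSet A V x).card < N) (t : ℕ) :
    SearchesUniformly val x (markedSet A V x)
      (Real.sin ((2 * t + 1) * groverAngle (idxLen N) (markedSet A V x).card) ^ 2)
      (groverRun A V t) := by
  intro F
  have hr2 : (markedSet A V x).card < 2 ^ idxLen N :=
    hN.trans_le (Nat.le_pow_clog (by norm_num) N)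
  have hs := sin_groverAngle_ne_zero hr2 hr
  have hs2 := sin_sq_groverAngle hr2
  rw [expect_groverRun_next]
  simp only [mul_add, Finset.sum_add_distrib]
  rw [← Finset.sum_mul, normSq_output, output_groverCircuit A V val x hr hN]
  let G : Bits (idxLen N) → ℝ := fun z => if h : Nat.ofBits z < N then
    F (some (⟨_, h⟩, x ⟨Nat.ofBits z, h⟩)) - F none else 0
  have key := sum_embed (c := c) (a := 0)
    (groverState A V x (groverAngle (idxLen N) (markedSet A V x).card) t)
    (fun y => if Marked A V x (y ∘ outReg) then G (y ∘ outReg) else 0)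
  refine (congrArg _ (key.trans (Finset.sum_congr rfl fun z _ =>
    mul_ite (Marked A V x z) _ (G z) 0))).trans ?_
  simp only [mul_zero]
  rw [sum_marked]
  set r := (markedSet A V x).card with hr_def
  set θ := groverAngle (idxLen N) r with hθ
  have hr' : (r : ℝ) ≠ 0 := by exact_mod_cast hr.ne'
  have h1 : ∀ i ∈ markedSet A V x, ‖groverState A V x θ t (encode i)‖ ^ 2 * G (encode i) =
      Real.sin ((2 * t + 1) * θ) ^ 2 / r * (F (some (i, x i)) - F none) := by
    intro i hi
    have hi' : Nat.ofBits (encode i) < N := by rw [ofBits_encode]; exact i.2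
    have hi2 : (⟨Nat.ofBits (encode i), hi'⟩ : Fin N) = i := Fin.ext (ofBits_encode i)
    have hG : G (encode i) = F (some (i, x i)) - F none := by
      simp only [G]
      rw [dif_pos hi', hi2]
    have e2 : ((1 / Real.sqrt 2) ^ idxLen N) ^ 2 = 1 / 2 ^ idxLen N := by
      rw [← pow_mul, mul_comm, pow_mul, div_pow, Real.sq_sqrt (by norm_num), one_pow,
        one_div_pow]
    rw [hG]
    congr 1
    rw [groverState, if_pos ((marked_encode_iff A V x i).2 hi), Complex.norm_real,
      Real.norm_eq_abs, sq_abs, mul_pow, e2, div_pow, hs2]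
    field_simp
  rw [Finset.sum_congr rfl h1]
  rw [← Finset.mul_sum, Finset.sum_sub_distrib, Finset.sum_const, nsmul_eq_mul, ← hr_def]
  field_simp
  ring

/-- Two queries per iteration, and one to check the measured index. -/
theorem costLE_groverRun (t : ℕ) :
    Algo.CostLE (2 * idxLen N + oracleSize c + 8) (2 * t + 1) (groverRun A V t) := by
  have hnext : ∀ y : Wire (idxLen N) c 0 → Bool, Algo.CostLE (idxLen N + 1) 1
      (if h : Nat.ofBits (y ∘ outReg) < N then
        (Algo.readEntry ⟨Nat.ofBits (y ∘ outReg), h⟩).bind fun b =>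
          .ret (if ⟨Nat.ofBits (y ∘ outReg), h⟩ ∈ A ∧ V b then
            some (⟨Nat.ofBits (y ∘ outReg), h⟩, b) else none)
      else .ret none : Algo N c (Option (Fin N × Bits c))) := by
    intro y
    split_ifs
    · exact Algo.costLE_bind (q' := 0) (Algo.costLE_readEntry _) _ fun b => Algo.costLE_ret _ _ _
    · exact Algo.costLE_ret _ _ _
  constructor
  · rw [groverRun, Algo.queries, queryCount_groverCircuit]
    exact Nat.add_le_add_left (Finset.sup_le fun y _ => (hnext y).1) _
  · rw [groverRun, Algo.gates]
    have h1 := length_groverCircuit_le (a := 0) A V t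
    have h2 := Finset.sup_le (s := Finset.univ) fun (y : Wire (idxLen N) c 0 → Bool) _ =>
      (hnext y).2
    refine (Nat.add_le_add h1 h2).trans ?_
    nlinarith [Nat.zero_le (t * (2 * idxLen N + oracleSize c + 9))]

/-- Grover runs with the listed numbers of iterations, until a marked index is found. -/
def searchList : List ℕ → Algo N c (Option (Fin N × Bits c))
  | [] => .ret none
  | t :: l => (groverRun A V t).bind fun o => o.elim (searchList l) fun p => .ret (some p)

/-- The second search runs only if the first returns nothing, and both are uniform on the same set,
so their mixture is uniform too. -/
theorem SearchesUniformly.bind {val : Format c} {x : Fin N → Bits c} {T : Finset (Fin N)}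
    {s s' : ℝ} {B B' : Algo N c (Option (Fin N × Bits c))}
    (h : SearchesUniformly val x T s B) (h' : SearchesUniformly val x T s' B') :
    SearchesUniformly val x T (s + (1 - s) * s')
      (B.bind fun o => o.elim B' fun p => .ret (some p)) := by
  intro F
  rw [Algo.expect_bind, h]
  simp only [Option.elim_some, Option.elim_none, Algo.expect, h' F]
  ring

theorem searchList_of_no_marked (val : Format c) (x : Fin N → Bits c) (l : List ℕ)
    (h : markedSet A V x = ∅) :
    SearchesUniformly val x (markedSet A V x) 0 (searchList A V l) := by
  induction l with
  | nil => intro F; simp [searchList, Algo.expect]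
  | cons t l ih => simpa [searchList] using (groverRun_of_no_marked A V val x t h).bind ih

/-- Every run with `t` iterations multiplies the failure probability by at most `3 / 4`, and the
other runs cannot increase it. -/
theorem exists_searchesUniformly_searchList (val : Format c) (x : Fin N → Bits c)
    (hr : 0 < (markedSet A V x).card) (hN : (markedSet A V x).card < N) (t : ℕ)
    (ht : 1 / 4 ≤
      Real.sin ((2 * t + 1) * groverAngle (idxLen N) (markedSet A V x).card) ^ 2)
    (l : List ℕ) :
    ∃ s, 0 ≤ s ∧ s ≤ 1 ∧ 1 - s ≤ (3 / 4) ^ l.count t ∧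
      SearchesUniformly val x (markedSet A V x) s (searchList A V l) := by
  induction l with
  | nil => exact ⟨0, le_rfl, zero_le_one, by simp, fun F => by simp [searchList, Algo.expect]⟩
  | cons t' l ih =>
    obtain ⟨s, h0, h1, hs, h⟩ := ih
    have hrun := searchesUniformly_groverRun A V val x hr hN t'
    set u := Real.sin ((2 * t' + 1) * groverAngle (idxLen N) (markedSet A V x).card) ^ 2 with hu
    have hu0 : 0 ≤ u := sq_nonneg _
    have hu1 : u ≤ 1 := Real.sin_sq_le_one _
    refine ⟨u + (1 - u) * s, by nlinarith, by nlinarith, ?_, hrun.bind h⟩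
    have e : 1 - (u + (1 - u) * s) = (1 - u) * (1 - s) := by ring
    rw [e, List.count_cons]
    split_ifs with htt
    · have htt' : t' = t := by simpa using htt
      have hu4 : 1 / 4 ≤ u := by rw [hu, htt']; exact ht
      rw [pow_succ']
      exact mul_le_mul (by linarith) hs (by linarith) (by norm_num)
    · rw [add_zero]
      nlinarith

theorem costLE_searchList (l : List ℕ) :
    Algo.CostLE (2 * idxLen N + oracleSize c + 8) (l.map fun t => 2 * t + 1).sum
      (searchList A V l) := by
  induction l with
  | nil => exact Algo.costLE_ret _ _ _
  | cons t l ih =>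
    rw [List.map_cons, List.sum_cons]
    refine Algo.costLE_bind (costLE_groverRun A V t) _ fun o => ?_
    cases o with
    | none => exact ih
    | some p => exact Algo.costLE_ret _ _ _

end Search

/-! ### A potential function for sets of large entries -/

section Potential

variable {N : ℕ} (w : Fin N → ℝ≥0)

theorem minOn_le {H : Finset (Fin N)} {i : Fin N} (hi : i ∈ H) : minOn w H ≤ w i := by
  rw [minOn, dif_pos ⟨i, hi⟩]
  exact Finset.inf'_le w hi

theorem le_minOn {H : Finset (Fin N)} (hH : H.Nonempty) {t : ℝ≥0} (h : ∀ i ∈ H, t ≤ w i) :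
    t ≤ minOn w H := by
  rw [minOn, dif_pos hH]
  exact Finset.le_inf' hH w h

theorem exists_eq_minOn {H : Finset (Fin N)} (hH : H.Nonempty) : ∃ m ∈ H, w m = minOn w H := by
  rw [minOn, dif_pos hH]
  obtain ⟨m, hm, e⟩ := Finset.exists_mem_eq_inf' hH w
  exact ⟨m, hm, e.symm⟩

theorem minOn_congr {w' : Fin N → ℝ≥0} {H : Finset (Fin N)} (h : ∀ i ∈ H, w i = w' i) :
    minOn w H = minOn w' H := by
  by_cases hH : H.Nonempty
  · rw [minOn, minOn, dif_pos hH, dif_pos hH]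
    exact Finset.inf'_congr hH rfl h
  · rw [minOn, minOn, dif_neg hH, dif_neg hH]

/-- The indices outside `H` whose entries exceed the minimum over `H`. -/
def better (H : Finset (Fin N)) : Finset (Fin N) := Hᶜ.filter fun i => minOn w H < w i

/-- The indices whose entries exceed that of `i`. -/
def above (i : Fin N) : Finset (Fin N) := Finset.univ.filter fun j => w i < w j

theorem mem_better {H : Finset (Fin N)} {i : Fin N} :
    i ∈ better w H ↔ i ∉ H ∧ minOn w H < w i := by
  simp [better]

theorem mem_above {i j : Fin N} : j ∈ above w i ↔ w i < w j := by simp [above]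

theorem isTop_iff_better_eq_empty {H : Finset (Fin N)} (hH : H.Nonempty) :
    IsTop H.card w H ↔ better w H = ∅ := by
  rw [Finset.eq_empty_iff_forall_notMem]
  constructor
  · rintro ⟨-, h⟩ j hj
    rw [mem_better] at hj
    exact hj.2.not_ge (le_minOn w hH fun i hi => h i hi j hj.1)
  · intro h
    refine ⟨rfl, fun i hi j hj => ?_⟩
    have := h j
    rw [mem_better, not_and, not_lt] at this
    exact (this hj).trans (minOn_le w hi)

variable {w} {H : Finset (Fin N)} {m j : Fin N}

theorem card_exchange (hm : m ∈ H) (hj : j ∉ H) : (insert j (H.erase m)).card = H.card := by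
  rw [Finset.card_insert_of_notMem (fun h => hj (Finset.mem_of_mem_erase h)),
    Finset.card_erase_add_one hm]

theorem minOn_exchange (hj : j ∈ better w H) :
    minOn w H ≤ minOn w (insert j (H.erase m)) := by
  refine le_minOn w (Finset.insert_nonempty _ _) fun i hi => ?_
  rcases Finset.mem_insert.1 hi with rfl | hi
  · exact ((mem_better w).1 hj).2.le
  · exact minOn_le w (Finset.mem_of_mem_erase hi)

/-- The minimum does not decrease, so the only candidate for a new better index is the discarded
`m`; its entry is the old minimum, which does not exceed the new one. -/
theorem better_exchange (hm' : w m = minOn w H) (hj : j ∈ better w H) :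
    better w (insert j (H.erase m)) ⊆ (better w H).erase j := by
  intro i hi
  rw [mem_better, Finset.mem_insert, not_or, Finset.mem_erase, not_and] at hi
  obtain ⟨⟨hij, hiH⟩, hlt⟩ := hi
  have hlt' := (minOn_exchange (m := m) hj).trans_lt hlt
  have him : i ≠ m := by
    rintro rfl
    rw [hm'] at hlt'
    exact lt_irrefl _ hlt'
  exact Finset.mem_erase.2 ⟨hij, (mem_better w).2 ⟨hiH him, hlt'⟩⟩

theorem card_better_exchange (hm' : w m = minOn w H) (hj : j ∈ better w H) :
    (better w (insert j (H.erase m))).card + 1 ≤ (better w H).card := by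
  have h := Finset.card_le_card (better_exchange hm' hj)
  rw [Finset.card_erase_of_mem hj] at h
  have : 0 < (better w H).card := Finset.card_pos.2 ⟨j, hj⟩
  omega

theorem better_subset_above (hm' : w m = minOn w H) : better w H ⊆ above w m := by
  intro i hi
  rw [mem_above, hm']
  exact ((mem_better w).1 hi).2

/-- An index that beats the minimum is better or lies in `H` without `m`. The rank of the discarded
element is thus known up to `|H|`. -/
theorem card_above_lt (hm : m ∈ H) (hm' : w m = minOn w H) :
    (above w m).card < (better w H).card + H.card := by
  have h : above w m ⊆ better w H ∪ H.erase m := by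
    intro i hi
    rw [mem_above] at hi
    rw [Finset.mem_union, mem_better, Finset.mem_erase]
    by_cases hiH : i ∈ H
    · exact Or.inr ⟨by rintro rfl; exact lt_irrefl _ hi, hiH⟩
    · exact Or.inl ⟨hiH, hm' ▸ hi⟩
  have h1 := (Finset.card_le_card h).trans (Finset.card_union_le _ _)
  have h2 := Finset.card_erase_add_one hm
  omega

theorem card_above_mono {i k : Fin N} (h : w i ≤ w k) : (above w k).card ≤ (above w i).card := by
  refine Finset.card_le_card fun l hl => ?_
  rw [mem_above] at hl ⊢
  exact h.trans_lt hl

/-- At most `|above m| - s` elements above `m` have at least `s` elements above them. -/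
theorem card_filter_above_add_le (s : ℕ)
    (hne : ((above w m).filter fun i => s ≤ (above w i).card).Nonempty) :
    ((above w m).filter fun i => s ≤ (above w i).card).card + s ≤ (above w m).card := by
  -- For `i` of largest entry in the filtered set, the indices above `i` number at least `s`, lie
  -- above `m`, and are outside that set.
  obtain ⟨i, hi, hmax⟩ := Finset.exists_max_image _ w hne
  rw [Finset.mem_filter, mem_above] at hi
  have hdisj : Disjoint ((above w m).filter fun i => s ≤ (above w i).card) (above w i) := by
    rw [Finset.disjoint_left]
    intro l hl hl'
    exact (hmax l hl).not_gt ((mem_above w).1 hl')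
  have hsub : ((above w m).filter fun i => s ≤ (above w i).card) ∪ above w i ⊆ above w m := by
    refine Finset.union_subset (Finset.filter_subset _ _) fun l hl => ?_
    rw [mem_above] at hl ⊢
    exact hi.1.trans hl
  have := Finset.card_le_card hsub
  rw [Finset.card_union_of_disjoint hdisj] at this
  omega

variable (w)

/-- The contribution to the potential of an element of `H`, for `|H| = K`. -/
def rankWeight (K : ℕ) (i : Fin N) : ℝ :=
  1 / Real.sqrt K - 1 / Real.sqrt ((above w i).card + K)

/-- A bound on the expected number of queries that it takes to turn `H` into a set of positions
of largest entries by exchanges. -/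
def potential (H : Finset (Fin N)) : ℝ :=
  Real.sqrt N * (1200 * ∑ i ∈ H, rankWeight w H.card i +
    180 * Real.sqrt (min (better w H).card (4 * H.card) : ℕ))

theorem rankWeight_nonneg {K : ℕ} (hK : 0 < K) (i : Fin N) : 0 ≤ rankWeight w K i := by
  rw [rankWeight, sub_nonneg]
  refine one_div_le_one_div_of_le (by positivity) (Real.sqrt_le_sqrt ?_)
  linarith [Nat.cast_nonneg (α := ℝ) (above w i).card]

theorem rankWeight_le {K : ℕ} (i : Fin N) : rankWeight w K i ≤ 1 / Real.sqrt K := by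
  rw [rankWeight, sub_le_self_iff]
  positivity

theorem potential_nonneg {H : Finset (Fin N)} (hH : H.Nonempty) : 0 ≤ potential w H := by
  have : 0 ≤ ∑ i ∈ H, rankWeight w H.card i :=
    Finset.sum_nonneg fun i _ => rankWeight_nonneg w (Finset.card_pos.2 hH) i
  unfold potential
  positivity

/-- Each of the `|H|` weights is at most `1 / √|H|`, and the truncation bounds the second root by `2
√|H|`; `1560 = 1200 + 2 * 180`. -/
theorem potential_le (H : Finset (Fin N)) :
    potential w H ≤ 1560 * Real.sqrt (H.card * N) := by
  have h1 : ∑ i ∈ H, rankWeight w H.card i ≤ Real.sqrt H.card := by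
    refine (Finset.sum_le_card_nsmul H _ (1 / Real.sqrt H.card)
      fun i _ => rankWeight_le w i).trans_eq ?_
    rw [nsmul_eq_mul, mul_one_div, Real.div_sqrt]
  have h2 : Real.sqrt (min (better w H).card (4 * H.card) : ℕ) ≤ 2 * Real.sqrt H.card := by
    refine (Real.sqrt_le_sqrt (Nat.cast_le.2 (min_le_right _ _))).trans_eq ?_
    rw [Nat.cast_mul, Real.sqrt_mul (by positivity), show ((4 : ℕ) : ℝ) = 2 ^ 2 by norm_num,
      Real.sqrt_sq (by norm_num)]
  rw [potential, Real.sqrt_mul (by positivity)]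
  have h3 : 0 ≤ Real.sqrt (N : ℝ) := Real.sqrt_nonneg _
  nlinarith [mul_le_mul_of_nonneg_left h1 h3, mul_le_mul_of_nonneg_left h2 h3]

theorem sqrt_sub_sqrt_ge {r : ℝ} (hr : 1 ≤ r) :
    1 / (2 * Real.sqrt r) ≤ Real.sqrt r - Real.sqrt (r - 1) := by
  have h0 : 0 < Real.sqrt r := Real.sqrt_pos.2 (by linarith)
  have h1 := Real.sqrt_nonneg (r - 1)
  have h2 := Real.mul_self_sqrt (show 0 ≤ r by linarith)
  have h3 := Real.mul_self_sqrt (show 0 ≤ r - 1 by linarith)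
  rw [div_le_iff₀ (by positivity)]
  nlinarith [sq_nonneg (Real.sqrt r - Real.sqrt (r - 1))]

/-- Halving the rank shrinks `√(a + K)` by a factor `1.26`, because `a ≥ 4 K`. Moreover `a + K ≤ r +
2 K ≤ 1.5 r ≤ 1.23² r`, and `0.26 / 1.23 ≥ 0.21`. -/
theorem inv_sqrt_gap {r K a ρ : ℝ} (hK : 0 < K) (hrK : 4 * K ≤ r) (ha : r ≤ a)
    (ha' : a ≤ r + K) (hρ : 0 ≤ ρ) (hρa : 2 * ρ ≤ a) :
    0.21 / Real.sqrt r ≤ 1 / Real.sqrt (ρ + K) - 1 / Real.sqrt (a + K) := by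
  have hr : 0 < r := by linarith
  have hA : 0 < a + K := by linarith
  have h1 : Real.sqrt (ρ + K) ≤ Real.sqrt (a + K) / 1.26 := by
    rw [Real.sqrt_le_left (by positivity), div_pow, Real.sq_sqrt hA.le, le_div_iff₀ (by norm_num)]
    nlinarith
  have h2 : Real.sqrt (a + K) ≤ 1.23 * Real.sqrt r := by
    rw [Real.sqrt_le_left (by positivity), mul_pow, Real.sq_sqrt hr.le]
    nlinarith
  have hs : 0 < Real.sqrt (a + K) := Real.sqrt_pos.2 hA
  have hsr : 0 < Real.sqrt r := Real.sqrt_pos.2 hr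
  have h3 : 1.26 / Real.sqrt (a + K) ≤ 1 / Real.sqrt (ρ + K) := by
    have := one_div_le_one_div_of_le (Real.sqrt_pos.2 (by linarith : 0 < ρ + K)) h1
    rwa [one_div_div] at this
  have h4 : 0.21 / Real.sqrt r ≤ 0.26 / Real.sqrt (a + K) := by
    rw [div_le_div_iff₀ hsr hs]
    nlinarith
  have h5 : 1.26 / Real.sqrt (a + K) - 1 / Real.sqrt (a + K) = 0.26 / Real.sqrt (a + K) := by
    rw [← sub_div]; norm_num
  linarith

variable {w}

theorem sum_exchange (f : Fin N → ℝ) (hm : m ∈ H) (hj : j ∉ H) :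
    ∑ i ∈ insert j (H.erase m), f i = ∑ i ∈ H, f i - (f m - f j) := by
  rw [Finset.sum_insert (fun h => hj (Finset.mem_of_mem_erase h)), ← Finset.add_sum_erase H f hm]
  ring

theorem potential_exchange (hm : m ∈ H) (hj : j ∉ H) :
    potential w (insert j (H.erase m)) = Real.sqrt N * (1200 * ∑ i ∈ H, rankWeight w H.card i +
      180 * Real.sqrt (min (better w (insert j (H.erase m))).card (4 * H.card) : ℕ)) -
      1200 * Real.sqrt N * (rankWeight w H.card m - rankWeight w H.card j) := by
  rw [potential, card_exchange hm hj, sum_exchange _ hm hj]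
  ring

theorem rankWeight_exchange (hm' : w m = minOn w H) (hj : j ∈ better w H) (K : ℕ) (hK : 0 < K) :
    rankWeight w K j ≤ rankWeight w K m := by
  have h := card_above_mono (w := w) (i := m) (k := j) (hm' ▸ ((mem_better w).1 hj).2.le)
  rw [rankWeight, rankWeight]
  have : 1 / Real.sqrt ((above w m).card + K) ≤ 1 / Real.sqrt ((above w j).card + K) := by
    refine one_div_le_one_div_of_le (by positivity) (Real.sqrt_le_sqrt ?_)
    have : ((above w j).card : ℝ) ≤ (above w m).card := by exact_mod_cast h
    linarith
  linarith

/-- The amortisation step. The constant `90` matches the cost of a search: `searchBound 0 k ≤ 30 * 3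
^ k`, where `3 ^ k ≤ 3 √(N / r)` for the level `k` of `r`. The potential has two terms because
neither suffices alone: rank weights need not drop enough when `r` is comparable to `K`, and the
truncated root need not move when `r > 4 K`. -/
theorem sum_potential_exchange_le (hm : m ∈ H) (hm' : w m = minOn w H) :
    ∑ j ∈ better w H, potential w (insert j (H.erase m)) ≤
      (better w H).card * (potential w H - 90 * Real.sqrt (N / (better w H).card)) := by
  rcases Nat.eq_zero_or_pos (better w H).card with h0 | hpos
  · rw [Finset.card_eq_zero] at h0
    simp [h0]
  set r := (better w H).card with hr
  set K := H.card with hK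
  have hKpos : 0 < K := Finset.card_pos.2 ⟨m, hm⟩
  have hrR : (1 : ℝ) ≤ r := by exact_mod_cast hpos
  have hN := Real.sqrt_nonneg (N : ℝ)
  have hsr : 0 < Real.sqrt (r : ℝ) := Real.sqrt_pos.2 (by linarith)
  rw [Real.sqrt_div (Nat.cast_nonneg N)]
  have hnot : ∀ j ∈ better w H, j ∉ H := fun j hj => ((mem_better w).1 hj).1
  have hmono : ∀ j ∈ better w H, 0 ≤ rankWeight w K m - rankWeight w K j := fun j hj =>
    sub_nonneg.2 (rankWeight_exchange hm' hj K hKpos)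
  rcases le_or_gt r (4 * K) with hc | hc
  -- Here every exchange suffices: `180 (√r - √(r - 1)) ≥ 90 / √r`, and the rank weights do not
  -- increase.
  · have hstep : ∀ j ∈ better w H, potential w (insert j (H.erase m)) ≤
        potential w H - 90 * (Real.sqrt N / Real.sqrt r) := by
      intro j hj
      rw [potential_exchange hm (hnot j hj), potential, ← hr, ← hK, min_eq_left hc]
      have h1 : Real.sqrt (min (better w (insert j (H.erase m))).card (4 * K) : ℕ) ≤
          Real.sqrt (r - 1) := by
        refine Real.sqrt_le_sqrt ?_
        have h2 := card_better_exchange hm' hj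
        have h3 : min (better w (insert j (H.erase m))).card (4 * K) + 1 ≤ r :=
          (Nat.add_le_add_right (min_le_left _ _) 1).trans h2
        have : ((min (better w (insert j (H.erase m))).card (4 * K) : ℕ) : ℝ) + 1 ≤ r := by
          exact_mod_cast h3
        linarith
      have h2 := sqrt_sub_sqrt_ge hrR
      have h3 : Real.sqrt N / Real.sqrt r = 2 * (Real.sqrt N * (1 / (2 * Real.sqrt r))) := by
        field_simp
      rw [h3]
      have h4 := mul_le_mul_of_nonneg_left h1 hN
      have h5 := mul_le_mul_of_nonneg_left h2 hN
      have h6 := mul_nonneg hN (hmono j hj)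
      linarith
    calc _ ≤ ∑ j ∈ better w H, (potential w H - 90 * (Real.sqrt N / Real.sqrt r)) :=
          Finset.sum_le_sum hstep
      _ = _ := by rw [Finset.sum_const, nsmul_eq_mul]
  -- Here the root term is only known not to increase, and the gain is the average drop of the rank
  -- weights.
  · have hstep : ∀ j ∈ better w H, potential w (insert j (H.erase m)) ≤
        potential w H - 1200 * Real.sqrt N * (rankWeight w K m - rankWeight w K j) := by
      intro j hj
      rw [potential_exchange hm (hnot j hj), potential]
      refine sub_le_sub_right (mul_le_mul_of_nonneg_left ?_ hN) _
      have : min (better w (insert j (H.erase m))).card (4 * H.card) ≤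
          min (better w H).card (4 * H.card) :=
        min_le_min_right _ ((Nat.le_succ _).trans (card_better_exchange hm' hj))
      have := Real.sqrt_le_sqrt (Nat.cast_le (α := ℝ).2 this)
      linarith
    set a := (above w m).card with ha
    have hra : r ≤ a := Finset.card_le_card (better_subset_above hm')
    have har : a < r + K := card_above_lt hm hm'
    set good := (better w H).filter fun j => 2 * (above w j).card ≤ a with hgood
    -- At most `a / 2` of the indices above `m` have more than `a / 2` indices above them, and `a ≤
    -- r + K ≤ 5 r / 4`. So at least `r - 5 r / 8` better indices are good.
    have hgc : 3 * r ≤ 8 * good.card := by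
      have hsplit := Finset.card_filter_add_card_filter_not (s := better w H)
        (fun j => 2 * (above w j).card ≤ a)
      have hbad : 2 * ((better w H).filter fun j => ¬ 2 * (above w j).card ≤ a).card ≤ a := by
        have hsub : ((better w H).filter fun j => ¬ 2 * (above w j).card ≤ a) ⊆
            (above w m).filter fun i => a / 2 + 1 ≤ (above w i).card := by
          intro i hi
          rw [Finset.mem_filter] at hi ⊢
          exact ⟨better_subset_above hm' hi.1, by omega⟩
        rcases Finset.eq_empty_or_nonempty
          ((above w m).filter fun i => a / 2 + 1 ≤ (above w i).card) with he | hne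
        · rw [he, Finset.subset_empty] at hsub
          rw [hsub, Finset.card_empty]
          omega
        · have h1 := card_filter_above_add_le _ hne
          have h2 := Finset.card_le_card hsub
          omega
      rw [← hgood] at hsplit
      omega
    have hgap : ∀ j ∈ good, 0.21 / Real.sqrt r ≤ rankWeight w K m - rankWeight w K j := by
      intro j hj
      have hj' := (Finset.mem_filter.1 hj).2
      have := inv_sqrt_gap (r := r) (K := K) (a := a) (ρ := (above w j).card)
        (by exact_mod_cast hKpos) (by exact_mod_cast hc.le) (by exact_mod_cast hra)
        (by exact_mod_cast har.le) (Nat.cast_nonneg _) (by exact_mod_cast hj')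
      simp only [rankWeight]
      linarith
    have hsum : good.card * (0.21 / Real.sqrt r) ≤
        ∑ j ∈ better w H, (rankWeight w K m - rankWeight w K j) := by
      calc (good.card * (0.21 / Real.sqrt r) : ℝ) = ∑ j ∈ good, 0.21 / Real.sqrt r := by
            rw [Finset.sum_const, nsmul_eq_mul]
        _ ≤ ∑ j ∈ good, (rankWeight w K m - rankWeight w K j) := Finset.sum_le_sum hgap
        _ ≤ _ := Finset.sum_le_sum_of_subset_of_nonneg (Finset.filter_subset _ _)
            fun j hj _ => hmono j hj
    have hgR : 3 * (r : ℝ) ≤ 8 * good.card := by exact_mod_cast hgc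
    calc _ ≤ ∑ j ∈ better w H, (potential w H -
          1200 * Real.sqrt N * (rankWeight w K m - rankWeight w K j)) := Finset.sum_le_sum hstep
      _ = r * potential w H -
          1200 * Real.sqrt N * ∑ j ∈ better w H, (rankWeight w K m - rankWeight w K j) := by
        rw [Finset.sum_sub_distrib, Finset.sum_const, nsmul_eq_mul, Finset.mul_sum]
      _ ≤ _ := by
        have hq : 0 ≤ 1 / Real.sqrt (r : ℝ) := by positivity
        -- The constants fit: `1200 * 0.21 * 3 / 8 = 94.5 ≥ 90`.
        have h1 : 3 * r * (0.21 * (1 / Real.sqrt r)) ≤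
            8 * ∑ j ∈ better w H, (rankWeight w K m - rankWeight w K j) := by
          have : (good.card : ℝ) * (0.21 / Real.sqrt r) =
            good.card * (0.21 * (1 / Real.sqrt r)) := by ring
          nlinarith
        have h2 := mul_le_mul_of_nonneg_left h1 hN
        have h3 : 0 ≤ Real.sqrt N * (r * (1 / Real.sqrt r)) := by positivity
        have h4 : (r : ℝ) * (potential w H - 90 * (Real.sqrt N / Real.sqrt r)) =
          r * potential w H - 90 * (Real.sqrt N * (r * (1 / Real.sqrt r))) := by ring
        rw [h4]
        nlinarith

end Potential

/-! ### Search with an unknown number of marked indices -/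

section Level

theorem two_pow_idxLen_le {N : ℕ} (hN : 0 < N) : 2 ^ idxLen N ≤ 2 * N := by
  rcases Nat.lt_or_ge 1 N with h | h
  · have h1 := Nat.pow_pred_clog_lt_self (b := 2) (by norm_num) h
    have h2 : 0 < Nat.clog 2 N := Nat.clog_pos (by norm_num) h
    have h3 : idxLen N = (Nat.clog 2 N).pred + 1 := (Nat.succ_pred_eq_of_pos h2).symm
    rw [h3, pow_succ]
    omega
  · have : N = 1 := by omega
    subst this
    simp [idxLen]

/-- Repeated tripling of an angle cannot jump over the interval from `π / 6` to `π / 2`, where `sin²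
≥ 1 / 4`. For the last `k` with `3 ^ k θ ≤ π / 2`, the bound `θ ≥ sin θ ≥ √(r / (2 N))` gives `3 ^ k
≤ (π / √2) √(N / r)`, and `π / √2 < 3`. -/
theorem exists_level {N r : ℕ} (hr : 0 < r) (hN : r < N) :
    ∃ k : ℕ, 1 / 4 ≤ Real.sin (3 ^ k * groverAngle (idxLen N) r) ^ 2 ∧
      (3 : ℝ) ^ k ≤ 3 * Real.sqrt (N / r) := by
  have hr2 : r < 2 ^ idxLen N := hN.trans_le (Nat.le_pow_clog (by norm_num) N)
  have hsin := sin_groverAngle hr2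
  set θ := groverAngle (idxLen N) r with hθ
  have hq : (0 : ℝ) < r / 2 ^ idxLen N := by positivity
  have hθpos : 0 < θ := Real.arcsin_pos.2 (Real.sqrt_pos.2 hq)
  have hθle : θ ≤ Real.pi / 2 := Real.arcsin_le_pi_div_two _
  have hex : ∃ k : ℕ, Real.pi / 2 < 3 ^ (k + 1) * θ := by
    obtain ⟨k, hk⟩ := pow_unbounded_of_one_lt (Real.pi / 2 / θ) (by norm_num : (1 : ℝ) < 3)
    refine ⟨k, ?_⟩
    rw [div_lt_iff₀ hθpos] at hk
    have : (0 : ℝ) < 3 ^ k * θ := by positivity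
    rw [pow_succ]
    nlinarith
  classical
  set k := Nat.find hex with hk
  have h1 : Real.pi / 2 < 3 ^ (k + 1) * θ := Nat.find_spec hex
  have h2 : 3 ^ k * θ ≤ Real.pi / 2 := by
    rcases Nat.eq_zero_or_pos k with h0 | hpos
    · rw [h0, pow_zero, one_mul]; exact hθle
    · have := Nat.find_min hex (m := k - 1) (by omega)
      rw [not_lt, Nat.sub_add_cancel hpos] at this
      exact this
  refine ⟨k, ?_, ?_⟩
  · have h3 : Real.pi / 6 ≤ 3 ^ k * θ := by
      rw [pow_succ] at h1
      linarith
    have h4 : (1 : ℝ) / 2 ≤ Real.sin (3 ^ k * θ) := by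
      rw [← Real.sin_pi_div_six]
      refine Real.sin_le_sin_of_le_of_le_pi_div_two ?_ h2 h3
      linarith [Real.pi_pos]
    nlinarith
  · have hN0 : (0 : ℝ) < N := by exact_mod_cast (by omega : 0 < N)
    have hr0 : (0 : ℝ) < r := by exact_mod_cast hr
    have h3 : Real.sqrt (r / 2 ^ idxLen N) ≤ θ := by
      rw [← hsin]; exact Real.sin_le hθpos.le
    have h4 : Real.sqrt (r / (2 * N)) ≤ Real.sqrt (r / 2 ^ idxLen N) := by
      refine Real.sqrt_le_sqrt (div_le_div_of_nonneg_left hr0.le (by positivity) ?_)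
      exact_mod_cast two_pow_idxLen_le (by omega)
    have h5 : (3 : ℝ) ^ k * Real.sqrt (r / (2 * N)) ≤ Real.pi / 2 :=
      (mul_le_mul_of_nonneg_left (h4.trans h3) (by positivity)).trans h2
    have h6 : Real.sqrt (r / (2 * N)) * Real.sqrt (N / r) = Real.sqrt (1 / 2) := by
      rw [← Real.sqrt_mul (by positivity)]
      congr 1
      field_simp
    have h7 : (0.7 : ℝ) ≤ Real.sqrt (1 / 2) := Real.le_sqrt_of_sq_le (by norm_num)
    have h8 := mul_le_mul_of_nonneg_right h5 (Real.sqrt_nonneg ((N : ℝ) / r))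
    rw [mul_assoc, h6] at h8
    have h9 : (3 : ℝ) ^ k * 0.7 ≤ 3 ^ k * Real.sqrt (1 / 2) :=
      mul_le_mul_of_nonneg_left h7 (by positivity)
    have h10 := mul_le_mul_of_nonneg_right Real.pi_lt_d2.le (Real.sqrt_nonneg ((N : ℝ) / r))
    have h11 := Real.sqrt_nonneg ((N : ℝ) / r)
    linarith

open Classical in
/-- A number `k` such that Grover search with `(3 ^ k - 1) / 2` iterations finds one of `r` marked
indices with constant probability. -/
def level (N r : ℕ) : ℕ := if h : 0 < r ∧ r < N then (exists_level h.1 h.2).choose else 0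

theorem level_spec {N r : ℕ} (hr : 0 < r) (hN : r < N) :
    1 / 4 ≤ Real.sin (3 ^ level N r * groverAngle (idxLen N) r) ^ 2 ∧
      (3 : ℝ) ^ level N r ≤ 3 * Real.sqrt (N / r) := by
  rw [level, dif_pos ⟨hr, hN⟩]
  exact (exists_level hr hN).choose_spec

/-- A bound on the expected cost of the search stages `p, p + 1, …`, when the stages from `k` on
succeed with probability at least `5 / 6`. -/
def searchBound (p k : ℕ) : ℝ := 24 * 3 ^ max p k + 6 * (3 ^ k - 3 ^ min p k)

theorem le_searchBound (p k : ℕ) : 12 * (3 : ℝ) ^ p ≤ searchBound p k := by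
  have h1 : (3 : ℝ) ^ p ≤ 3 ^ max p k := pow_le_pow_right₀ (by norm_num) (le_max_left _ _)
  have h2 : (3 : ℝ) ^ min p k ≤ 3 ^ k := pow_le_pow_right₀ (by norm_num) (min_le_right _ _)
  have h3 : (0 : ℝ) < 3 ^ p := by positivity
  unfold searchBound
  linarith

theorem searchBound_zero_le (k : ℕ) : searchBound 0 k ≤ 30 * 3 ^ k := by
  simp [searchBound]
  linarith

/-- The function `searchBound` solves the worst case of this recursion with equality. Before `k`,
with `s = 0`, the difference is `6 (3 ^ (p + 1) - 3 ^ p) = 12 * 3 ^ p`. From `k` on, with failure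
probability `1 / 6`, `12 * 3 ^ p + 24 * 3 ^ (p + 1) / 6 = 24 * 3 ^ p`. -/
theorem searchBound_step (p k : ℕ) {s : ℝ} (hs : 0 ≤ s) (h : k ≤ p → 1 - s ≤ 1 / 6) :
    12 * 3 ^ p + (1 - s) * searchBound (p + 1) k ≤ searchBound p k := by
  have h3 : (0 : ℝ) < 3 ^ p := by positivity
  rcases le_or_gt k p with hkp | hkp
  · have h1 := h hkp
    simp only [searchBound, max_eq_left hkp, min_eq_right hkp, max_eq_left (hkp.trans p.le_succ),
      min_eq_right (hkp.trans p.le_succ), sub_self, mul_zero, add_zero, pow_succ]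
    nlinarith
  · have h4 : 0 ≤ searchBound (p + 1) k := le_trans (by positivity) (le_searchBound (p + 1) k)
    have h5 : searchBound p k = 12 * 3 ^ p + searchBound (p + 1) k := by
      simp only [searchBound, max_eq_right hkp.le, min_eq_left hkp.le,
        max_eq_right (Nat.succ_le_of_lt hkp), min_eq_left (Nat.succ_le_of_lt hkp), pow_succ]
      ring
    nlinarith

/-- The numbers of iterations of the Grover runs of stage `p`. -/
def stageList (p : ℕ) : List ℕ :=
  (List.replicate 8 ((List.range (p + 1)).map fun k => (3 ^ k - 1) / 2)).flatten

theorem two_mul_iterations_add_one (k : ℕ) : 2 * ((3 ^ k - 1) / 2) + 1 = 3 ^ k := by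
  have h : 3 ^ k % 2 = 1 := by simp [Nat.pow_mod]
  generalize 3 ^ k = y at h ⊢
  omega

theorem eight_le_count_stageList {k p : ℕ} (h : k ≤ p) :
    8 ≤ (stageList p).count ((3 ^ k - 1) / 2) := by
  have h1 : 0 < ((List.range (p + 1)).map fun k => (3 ^ k - 1) / 2).count ((3 ^ k - 1) / 2) :=
    List.count_pos_iff.2 (List.mem_map.2 ⟨k, by simpa using Nat.lt_succ_of_le h, rfl⟩)
  rw [stageList, List.count_flatten, List.map_replicate, List.sum_replicate, smul_eq_mul]
  omega

/-- A geometric series: `8 (3 ^ (p + 1) - 1) / 2 ≤ 12 * 3 ^ p`. -/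
theorem sum_stageList_le (p : ℕ) : ((stageList p).map fun t => 2 * t + 1).sum ≤ 12 * 3 ^ p := by
  have h1 : ∀ p, 2 * ((List.range (p + 1)).map fun k => 3 ^ k).sum + 1 = 3 ^ (p + 1) := by
    intro p
    induction p with
    | zero => simp
    | succ p ih =>
      rw [List.range_succ, List.map_append, List.sum_append, List.map_singleton,
        List.sum_singleton, pow_succ 3 (p + 1)]
      omega
  have h2 : (fun t => 2 * t + 1) ∘ (fun k => (3 ^ k - 1) / 2) = fun k => 3 ^ k :=
    funext two_mul_iterations_add_one
  rw [stageList, List.map_flatten, List.map_replicate, List.map_map, h2, List.sum_flatten,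
    List.map_replicate, List.sum_replicate, smul_eq_mul]
  have := h1 p
  rw [pow_succ] at this
  omega

end Level

/-! ### Finding the positions of the largest entries -/

section Top

variable {N c : ℕ} (val : Format c)

/-- The gates per query of the search algorithms. -/
def gateFactor (N c : ℕ) : ℕ := 2 * idxLen N + oracleSize c + 8

/-- Stage `p` of the search for an index outside `s.1` whose entry exceeds those at the
positions in `s.1`, which are stored in `s.2`. -/
def searchStage (p : ℕ) (s : Finset (Fin N) × (Fin N → Bits c)) :
    Algo N c (Option (Fin N × Bits c)) :=
  searchList s.1ᶜ (fun v => minOn (vec val s.2) s.1 < val v) (stageList p)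

/-- Remove a position of a smallest entry. -/
def dropMin (w : Fin N → ℝ≥0) (H : Finset (Fin N)) : Finset (Fin N) :=
  if h : H.Nonempty then H.erase (exists_eq_minOn w h).choose else H

/-- Replace a position of a smallest entry. -/
def exchange (s : Finset (Fin N) × (Fin N → Bits c)) (q : Fin N × Bits c) :
    Finset (Fin N) × (Fin N → Bits c) :=
  (insert q.1 (dropMin (vec val s.2) s.1), Function.update s.2 q.1 q.2)

/-- Improve a set of positions by exchanges, making at most `b` queries. -/
def improve (b p : ℕ) (s : Finset (Fin N) × (Fin N → Bits c)) :
    Algo N c (Finset (Fin N) × (Fin N → Bits c)) :=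
  if h : 12 * 3 ^ p ≤ b then
    (searchStage val p s).bind fun o =>
      o.elim (improve (b - 12 * 3 ^ p) (p + 1) s) fun q =>
        improve (b - 12 * 3 ^ p) 0 (exchange val s q)
  else .ret s
termination_by b
decreasing_by all_goals
  have : 0 < 3 ^ p := Nat.pow_pos (by norm_num)
  omega

theorem costLE_improve (b p : ℕ) (s : Finset (Fin N) × (Fin N → Bits c)) :
    Algo.CostLE (gateFactor N c) b (improve val b p s) := by
  induction b using Nat.strong_induction_on generalizing p s with
  | _ b ih =>
    rw [improve]
    split_ifs with h
    · have h3 : 0 < 3 ^ p := Nat.pow_pos (by norm_num)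
      have hstage := (costLE_searchList s.1ᶜ (fun v => minOn (vec val s.2) s.1 < val v)
        (stageList p)).mono (sum_stageList_le p)
      have := Algo.costLE_bind hstage (fun o =>
        o.elim (improve val (b - 12 * 3 ^ p) (p + 1) s) fun q =>
          improve val (b - 12 * 3 ^ p) 0 (exchange val s q)) (q' := b - 12 * 3 ^ p) (by
        intro o
        cases o with
        | none => exact ih _ (by omega) _ _
        | some q => exact ih _ (by omega) _ _)
      rw [Nat.add_sub_cancel' h] at this
      exact this
    · exact Algo.costLE_ret _ _ _

variable (x : Fin N → Bits c)

/-- The set of positions has `K` elements and the stored entries are correct. -/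
def Valid (K : ℕ) (s : Finset (Fin N) × (Fin N → Bits c)) : Prop :=
  s.1.card = K ∧ ∀ i ∈ s.1, s.2 i = x i

variable {val x} {K : ℕ} {s : Finset (Fin N) × (Fin N → Bits c)}

theorem Valid.minOn_eq (h : Valid x K s) : minOn (vec val s.2) s.1 = minOn (vec val x) s.1 :=
  minOn_congr _ fun i hi => by rw [vec, vec, h.2 i hi]

theorem Valid.markedSet_eq (h : Valid x K s) :
    markedSet s.1ᶜ (fun v => minOn (vec val s.2) s.1 < val v) x = better (vec val x) s.1 := by
  simp only [h.minOn_eq]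
  rfl

theorem Valid.card_better_lt (h : Valid x K s) (hK : 0 < K) :
    (better (vec val x) s.1).card < N := by
  have h1 : (better (vec val x) s.1).card ≤ s.1ᶜ.card :=
    Finset.card_le_card (Finset.filter_subset _ _)
  have h2 := Finset.card_compl_add_card s.1
  rw [Fintype.card_fin, h.1] at h2
  omega

theorem Valid.exists_exchange (h : Valid x K s) (hK : 0 < K) :
    ∃ m ∈ s.1, vec val x m = minOn (vec val x) s.1 ∧
      ∀ q, (exchange val s q).1 = insert q.1 (s.1.erase m) := by
  have hne : s.1.Nonempty := Finset.card_pos.1 (h.1 ▸ hK)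
  have hm := (exists_eq_minOn (vec val s.2) hne).choose_spec
  refine ⟨(exists_eq_minOn (vec val s.2) hne).choose, hm.1, ?_, ?_⟩
  · rw [← h.minOn_eq]
    refine Eq.trans ?_ hm.2
    rw [vec, vec, h.2 _ hm.1]
  · intro q
    rw [exchange, dropMin, dif_pos hne]

theorem Valid.exchange (h : Valid x K s) (hK : 0 < K) {i : Fin N}
    (hi : i ∈ better (vec val x) s.1) : Valid x K (exchange val s (i, x i)) := by
  obtain ⟨m, hm, -, e⟩ := h.exists_exchange (val := val) hK
  constructor
  · rw [e, card_exchange hm ((mem_better _).1 hi).1, h.1]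
  · intro k hk
    rw [e] at hk
    rcases eq_or_ne k i with rfl | hki
    · simp [StatePrep.exchange]
    · refine (Function.update_of_ne hki _ _).trans ?_
      exact h.2 k (Finset.mem_of_mem_erase (Finset.mem_of_mem_insert_of_ne hk hki))

theorem Valid.exists_searchesUniformly (h : Valid x K s) (hK : 0 < K) (p : ℕ) :
    ∃ σ, 0 ≤ σ ∧ σ ≤ 1 ∧
      SearchesUniformly val x (better (vec val x) s.1) σ (searchStage val p s) ∧
      (better (vec val x) s.1 = ∅ → σ = 0) ∧
      (better (vec val x) s.1 ≠ ∅ → level N (better (vec val x) s.1).card ≤ p →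
        1 - σ ≤ 1 / 6) := by
  rw [← h.markedSet_eq (val := val)]
  by_cases he : markedSet s.1ᶜ (fun v => minOn (vec val s.2) s.1 < val v) x = ∅
  · exact ⟨0, le_rfl, zero_le_one, searchList_of_no_marked _ _ val x _ he, fun _ => rfl,
      fun h' => absurd he h'⟩
  · have hpos := Finset.card_pos.2 (Finset.nonempty_iff_ne_empty.2 he)
    have hlt : (markedSet s.1ᶜ (fun v => minOn (vec val s.2) s.1 < val v) x).card < N := by
      rw [h.markedSet_eq]
      exact h.card_better_lt hK
    have hl := (level_spec hpos hlt).1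
    rw [show (3 : ℝ) ^ level N (markedSet s.1ᶜ (fun v => minOn (vec val s.2) s.1 < val v) x).card =
      2 * ((3 ^ level N (markedSet s.1ᶜ (fun v => minOn (vec val s.2) s.1 < val v) x).card - 1) /
        2 : ℕ) + 1 from by exact_mod_cast (two_mul_iterations_add_one _).symm] at hl
    obtain ⟨σ, h0, h1, hc, hs⟩ :=
      exists_searchesUniformly_searchList _ _ val x hpos hlt _ hl (stageList p)
    refine ⟨σ, h0, h1, hs, fun h' => absurd h' he, fun _ hp => hc.trans ?_⟩
    -- Eight runs at the right number of iterations fail with probability at most `(3 / 4) ^ 8 < 1 /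
    -- 6`.
    refine (pow_le_pow_of_le_one (by norm_num) (by norm_num)
      (eight_le_count_stageList hp)).trans (by norm_num)

theorem expect_improve_of_le {b p : ℕ} (hb : 12 * 3 ^ p ≤ b)
    (F : Finset (Fin N) × (Fin N → Bits c) → ℝ) {T : Finset (Fin N)} {σ : ℝ}
    (h : SearchesUniformly val x T σ (searchStage val p s)) :
    (improve val b p s).expect val x F =
      σ * ((∑ i ∈ T, (improve val (b - 12 * 3 ^ p) 0 (exchange val s (i, x i))).expect val x F) /
        T.card) + (1 - σ) * (improve val (b - 12 * 3 ^ p) (p + 1) s).expect val x F := by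
  rw [improve, dif_pos hb, Algo.expect_bind, h]
  rfl

/-- Searches return true entries and exchanges preserve validity, so invalid states carry no weight.
This is how the invariant passes through repeated improvement. -/
theorem expect_improve_mono (hK : 0 < K) {F G : Finset (Fin N) × (Fin N → Bits c) → ℝ}
    (hFG : ∀ s, Valid x K s → F s ≤ G s) (b p : ℕ) (s : Finset (Fin N) × (Fin N → Bits c))
    (hs : Valid x K s) :
    (improve val b p s).expect val x F ≤ (improve val b p s).expect val x G := by
  induction b using Nat.strong_induction_on generalizing p s with
  | _ b ih =>
    have h3 : 0 < 3 ^ p := Nat.pow_pos (by norm_num)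
    by_cases hb : 12 * 3 ^ p ≤ b
    · obtain ⟨σ, h0, h1, hσ, -, -⟩ := hs.exists_searchesUniformly (val := val) hK p
      rw [expect_improve_of_le hb F hσ, expect_improve_of_le hb G hσ]
      have hsum := Finset.sum_le_sum fun i (hi : i ∈ better (vec val x) s.1) =>
        ih (b - 12 * 3 ^ p) (by omega) 0 _ (hs.exchange hK hi)
      have hnone := ih (b - 12 * 3 ^ p) (by omega) (p + 1) s hs
      exact add_le_add (mul_le_mul_of_nonneg_left
        (div_le_div_of_nonneg_right hsum (Nat.cast_nonneg _)) h0)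
        (mul_le_mul_of_nonneg_left hnone (by linarith))
    · rw [improve, dif_neg hb]
      exact hFG s hs

open Classical in
/-- The indicator function of the failure to find largest entries. -/
def notTop (val : Format c) (x : Fin N → Bits c) (s : Finset (Fin N) × (Fin N → Bits c)) : ℝ :=
  if better (vec val x) s.1 = ∅ then 0 else 1

theorem notTop_le_one (s : Finset (Fin N) × (Fin N → Bits c)) : notTop val x s ≤ 1 := by
  unfold notTop; split_ifs <;> norm_num

theorem notTop_nonneg (s : Finset (Fin N) × (Fin N → Bits c)) : 0 ≤ notTop val x s := by
  unfold notTop; split_ifs <;> norm_num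

/-- Without better indices no search ever succeeds, so a correct set is never changed. -/
theorem expect_improve_of_top (hK : 0 < K) (b p : ℕ) (s : Finset (Fin N) × (Fin N → Bits c))
    (hs : Valid x K s) (htop : better (vec val x) s.1 = ∅) :
    (improve val b p s).expect val x (notTop val x) = 0 := by
  induction b using Nat.strong_induction_on generalizing p with
  | _ b ih =>
    have h3 : 0 < 3 ^ p := Nat.pow_pos (by norm_num)
    by_cases hb : 12 * 3 ^ p ≤ b
    · obtain ⟨σ, -, -, hσ, hσ0, -⟩ := hs.exists_searchesUniformly (val := val) hK p
      rw [expect_improve_of_le hb _ hσ, hσ0 htop, ih (b - 12 * 3 ^ p) (by omega) (p + 1)]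
      simp
    · rw [improve, dif_neg hb]
      exact if_pos htop

/-- Markov's inequality for the process stopped at budget `b`: failure means that the budget ran
out, and the right side bounds the expected cost still to come. In it, the price `90 √(N / r)`
reserved for the current search is replaced by the cost of this search from stage `p` on. -/
theorem mul_expect_improve_le (hK : 0 < K) (b p : ℕ) (s : Finset (Fin N) × (Fin N → Bits c))
    (hs : Valid x K s) (htop : better (vec val x) s.1 ≠ ∅) :
    b * (improve val b p s).expect val x (notTop val x) ≤
      potential (vec val x) s.1 - 90 * Real.sqrt (N / (better (vec val x) s.1).card) +
        searchBound p (level N (better (vec val x) s.1).card) := by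
  induction b using Nat.strong_induction_on generalizing p s with
  | _ b ih =>
    have h3 : 0 < 3 ^ p := Nat.pow_pos (by norm_num)
    have hf1 : (improve val b p s).expect val x (notTop val x) ≤ 1 := by
      rw [← Algo.expect_const val x 1 (improve val b p s)]
      exact Algo.expect_mono val x notTop_le_one _
    set T := better (vec val x) s.1 with hT
    have hr : (0 : ℝ) < T.card :=
      Nat.cast_pos.2 (Finset.card_pos.2 (Finset.nonempty_iff_ne_empty.2 htop))
    obtain ⟨m, hm, hm', e⟩ := hs.exists_exchange (val := val) hK
    have hpot := sum_potential_exchange_le hm hm'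
    rw [← hT] at hpot
    set Q := potential (vec val x) s.1 - 90 * Real.sqrt (N / T.card) with hQ
    -- This is needed when the budget does not cover the stage; it holds because `|T| Q` dominates a
    -- sum of potentials.
    have hQ0 : 0 ≤ Q := by
      have : 0 ≤ ∑ j ∈ T, potential (vec val x) (insert j (s.1.erase m)) :=
        Finset.sum_nonneg fun j _ => potential_nonneg _ (Finset.insert_nonempty _ _)
      exact (mul_nonneg_iff_of_pos_left hr).1 (this.trans hpot)
    have hF := le_searchBound p (level N T.card)
    by_cases hb : 12 * 3 ^ p ≤ b
    · obtain ⟨σ, h0, h1, hσ, -, hσ6⟩ := hs.exists_searchesUniformly (val := val) hK p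
      have hstep := searchBound_step p (level N T.card) h0 (hσ6 htop)
      have hexp := expect_improve_of_le hb (notTop val x) hσ
      set b' := b - 12 * 3 ^ p with hb'
      have hbb : (b : ℝ) = b' + 12 * 3 ^ p := by
        have : b = b' + 12 * 3 ^ p := by omega
        exact_mod_cast this
      have hsucc : ∀ i ∈ T, b' * (improve val b' 0 (exchange val s (i, x i))).expect val x
          (notTop val x) ≤ potential (vec val x) (insert i (s.1.erase m)) := by
        intro i hi
        have hv := hs.exchange (val := val) hK hi
        rw [← e (i, x i)]
        by_cases htop' : better (vec val x) (exchange val s (i, x i)).1 = ∅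
        · rw [expect_improve_of_top hK _ _ _ hv htop', mul_zero]
          refine potential_nonneg _ ?_
          rw [e]
          exact Finset.insert_nonempty _ _
        · have h4 := ih b' (by omega) 0 _ hv htop'
          -- A new search starts at stage `0`, where its cost is at most `90 √(N / r')` for the new
          -- number `r'` of better indices; this cancels the negative term of `h4`.
          have h5 := searchBound_zero_le
            (level N (better (vec val x) (exchange val s (i, x i)).1).card)
          have h6 := (level_spec (Finset.card_pos.2 (Finset.nonempty_iff_ne_empty.2 htop'))
            (hv.card_better_lt hK)).2
          linarith
      have hnone := ih b' (by omega) (p + 1) s hs htop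
      rw [← hT, ← hQ] at hnone
      have havg : b' * ((∑ i ∈ T, (improve val b' 0 (exchange val s (i, x i))).expect val x
          (notTop val x)) / T.card) ≤ Q := by
        rw [← mul_div_assoc, div_le_iff₀ hr, Finset.mul_sum, mul_comm Q]
        exact (Finset.sum_le_sum hsucc).trans hpot
      rw [← hT] at hexp
      set avg := (∑ i ∈ T, (improve val b' 0 (exchange val s (i, x i))).expect val x
          (notTop val x)) / T.card with havg_def
      have hb'f : b' * (improve val b p s).expect val x (notTop val x) ≤
          Q + (1 - σ) * searchBound (p + 1) (level N T.card) := by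
        rw [hexp]
        nlinarith [mul_le_mul_of_nonneg_left havg h0,
          mul_le_mul_of_nonneg_left hnone (sub_nonneg.2 h1)]
      -- The part of the budget spent on this stage is weighted by a failure probability of at most
      -- one.
      have hc : (12 * 3 ^ p : ℝ) * (improve val b p s).expect val x (notTop val x) ≤
          12 * 3 ^ p := mul_le_of_le_one_right (by positivity) hf1
      rw [hbb, add_mul]
      linarith
    · have hb2 : (b : ℝ) ≤ 12 * 3 ^ p := by
        have : b ≤ 12 * 3 ^ p := by omega
        exact_mod_cast this
      have : b * (improve val b p s).expect val x (notTop val x) ≤ b :=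
        mul_le_of_le_one_right (Nat.cast_nonneg _) hf1
      linarith

/-- At stage `0` the search cost is absorbed by the negative term, which leaves the potential, and
`3120 = 2 * 1560`. The factor `notTop` on the right makes the estimate iterate. -/
theorem expect_improve_le_half (hK : 0 < K) (b : ℕ) (hb : 3120 * Real.sqrt (K * N) ≤ b)
    (s : Finset (Fin N) × (Fin N → Bits c)) (hs : Valid x K s) :
    (improve val b 0 s).expect val x (notTop val x) ≤ 1 / 2 * notTop val x s := by
  by_cases htop : better (vec val x) s.1 = ∅
  · rw [expect_improve_of_top hK b 0 s hs htop]
    exact mul_nonneg (by norm_num) (notTop_nonneg s)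
  · have h1 := mul_expect_improve_le hK b 0 s hs htop
    have h2 := searchBound_zero_le (level N (better (vec val x) s.1).card)
    have h3 := (level_spec (Finset.card_pos.2 (Finset.nonempty_iff_ne_empty.2 htop))
      (hs.card_better_lt hK)).2
    have h4 := potential_le (vec val x) s.1
    rw [hs.1] at h4
    have hn : notTop val x s = 1 := if_neg htop
    have hKN : (0 : ℝ) < K * N := by
      have : 0 < N := (Nat.zero_le _).trans_lt (hs.card_better_lt (val := val) hK)
      positivity
    have hb0 : (0 : ℝ) < b := lt_of_lt_of_le (mul_pos (by norm_num) (Real.sqrt_pos.2 hKN)) hb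
    rw [hn, mul_one, le_div_iff₀ (by norm_num)]
    have h5 : b * ((improve val b 0 s).expect val x (notTop val x) * 2) ≤ b * 1 := by linarith
    exact le_of_mul_le_mul_left h5 hb0

/-- Repeated improvement. -/
def improveRepeatedly (val : Format c) (b : ℕ) :
    ℕ → Finset (Fin N) × (Fin N → Bits c) → Algo N c (Finset (Fin N) × (Fin N → Bits c))
  | 0, s => .ret s
  | n + 1, s => (improve val b 0 s).bind (improveRepeatedly val b n)

theorem costLE_improveRepeatedly (b n : ℕ) (s : Finset (Fin N) × (Fin N → Bits c)) :
    Algo.CostLE (gateFactor N c) (n * b) (improveRepeatedly val b n s) := by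
  induction n generalizing s with
  | zero => exact Algo.costLE_ret _ _ _
  | succ n ih =>
    rw [add_mul, one_mul, add_comm]
    exact Algo.costLE_bind (costLE_improve val b 0 s) _ ih

theorem expect_improveRepeatedly_mono (hK : 0 < K)
    {F G : Finset (Fin N) × (Fin N → Bits c) → ℝ} (hFG : ∀ s, Valid x K s → F s ≤ G s) (b n : ℕ)
    (s : Finset (Fin N) × (Fin N → Bits c)) (hs : Valid x K s) :
    (improveRepeatedly val b n s).expect val x F ≤
      (improveRepeatedly val b n s).expect val x G := by
  induction n generalizing s with
  | zero => exact hFG s hs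
  | succ n ih =>
    rw [improveRepeatedly, Algo.expect_bind, Algo.expect_bind]
    exact expect_improve_mono hK ih b 0 s hs

theorem expect_improveRepeatedly_le (hK : 0 < K) (b : ℕ) (hb : 3120 * Real.sqrt (K * N) ≤ b)
    (n : ℕ) (s : Finset (Fin N) × (Fin N → Bits c)) (hs : Valid x K s) :
    (improveRepeatedly val b n s).expect val x (notTop val x) ≤
      (1 / 2) ^ n * notTop val x s := by
  induction n generalizing s with
  | zero => rw [improveRepeatedly, Algo.expect, pow_zero, one_mul]
  | succ n ih =>
    rw [improveRepeatedly, Algo.expect_bind]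
    refine (expect_improve_mono hK ih b 0 s hs).trans ?_
    rw [Algo.expect_smul, pow_succ, mul_assoc]
    exact mul_le_mul_of_nonneg_left (expect_improve_le_half hK b hb s hs) (by positivity)

/-- A top-`K` maximum finding algorithm: starting from the set `H`, improve it `n` times. -/
def findTop (val : Format c) (b n K : ℕ) (H : Finset (Fin N)) : Algo N c (Finset (Fin N)) :=
  (Algo.readList H.toList).bind fun z =>
    (improveRepeatedly val b n (H, z)).bind fun s => .ret (if s.1.card ≤ K then s.1 else ∅)

/-- The fallback to `∅` in `findTop` serves this bound: the later reading of `H` must cost at most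
`K` queries on every outcome, possible or not. -/
theorem allRet_findTop (b n K : ℕ) (H : Finset (Fin N)) :
    Algo.AllRet (fun H' => H'.card ≤ K) (findTop val b n K H) := by
  refine Algo.allRet_bind _ _ fun z => Algo.allRet_bind _ _ fun s => ?_
  change (if s.1.card ≤ K then s.1 else ∅).card ≤ K
  split_ifs with h
  · exact h
  · simp

theorem costLE_readList_gateFactor (H : Finset (Fin N)) :
    Algo.CostLE (gateFactor N c) H.card
      (Algo.readList H.toList : Algo N c (Fin N → Bits c)) := by
  have h := Algo.costLE_readList (c := c) H.toList
  rw [Finset.length_toList] at h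
  refine ⟨h.1, h.2.trans (Nat.mul_le_mul_right _ ?_)⟩
  unfold gateFactor
  omega

theorem costLE_findTop (b n K : ℕ) (H : Finset (Fin N)) :
    Algo.CostLE (gateFactor N c) (H.card + n * b) (findTop val b n K H) := by
  refine Algo.costLE_bind (costLE_readList_gateFactor H) _ fun z => ?_
  exact Algo.costLE_bind (q' := 0) (costLE_improveRepeatedly b n _) _
    fun s => Algo.costLE_ret _ _ _

theorem findsTop_findTop (hK : 0 < K) (b n : ℕ) (hb : 3120 * Real.sqrt (K * N) ≤ b) {δ : ℝ}
    (hn : (1 / 2) ^ n ≤ δ) {H : Finset (Fin N)} (hH : H.card = K) :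
    FindsTop val K δ (findTop val b n K H) := by
  intro x
  rw [Algo.prob_eq_expect, findTop, Algo.expect_bind, Algo.expect_readList, Algo.expect_bind]
  set z : Fin N → Bits c := fun i => if i ∈ H.toList then x i else fun _ => false with hz
  have hs : Valid x K (H, z) := ⟨hH, fun i hi => by simp [hz, hi]⟩
  have h1 := expect_improveRepeatedly_le (val := val) hK b hb n (H, z) hs
  have h2 : (1 / 2 : ℝ) ^ n * notTop val x (H, z) ≤ δ :=
    (mul_le_of_le_one_right (by positivity) (notTop_le_one _)).trans hn
  have h3 : (improveRepeatedly val b n (H, z)).expect val x (fun s => 1 - notTop val x s) ≥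
      1 - δ := by
    rw [Algo.expect_sub, Algo.expect_const]
    linarith
  refine h3.le.trans (expect_improveRepeatedly_mono hK (fun s hs => ?_) b n (H, z) hs)
  rw [Algo.expect, if_pos hs.1.le]
  have hne : s.1.Nonempty := Finset.card_pos.1 (hs.1 ▸ hK)
  have hiff := isTop_iff_better_eq_empty (vec val x) hne
  rw [hs.1] at hiff
  by_cases ht : better (vec val x) s.1 = ∅
  · rw [if_pos (hiff.2 ht)]
    linarith [notTop_nonneg (val := val) (x := x) s]
  · rw [notTop, if_neg ht, sub_self]
    split_ifs <;> norm_num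

end Top

/-! ### Preparation of known states -/

section Blocks

variable {n : ℕ}

/-- The bit strings which agree with `z` at the positions from `j` on. -/
def block (j : ℕ) (z : Bits n) : Finset (Bits n) :=
  Finset.univ.filter fun z' => ∀ k : Fin n, j ≤ k → z' k = z k

theorem mem_block {j : ℕ} {z z' : Bits n} :
    z' ∈ block j z ↔ ∀ k : Fin n, j ≤ k → z' k = z k := by
  simp [block]

theorem block_congr {j : ℕ} {z z' : Bits n} (h : ∀ k : Fin n, j ≤ k → z k = z' k) :
    block j z = block j z' := by
  ext y
  rw [mem_block, mem_block]
  exact forall₂_congr fun k hk => by rw [h k hk]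

theorem le_succ_iff_of_ne {j k : Fin n} (h : k ≠ j) : (j : ℕ) ≤ k ↔ (j : ℕ) + 1 ≤ k := by
  have : (k : ℕ) ≠ j := fun e => h (Fin.ext e)
  omega

theorem mem_block_update {j : Fin n} {z z' : Bits n} {b : Bool} :
    z' ∈ block j (Function.update z j b) ↔ z' j = b ∧ z' ∈ block (j + 1) z := by
  rw [mem_block, mem_block]
  constructor
  · intro h
    refine ⟨by simpa using h j le_rfl, fun k hk => ?_⟩
    have hkj : k ≠ j := by rintro rfl; omega
    simpa [hkj] using h k (by omega)
  · rintro ⟨hb, h⟩ k hk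
    by_cases hkj : k = j
    · subst hkj; simpa using hb
    · rw [Function.update_of_ne hkj]
      exact h k ((le_succ_iff_of_ne hkj).1 hk)

variable (μ : Bits n → ℝ)

/-- The sum of `μ` over a block. -/
def mass (j : ℕ) (z : Bits n) : ℝ := ∑ z' ∈ block j z, μ z'

theorem mass_succ (j : Fin n) (z : Bits n) :
    mass μ (j + 1) z =
      mass μ j (Function.update z j false) + mass μ j (Function.update z j true) := by
  have h : ∀ b, block j (Function.update z j b) = (block (j + 1) z).filter fun z' => z' j = b := by
    intro b
    ext z'
    rw [mem_block_update, Finset.mem_filter, and_comm]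
  rw [mass, mass, mass, h, h,
    ← Finset.sum_filter_add_sum_filter_not (block (j + 1) z) (fun z' => z' j = false)]
  simp only [Bool.not_eq_false]

theorem mass_zero (z : Bits n) : mass μ 0 z = μ z := by
  have : block 0 z = {z} := by
    ext z'
    rw [mem_block, Finset.mem_singleton]
    exact ⟨fun h => funext fun k => h k (Nat.zero_le _), fun h k _ => by rw [h]⟩
  rw [mass, this, Finset.sum_singleton]

theorem mass_top (z : Bits n) : mass μ n z = ∑ z', μ z' := by
  have : block n z = Finset.univ := by
    ext z'
    simp [mem_block, Nat.not_le.2 (Fin.is_lt _)]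
  rw [mass, this]

theorem mass_nonneg {μ : Bits n → ℝ} (hμ : ∀ z, 0 ≤ μ z) (j : ℕ) (z : Bits n) : 0 ≤ mass μ j z :=
  Finset.sum_nonneg fun z' _ => hμ z'

/-- The rotation angle which distributes the mass of a block to its two halves. -/
def splitAngle (j : Fin n) (z : Bits n) : ℝ :=
  Real.arccos (Real.sqrt (mass μ j (Function.update z j false) / mass μ (j + 1) z))

open Classical in
/-- The angle of the rotation of qubit `j`, depending on the contents of the register. -/
def angle (j : Fin n) (z : Bits n) : ℝ :=
  if (∀ k, k < j → z k = false) ∧ mass μ j (Function.update z j true) ≠ 0 then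
    splitAngle μ j z else 0

theorem mass_succ_update (j : Fin n) (z : Bits n) (b : Bool) :
    mass μ (j + 1) (Function.update z j b) = mass μ (j + 1) z := by
  rw [mass_succ, mass_succ]
  simp

/-- The angle is determined by the qubits other than `j`, which lets rotations of qubit `j` compose
and their flag be uncomputed. -/
theorem angle_update (j : Fin n) (z : Bits n) (b : Bool) :
    angle μ j (Function.update z j b) = angle μ j z := by
  have h : (∀ k, k < j → Function.update z j b k = false) ↔ ∀ k, k < j → z k = false :=
    forall₂_congr fun k hk => by rw [Function.update_of_ne hk.ne]
  simp only [angle, splitAngle, h, Function.update_idem, mass_succ_update]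

/-- The matrix of the rotation by the angle `t`. -/
def rotation (t : ℝ) : Matrix Bool Bool ℂ := planeMatrix (Real.cos t) (Real.sin t)

theorem rotation_mem (t : ℝ) : rotation t ∈ Matrix.unitaryGroup Bool ℂ :=
  planeMatrix_mem (by linarith [Real.sin_sq_add_cos_sq t])

theorem rotation_zero : rotation 0 = 1 := by
  ext a b
  cases a <;> cases b <;> simp [rotation, planeMatrix]

theorem rotation_mul (s t : ℝ) : rotation s * rotation t = rotation (s + t) := by
  ext a b
  cases a <;> cases b <;>
    simp only [Matrix.mul_apply, Fintype.sum_bool, rotation, planeMatrix, if_true,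
      Bool.false_eq_true, reduceCtorEq, if_false, Real.cos_add, Real.sin_add] <;>
    push_cast <;> ring

/-- Conjugation by `X` inverts a rotation, so two half rotations interleaved with CNOT gates cancel
when the control is set and add up otherwise. -/
theorem pauliX_mul_rotation_mul (t : ℝ) :
    pauliX * rotation t * (pauliX * rotation t) = 1 := by
  have e : Complex.sin t * Complex.sin t + Complex.cos t * Complex.cos t = 1 := by
    rw [← sq, ← sq, Complex.sin_sq_add_cos_sq]
  ext a b
  cases a <;> cases b <;>
    simp [Matrix.mul_apply, rotation, planeMatrix, pauliX] <;>
    first | ring1 | linear_combination e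

/-- The state after the rotations of the qubits from `j` on. -/
def partialState (j : ℕ) : State (Fin n) := fun z =>
  if ∀ k : Fin n, (k : ℕ) < j → z k = false then
    ((Real.sqrt (mass μ j z / ∑ z', μ z') : ℝ) : ℂ) else 0

/-- One level of the binary tree: the squared cosine and sine of the angle are the fractions of the
block's mass in its two halves. -/
theorem onWire_rotation_partialState {μ : Bits n → ℝ} (hμ : ∀ z, 0 ≤ μ z) (j : Fin n) :
    onWire j (fun z => rotation (angle μ j z)) (partialState μ (j + 1)) = partialState μ j := by
  funext z
  have hT : partialState μ (j + 1) (Function.update z j true) = 0 := by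
    refine if_neg fun h => ?_
    simpa using h j (Nat.lt_succ_self _)
  have hc : (∀ k : Fin n, (k : ℕ) < j + 1 → Function.update z j false k = false) ↔
      ∀ k : Fin n, (k : ℕ) < j → z k = false := by
    constructor
    · intro h k hk
      have hkj : k ≠ j := by rintro rfl; omega
      simpa [hkj] using h k (by omega)
    · intro h k hk
      by_cases hkj : k = j
      · subst hkj; simp
      · rw [Function.update_of_ne hkj]
        have : (k : ℕ) ≠ j := fun e => hkj (Fin.ext e)
        exact h k (by omega)
  simp only [onWire, Fintype.sum_bool, hT, mul_zero, zero_add]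
  by_cases hz : ∀ k : Fin n, (k : ℕ) < j → z k = false
  · have hz' : ∀ k, k < j → z k = false := fun k hk => hz k hk
    simp only [partialState, if_pos (hc.2 hz), if_pos hz, mass_succ_update]
    have hm := mass_succ μ j z
    have h0 := mass_nonneg hμ j (Function.update z j false)
    have h1 := mass_nonneg hμ j (Function.update z j true)
    have hz2 : z = Function.update z j (z j) := by rw [Function.update_eq_self]
    set m0 := mass μ j (Function.update z j false) with hm0
    set m1 := mass μ j (Function.update z j true) with hm1
    have hS : 0 ≤ ∑ z', μ z' := Finset.sum_nonneg fun z' _ => hμ z'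
    -- With an empty upper half nothing has to move; this also covers blocks of mass zero, where the
    -- fractions are undefined.
    by_cases hne : m1 = 0
    · have ha : angle μ j z = 0 := if_neg fun h => h.2 hne
      rw [ha, rotation_zero, hm, hne, add_zero]
      cases hzj : z j
      · rw [hzj] at hz2
        rw [hz2, ← hm0]
        simp
      · rw [hzj] at hz2
        rw [hz2, ← hm1, hne]
        simp
    · have ha : angle μ j z = splitAngle μ j z := if_pos ⟨hz', hne⟩
      have hpos : 0 < m0 + m1 := by
        have := lt_of_le_of_ne h1 (Ne.symm hne)
        linarith
      have hq1 : m0 / (m0 + m1) ≤ 1 := by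
        rw [div_le_one hpos]
        linarith
      have hcos : Real.cos (splitAngle μ j z) = Real.sqrt (m0 / (m0 + m1)) := by
        rw [splitAngle, ← hm0, hm]
        refine Real.cos_arccos ?_ (Real.sqrt_le_one.2 hq1)
        linarith [Real.sqrt_nonneg (m0 / (m0 + m1))]
      have hsin : Real.sin (splitAngle μ j z) = Real.sqrt (m1 / (m0 + m1)) := by
        rw [splitAngle, ← hm0, hm, Real.sin_arccos, Real.sq_sqrt (by positivity)]
        congr 1
        field_simp
        ring
      rw [ha, hm]
      cases hzj : z j
      · rw [hzj] at hz2
        rw [rotation, planeMatrix, if_pos rfl, hcos, ← Complex.ofReal_mul,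
          ← Real.sqrt_mul (by positivity), div_mul_div_cancel₀ hpos.ne', hm0, ← hz2]
      · rw [hzj] at hz2
        rw [rotation, planeMatrix, if_neg (by simp), if_neg (by simp), hsin,
          ← Complex.ofReal_mul, ← Real.sqrt_mul (by positivity), div_mul_div_cancel₀ hpos.ne',
          hm1, ← hz2]
  · simp only [partialState, if_neg hz, if_neg (fun h => hz (hc.1 h)), mul_zero]

theorem partialState_top {μ : Bits n → ℝ} (hμ : ∑ z, μ z ≠ 0) :
    partialState μ n = basisState fun _ => false := by
  funext z
  have h : (∀ k : Fin n, (k : ℕ) < n → z k = false) ↔ z = fun _ => false :=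
    ⟨fun h => funext fun k => h k k.2, fun h k _ => by rw [h]⟩
  simp only [partialState, mass_top, div_self hμ, h, basisState, Real.sqrt_one,
    Complex.ofReal_one]
  congr

theorem ofBits_mono {z z' : Bits n} (h : ∀ k, z k = true → z' k = true) :
    Nat.ofBits z ≤ Nat.ofBits z' := by
  induction n with
  | zero => simp
  | succ n ih =>
    rw [Nat.ofBits_succ, Nat.ofBits_succ]
    have h1 := ih (z := z ∘ Fin.succ) (z' := z' ∘ Fin.succ) fun k hk => h k.succ hk
    have h2 : (z 0).toNat ≤ (z' 0).toNat := by
      cases h0 : z 0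
      · simp
      · rw [h 0 h0]
    omega

/-- The string `z` is bitwise below `z'`: it vanishes below `j`, `z'` is set at `j`, and they agree
above. -/
theorem ofBits_le_of_mem_block {j : Fin n} {z z' : Bits n} (hz : ∀ k, k < j → z k = false)
    (h : z' ∈ block j (Function.update z j true)) : Nat.ofBits z ≤ Nat.ofBits z' := by
  rw [mem_block_update, mem_block] at h
  refine ofBits_mono fun k hk => ?_
  rcases lt_trichotomy k j with hkj | hkj | hkj
  · rw [hz k hkj] at hk
    exact absurd hk (by simp)
  · rw [hkj]; exact h.1
  · rw [h.2 k hkj]; exact hk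

theorem ofBits_div_eq {m : ℕ} {z z' : Bits n} (h : z' ∈ block m z) :
    Nat.ofBits z' / 2 ^ m = Nat.ofBits z / 2 ^ m := by
  refine Nat.eq_of_testBit_eq fun i => ?_
  rw [Nat.testBit_div_two_pow, Nat.testBit_div_two_pow, Nat.testBit_ofBits, Nat.testBit_ofBits]
  split_ifs with hi
  · exact mem_block.1 h ⟨_, hi⟩ (by simp)
  · rfl

theorem mem_block_of_div_eq {m : ℕ} {z z' : Bits n}
    (h : Nat.ofBits z' / 2 ^ m = Nat.ofBits z / 2 ^ m) : z' ∈ block m z := by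
  rw [mem_block]
  intro k hk
  have h1 := congrArg (fun x => Nat.testBit x (k - m)) h
  simp only [Nat.testBit_div_two_pow] at h1
  rw [Nat.sub_add_cancel hk] at h1
  simpa using h1

end Blocks

/-! ### Realisation of the state preparation by gates -/

section Preparation

variable {N c : ℕ} (u : Fin N → ℝ≥0)

/-- The vector `u` as a function of the register contents. -/
def weight (z : Bits (idxLen N)) : ℝ := if h : Nat.ofBits z < N then u ⟨Nat.ofBits z, h⟩ else 0

theorem weight_nonneg (z : Bits (idxLen N)) : 0 ≤ weight u z := by
  unfold weight; split_ifs <;> simp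

theorem weight_encode (i : Fin N) : weight u (encode i) = u i := by
  have h : Nat.ofBits (encode i) < N := by rw [ofBits_encode]; exact i.2
  rw [weight, dif_pos h]
  congr 2
  exact Fin.ext (ofBits_encode i)

theorem sum_weight : ∑ z, weight u z = ∑ i, (u i : ℝ) := by
  symm
  refine Fintype.sum_of_injective encode encode_injective _ _ ?_ fun i => (weight_encode u i).symm
  intro z hz
  refine dif_neg fun h => hz ⟨_, encode_ofBits z h⟩

/-- A non-zero angle requires mass in the upper half of the block, hence an index below `N` that
dominates `z`. Contents to be rotated are therefore indices, and indicator gates can select them. -/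
theorem ofBits_lt_of_angle_ne_zero {j : Fin (idxLen N)} {z : Bits (idxLen N)}
    (h : angle (weight u) j z ≠ 0) : Nat.ofBits z < N := by
  have h' : (∀ k, k < j → z k = false) ∧
      mass (weight u) j (Function.update z j true) ≠ 0 := by
    by_contra hcon
    exact h (if_neg hcon)
  obtain ⟨z', hz', hne⟩ := Finset.exists_ne_zero_of_sum_ne_zero h'.2
  have : Nat.ofBits z' < N := by
    by_contra hcon
    exact hne (dif_neg hcon)
  exact (ofBits_le_of_mem_block h'.1 hz').trans_lt this

/-- The ancillary qubit. -/
abbrev flagWire : Wire (idxLen N) c 1 := .anc 0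

/-- The indices for which qubit `j` has to be rotated by the angle `t`. -/
def angleSet (j : Fin (idxLen N)) (t : ℝ) : Finset (Fin N) :=
  Finset.univ.filter fun i => angle (weight u) j (encode i) = t

/-- For `t = 0` this could fail, because contents that encode no index have angle zero. -/
theorem exists_mem_angleSet_iff {j : Fin (idxLen N)} {t : ℝ} (ht : t ≠ 0)
    (z : Bits (idxLen N)) :
    (∃ s ∈ angleSet u j t, z = encode s) ↔ angle (weight u) j z = t := by
  constructor
  · rintro ⟨s, hs, rfl⟩
    exact (Finset.mem_filter.1 hs).2
  · intro h
    have hz := ofBits_lt_of_angle_ne_zero u (by rw [h]; exact ht)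
    have e := encode_ofBits z hz
    exact ⟨⟨_, hz⟩, Finset.mem_filter.2 ⟨Finset.mem_univ _, by rw [e, h]⟩, e.symm⟩

/-- The indicator gate from `out` to the ancillary qubit. -/
def flagGate (S : Finset (Fin N)) : Gate N c (Wire (idxLen N) c 1) :=
  Gate.ind S outReg flagWire (fun _ e => by injection e)

/-- The rotation of qubit `j` of the register `out`. -/
def rotationGate (j : Fin (idxLen N)) (t : ℝ) : Gate N c (Wire (idxLen N) c 1) :=
  Gate.one ⟨rotation t, rotation_mem t⟩ (.out j)

/-- The rotation of qubit `j` of the register `out` unless the ancillary qubit is set. -/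
def controlledRotation (j : Fin (idxLen N)) (t : ℝ) : Circuit N c (Wire (idxLen N) c 1) :=
  [rotationGate j (t / 2), Gate.cnot flagWire (.out j) (by simp [flagWire]),
    rotationGate j (t / 2), Gate.cnot flagWire (.out j) (by simp [flagWire])]

theorem runOn_controlledRotation (val : Format c) (x : Fin N → Bits c) (j : Fin (idxLen N))
    (t : ℝ) (ψ : State (Wire (idxLen N) c 1)) :
    runOn val x (controlledRotation j t) ψ =
      onWire (.out j) (fun y => if y flagWire then 1 else rotation t) ψ := by
  simp only [controlledRotation, runOn_cons, runOn_nil, rotationGate, Gate.apply]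
  rw [onWire_onWire _ _ _ fun _ _ => rfl, onWire_onWire _ _ _ fun _ _ => rfl,
    onWire_onWire _ _ _ fun _ _ => rfl]
  congr 1
  funext y
  cases y flagWire
  · simp only [Bool.false_eq_true, if_false, one_mul, mul_one, rotation_mul, add_halves]
  · simp only [if_true, mul_assoc]
    have := pauliX_mul_rotation_mul (t / 2)
    rwa [mul_assoc] at this

/-- The rotation of qubit `j` of the register `out` by the angle `t` for the indices that require
this angle. -/
def angleCircuit (j : Fin (idxLen N)) (t : ℝ) : Circuit N c (Wire (idxLen N) c 1) :=
  [flagGate (angleSet u j t)] ++ controlledRotation j t ++ [flagGate (angleSet u j t)]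

theorem runOn_angleCircuit (val : Format c) (x : Fin N → Bits c) (j : Fin (idxLen N)) {t : ℝ}
    (ht : t ≠ 0) (φ : State (Fin (idxLen N))) :
    runOn val x (angleCircuit u j t) (embed c 1 φ) =
      embed c 1 (onWire j (fun z => if angle (weight u) j z = t then rotation t else 1) φ) := by
  set I : (Wire (idxLen N) c 1 → Bool) → Wire (idxLen N) c 1 → Bool :=
    indMap (angleSet u j t) outReg flagWire with hI
  have hII : ∀ y, I (I y) = y := indMap_indMap _ _ _ (fun _ e => by injection e)
  have hgate : ∀ ψ : State (Wire (idxLen N) c 1),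
      (flagGate (angleSet u j t)).apply val x ψ = fun y => ψ (I y) := fun ψ => apply_ind _ _ _ _ _ _ _
  have hout : ∀ y, I y (.out j) = y (.out j) := fun y =>
    Function.update_of_ne (by simp [flagWire]) _ _
  have hflag : ∀ y, I y flagWire =
      xor (y flagWire) (decide (¬ angle (weight u) j (y ∘ outReg) = t)) := by
    intro y
    simp only [hI, indMap, Function.update_self, exists_mem_angleSet_iff u ht]
  -- The flag does not depend on the rotated qubit, so the second indicator gate clears it.
  have hcomm : ∀ y b, I (Function.update y (.out j) b) = Function.update (I y) (.out j) b := by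
    intro y b
    have h1 : I y = Function.update y flagWire (I y flagWire) := by
      simp [hI, indMap]
    have h2 : I (Function.update y (.out j) b) = Function.update (Function.update y (.out j) b)
        flagWire (I (Function.update y (.out j) b) flagWire) := by
      simp [hI, indMap]
    rw [h2, hflag, update_out_comp, angle_update, Function.update_of_ne (by simp [flagWire]),
      ← hflag]
    conv_rhs => rw [h1]
    rw [Function.update_comm (by simp [flagWire])]
  have hrun : runOn val x (angleCircuit u j t) (embed c 1 φ) =
      onWire (.out j) (fun y => if I y flagWire then 1 else rotation t) (embed c 1 φ) := by
    rw [angleCircuit, runOn_append, runOn_append, runOn_cons, runOn_cons, runOn_nil, runOn_nil,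
      hgate, hgate, runOn_controlledRotation]
    funext y
    simp only [onWire, hout, hcomm, hII]
  rw [hrun]
  refine onWire_embed j _ _ (fun y hy => ?_) φ
  rw [hflag, hy.2.2.2 0, Bool.false_xor]
  by_cases h : angle (weight u) j (y ∘ outReg) = t <;> simp [h]

/-- The non-zero rotation angles of qubit `j`. -/
def angles (j : Fin (idxLen N)) : Finset ℝ :=
  (Finset.univ.image fun i : Fin N => angle (weight u) j (encode i)).erase 0

/-- All rotations of qubit `j` of the register `out`. -/
def levelCircuit (j : Fin (idxLen N)) : Circuit N c (Wire (idxLen N) c 1) :=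
  (angles u j).toList.flatMap (angleCircuit u j)

/-- Distinct angles concern disjoint sets of contents, and rotating qubit `j` does not lead from one
set to another; so at most one of the factors acts on each block. -/
theorem runOn_flatMap_angleCircuit (val : Format c) (x : Fin N → Bits c) (j : Fin (idxLen N))
    (l : List ℝ) (hl : l.Nodup) (h0 : ∀ t ∈ l, t ≠ 0) (φ : State (Fin (idxLen N))) :
    runOn val x (l.flatMap (angleCircuit u j)) (embed c 1 φ) =
      embed c 1 (onWire j (fun z => if angle (weight u) j z ∈ l then
        rotation (angle (weight u) j z) else 1) φ) := by
  induction l generalizing φ with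
  | nil => simp only [List.flatMap_nil, runOn_nil, List.not_mem_nil, if_false, onWire_one]
  | cons t l ih =>
    rw [List.flatMap_cons, runOn_append, runOn_angleCircuit u val x j (h0 t List.mem_cons_self),
      ih (List.nodup_cons.1 hl).2 fun t ht => h0 t (List.mem_cons_of_mem _ ht),
      onWire_onWire _ _ _ fun z b => by rw [angle_update]]
    congr 2
    funext z
    by_cases h1 : angle (weight u) j z = t
    · have h2 := (List.nodup_cons.1 hl).1
      simp [h1, h2]
    · simp [h1]

theorem runOn_levelCircuit (val : Format c) (x : Fin N → Bits c) (j : Fin (idxLen N))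
    (φ : State (Fin (idxLen N))) :
    runOn val x (levelCircuit u j) (embed c 1 φ) =
      embed c 1 (onWire j (fun z => rotation (angle (weight u) j z)) φ) := by
  rw [levelCircuit, runOn_flatMap_angleCircuit u val x j _ (Finset.nodup_toList (angles u j))
    fun t ht => Finset.ne_of_mem_erase (Finset.mem_toList.1 ht)]
  congr 2
  funext z
  by_cases h0 : angle (weight u) j z = 0
  · rw [h0, rotation_zero, ite_self]
  · refine if_pos (Finset.mem_toList.2 (Finset.mem_erase.2 ⟨h0, Finset.mem_image.2 ?_⟩))
    have hz := ofBits_lt_of_angle_ne_zero u h0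
    exact ⟨⟨_, hz⟩, Finset.mem_univ _, by rw [encode_ofBits z hz]⟩

/-- The rotations of the qubits `m - 1, …, 0` of the register `out`. -/
def prepCircuit : ℕ → Circuit N c (Wire (idxLen N) c 1)
  | 0 => []
  | m + 1 => (if h : m < idxLen N then levelCircuit u ⟨m, h⟩ else []) ++ prepCircuit m

theorem runOn_prepCircuit (val : Format c) (x : Fin N → Bits c) (m : ℕ) (hm : m ≤ idxLen N) :
    runOn val x (prepCircuit u m) (embed c 1 (partialState (weight u) m)) =
      embed c 1 (partialState (weight u) 0) := by
  induction m with
  | zero => rfl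
  | succ m ih =>
    have h : m < idxLen N := hm
    rw [prepCircuit, dif_pos h, runOn_append, runOn_levelCircuit]
    have hstep := onWire_rotation_partialState (weight_nonneg u) ⟨m, h⟩
    rw [hstep]
    exact ih h.le

theorem ket_false_eq_embed {a : ℕ} (φ : Fin N → ℂ) :
    ket c a φ false =
      embed c a fun z => if h : Nat.ofBits z < N then φ ⟨Nat.ofBits z, h⟩ else 0 := by
  have hb : ∀ i : Fin N, basis c a i false = place c a (encode i) := by
    intro i
    funext q
    cases q <;> rfl
  funext y
  have hsum : ket c a φ false y = ∑ i, φ i * if y = place c a (encode i) then 1 else 0 := by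
    simp only [ket, Finset.sum_apply, Pi.smul_apply, smul_eq_mul, basisState, hb]
    refine Finset.sum_congr rfl fun i _ => ?_
    congr
  rw [hsum]
  by_cases hy : Clean y
  · rw [embed_of_clean _ hy]
    have hiff : ∀ i : Fin N, y = place c a (encode i) ↔ Nat.ofBits (y ∘ outReg) = i := by
      intro i
      rw [← eq_encode_iff]
      constructor
      · intro e; rw [e, place_comp_out]
      · intro e; rw [hy.eq_place, e]
    simp only [hiff]
    by_cases h : Nat.ofBits (y ∘ outReg) < N
    · rw [dif_pos h, Finset.sum_eq_single ⟨_, h⟩]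
      · simp
      · intro i _ hi
        rw [if_neg (fun e => hi (Fin.ext e.symm)), mul_zero]
      · simp
    · rw [dif_neg h]
      refine Finset.sum_eq_zero fun i _ => ?_
      rw [if_neg (fun e : Nat.ofBits (y ∘ outReg) = i => h (e ▸ i.2)), mul_zero]
  · rw [embed_of_not_clean _ hy]
    refine Finset.sum_eq_zero fun i _ => ?_
    rw [if_neg (fun e : y = place c a (encode i) => hy (e ▸ place_clean _)), mul_zero]

theorem output_prepCircuit (val : Format c) (x : Fin N → Bits c) (hu : u ≠ 0) :
    output val x (prepCircuit u (idxLen N)) = ket c 1 (amplitudes u) false := by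
  have hne : ∑ z, weight u z ≠ 0 := by
    rw [sum_weight]
    intro h
    refine hu (funext fun i => ?_)
    have := (Finset.sum_eq_zero_iff_of_nonneg fun i _ => (u i).2).1 h i (Finset.mem_univ i)
    exact NNReal.coe_eq_zero.1 this
  rw [output_eq_runOn, basisState_zero_eq_embed, ← partialState_top hne,
    runOn_prepCircuit u val x _ le_rfl, ket_false_eq_embed]
  congr 1
  funext z
  rw [partialState, if_pos (fun k hk => absurd hk (Nat.not_lt_zero _)), mass_zero, sum_weight,
    weight]
  split_ifs with h
  · rfl
  · simp

theorem wires_of_mem_angleCircuit (j : Fin (idxLen N)) (t : ℝ)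
    (g : Gate N c (Wire (idxLen N) c 1)) (hg : g ∈ angleCircuit u j t) :
    g.isQuery = false ∧ ∀ q ∈ g.wires, (∃ j, q = Wire.out j) ∨ ∃ j, q = Wire.anc j := by
  simp only [angleCircuit, controlledRotation, List.mem_append, List.mem_cons, List.not_mem_nil,
    or_false] at hg
  rcases hg with (rfl | rfl | rfl | rfl | rfl) | rfl <;>
    refine ⟨rfl, fun q hq => ?_⟩ <;>
    simp only [flagGate, rotationGate, Gate.wires, Set.mem_union, Set.mem_range,
      Set.mem_singleton_iff, Set.mem_insert_iff] at hq
  · rcases hq with ⟨k, rfl⟩ | rfl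
    · exact Or.inl ⟨k, rfl⟩
    · exact Or.inr ⟨0, rfl⟩
  · exact Or.inl ⟨j, hq⟩
  · rcases hq with rfl | rfl
    · exact Or.inr ⟨0, rfl⟩
    · exact Or.inl ⟨j, rfl⟩
  · exact Or.inl ⟨j, hq⟩
  · rcases hq with rfl | rfl
    · exact Or.inr ⟨0, rfl⟩
    · exact Or.inl ⟨j, rfl⟩
  · rcases hq with ⟨k, rfl⟩ | rfl
    · exact Or.inl ⟨k, rfl⟩
    · exact Or.inr ⟨0, rfl⟩

theorem exists_mem_angleCircuit (m : ℕ) (g : Gate N c (Wire (idxLen N) c 1))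
    (hg : g ∈ prepCircuit u m) : ∃ j t, g ∈ angleCircuit u j t := by
  induction m with
  | zero => simp [prepCircuit] at hg
  | succ m ih =>
    rw [prepCircuit, List.mem_append] at hg
    rcases hg with hg | hg
    · split_ifs at hg with h
      · obtain ⟨t, -, ht⟩ := List.mem_flatMap.1 hg
        exact ⟨_, t, ht⟩
      · simp at hg
    · exact ih hg

theorem preparesStates_prepCircuit (val : Format c) :
    PreparesStates val fun u : Fin N → ℝ≥0 => prepCircuit (c := c) u (idxLen N) := by
  refine fun u hu => ⟨queryCount_eq_zero fun g hg => ?_, fun g hg => ?_, fun x =>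
    output_prepCircuit u val x hu⟩
  · obtain ⟨j, t, h⟩ := exists_mem_angleCircuit u _ g hg
    exact (wires_of_mem_angleCircuit u j t g h).1
  · obtain ⟨j, t, h⟩ := exists_mem_angleCircuit u _ g hg
    exact (wires_of_mem_angleCircuit u j t g h).2

/-! ### The number of gates for vectors that are constant outside a small set -/

/-- Flipping qubit `j` matches the two halves of the block, so a constant weight is split evenly. -/
theorem splitAngle_of_constant {j : Fin (idxLen N)} {z : Bits (idxLen N)} {h : ℝ}
    (hc : ∀ z' ∈ block (j + 1) z, weight u z' = h)
    (hne : mass (weight u) j (Function.update z j true) ≠ 0) :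
    splitAngle (weight u) j z = Real.arccos (Real.sqrt (1 / 2)) := by
  have hsum : mass (weight u) j (Function.update z j false) =
      mass (weight u) j (Function.update z j true) := by
    rw [mass, mass]
    refine Finset.sum_nbij' (fun z' => Function.update z' j true)
      (fun z' => Function.update z' j false) ?_ ?_ ?_ ?_ ?_
    · intro z' hz'
      rw [mem_block_update] at hz' ⊢
      refine ⟨by simp, mem_block.2 fun k hk => ?_⟩
      rw [Function.update_of_ne (by rintro rfl; omega)]
      exact mem_block.1 hz'.2 k hk
    · intro z' hz'
      rw [mem_block_update] at hz' ⊢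
      refine ⟨by simp, mem_block.2 fun k hk => ?_⟩
      rw [Function.update_of_ne (by rintro rfl; omega)]
      exact mem_block.1 hz'.2 k hk
    · intro z' hz'
      rw [mem_block_update] at hz'
      rw [Function.update_idem, ← hz'.1, Function.update_eq_self]
    · intro z' hz'
      rw [mem_block_update] at hz'
      rw [Function.update_idem, ← hz'.1, Function.update_eq_self]
    · intro z' hz'
      rw [mem_block_update] at hz'
      rw [hc z' hz'.2, hc]
      refine mem_block.2 fun k hk => ?_
      rw [Function.update_of_ne (by rintro rfl; omega)]
      exact mem_block.1 hz'.2 k hk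
  rw [splitAngle, mass_succ, hsum]
  congr 2
  field_simp
  norm_num

theorem splitAngle_congr {j : Fin (idxLen N)} {z z' : Bits (idxLen N)}
    (h : z' ∈ block (j + 1) z) : splitAngle (weight u) j z' = splitAngle (weight u) j z := by
  rw [mem_block] at h
  rw [splitAngle, splitAngle, mass, mass, mass, mass, block_congr h,
    block_congr (j := j) (z := Function.update z' j false) (z' := Function.update z j false)]
  intro k hk
  by_cases hkj : k = j
  · subst hkj; simp
  · rw [Function.update_of_ne hkj, Function.update_of_ne hkj]
    exact h k ((le_succ_iff_of_ne hkj).1 hk)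

/-- A block that avoids `H` and is not cut by the end of the index range is split evenly. Any other
block with a non-zero angle contains an element of `H` or the last index `N - 1`, which gives at
most `|H| + 1` further angles. -/
theorem card_angles_le {H : Finset (Fin N)} {h : ℝ≥0} (hu : ∀ i ∉ H, u i = h)
    (j : Fin (idxLen N)) : (angles u j).card ≤ H.card + 2 := by
  rcases Nat.eq_zero_or_pos N with hN | hN
  · subst hN
    have : angles u j = ∅ := by simp [angles]
    simp [this]
  let last : Fin N := ⟨N - 1, by omega⟩
  have hsub : angles u j ⊆ insert (Real.arccos (Real.sqrt (1 / 2)))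
      ((insert last H).image fun i => splitAngle (weight u) j (encode i)) := by
    intro t ht
    obtain ⟨ht0, ht⟩ := Finset.mem_erase.1 ht
    obtain ⟨i, -, rfl⟩ := Finset.mem_image.1 ht
    have hcond : (∀ k, k < j → encode i k = false) ∧
        mass (weight u) j (Function.update (encode i) j true) ≠ 0 := by
      by_contra hcon
      exact ht0 (if_neg hcon)
    have ha : angle (weight u) j (encode i) = splitAngle (weight u) j (encode i) := if_pos hcond
    rw [ha, Finset.mem_insert, Finset.mem_image]
    by_cases hex : ∃ e ∈ insert last H, encode e ∈ block (j + 1) (encode i)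
    · obtain ⟨e, he, hb⟩ := hex
      exact Or.inr ⟨e, he, splitAngle_congr u hb⟩
    · left
      push Not at hex
      refine splitAngle_of_constant u (h := h) (fun z' hz' => ?_) hcond.2
      have hd := ofBits_div_eq hz'
      -- Blocks are fibres of division by `2 ^ (j + 1)`, hence intervals. If `z' ≥ N` shared a block
      -- with `i`, then `N - 1` would lie in it as well.
      have hlt : Nat.ofBits z' < N := by
        by_contra hge
        refine hex last (Finset.mem_insert_self _ _) (mem_block_of_div_eq ?_)
        rw [ofBits_encode, ofBits_encode] at *
        have h1 : ((i : ℕ)) / 2 ^ ((j : ℕ) + 1) ≤ (N - 1) / 2 ^ ((j : ℕ) + 1) :=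
          Nat.div_le_div_right (by omega)
        have h2 : (N - 1) / 2 ^ ((j : ℕ) + 1) ≤ Nat.ofBits z' / 2 ^ ((j : ℕ) + 1) :=
          Nat.div_le_div_right (by omega)
        exact le_antisymm (h2.trans hd.le) h1
      have e := encode_ofBits z' hlt
      rw [← e, weight_encode, hu]
      intro hmem
      refine hex _ (Finset.mem_insert_of_mem hmem) ?_
      rw [e]
      exact hz'
  refine (Finset.card_le_card hsub).trans ((Finset.card_insert_le _ _).trans ?_)
  have h1 := Finset.card_image_le (s := insert last H)
    (f := fun i => splitAngle (weight u) j (encode i))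
  have h2 := Finset.card_insert_le last H
  omega

theorem length_levelCircuit (j : Fin (idxLen N)) :
    (levelCircuit (c := c) u j).length = 6 * (angles u j).card := by
  have : ∀ t, (angleCircuit (c := c) u j t).length = 6 := fun t => rfl
  rw [levelCircuit, List.length_flatMap]
  simp only [this, List.map_const', List.sum_replicate, Finset.length_toList, smul_eq_mul]
  ring

theorem length_prepCircuit_le {H : Finset (Fin N)} {h : ℝ≥0} (hu : ∀ i ∉ H, u i = h) (m : ℕ) :
    (prepCircuit (c := c) u m).length ≤ m * (6 * (H.card + 2)) := by
  induction m with
  | zero => simp [prepCircuit]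
  | succ m ih =>
    rw [prepCircuit, List.length_append, add_mul, one_mul, add_comm]
    refine Nat.add_le_add ih ?_
    split_ifs with hm
    · rw [length_levelCircuit]
      exact Nat.mul_le_mul_left 6 (card_angles_le u hu _)
    · simp

end Preparation

/-! ### The circuit output by the preprocessing phase -/

section Main

variable {N c a : ℕ}

theorem ket_apply (φ : Fin N → ℂ) (b : Bool) (y : Wire (idxLen N) c a → Bool) :
    ket c a φ b y = ∑ i, φ i * if y = basis c a i b then 1 else 0 := by
  simp only [ket, Finset.sum_apply, Pi.smul_apply, smul_eq_mul, basisState]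
  refine Finset.sum_congr rfl fun i _ => ?_
  congr

theorem eq_basis_iff (y : Wire (idxLen N) c a → Bool) (i : Fin N) (b : Bool) :
    y = basis c a i b ↔ y .rot = b ∧ Function.update y .rot false = basis c a i false := by
  constructor
  · rintro rfl
    refine ⟨rfl, ?_⟩
    funext q
    cases q <;> simp [basis]
  · rintro ⟨rfl, h⟩
    funext q
    have := congrFun h q
    cases q with
    | rot => rfl
    | _ => simpa [basis] using this

/-- The indicator and query permutations neither read nor change `rot`. Conjugating the controlled
rotation by them only changes the data that control it. -/
theorem runOn_stages (val : Format c) (x : Fin N → Bits c) (H : Finset (Fin N)) (h : ℝ≥0)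
    (D : Circuit N c (Wire (idxLen N) c a)) :
    output val x (mainCircuit D H h) =
      onWire .rot (fun y => if queryPerm x (indPerm H y) .ind then
        rotMatrix h (val (queryPerm x (indPerm H y) ∘ qryReg)) else 1) (output val x D) := by
  have hcomm : ∀ (y : Wire (idxLen N) c a → Bool) (b : Bool),
      Function.update (queryPerm x (indPerm H y)) .rot b =
        queryPerm x (indPerm H (Function.update y .rot b)) := by
    intro y b
    have hout : Function.update y .rot b ∘ (outReg : _ ↪ Wire (idxLen N) c a) = y ∘ outReg :=
      update_comp_of_ne y _ _ _ fun k e => by injection e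
    funext q
    cases q with
    | rot =>
      rw [Function.update_self, queryPerm_of_ne x _ (by simp), indPerm_of_ne H _ (by simp),
        Function.update_self]
    | ind =>
      rw [Function.update_of_ne (by simp), queryPerm_of_ne x _ (by simp),
        queryPerm_of_ne x _ (by simp), indPerm_ind, indPerm_ind, hout,
        Function.update_of_ne (by simp)]
    | qry j =>
      rw [Function.update_of_ne (by simp), queryPerm_qry, queryPerm_qry, indPerm_comp_out,
        indPerm_comp_out, hout, indPerm_of_ne H _ (by simp), indPerm_of_ne H _ (by simp),
        Function.update_of_ne (by simp)]
    | out j =>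
      rw [Function.update_of_ne (by simp), queryPerm_of_ne x _ (by simp),
        queryPerm_of_ne x _ (by simp), indPerm_of_ne H _ (by simp), indPerm_of_ne H _ (by simp),
        Function.update_of_ne (by simp)]
    | anc j =>
      rw [Function.update_of_ne (by simp), queryPerm_of_ne x _ (by simp),
        queryPerm_of_ne x _ (by simp), indPerm_of_ne H _ (by simp), indPerm_of_ne H _ (by simp),
        Function.update_of_ne (by simp)]
  change runOn val x (D ++ [indGate H, queryGate, Gate.crot h .ind .rot qryReg _ _ _, queryGate,
    indGate H]) _ = _
  rw [runOn_append, runOn_cons, runOn_cons, runOn_cons, runOn_cons, runOn_cons, runOn_nil,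
    apply_indGate, apply_indGate, apply_queryGate, apply_queryGate]
  funext y
  simp only [Gate.apply, onWire, hcomm, queryPerm_queryPerm, indPerm_indPerm]
  have hrot : queryPerm x (indPerm H y) Wire.rot = y Wire.rot := by
    rw [queryPerm_of_ne x _ (by simp), indPerm_of_ne H _ (by simp)]
  rw [hrot]
  rfl

/-- The factor between the amplitudes for `i` before and after the last five gates. -/
theorem onWire_rot_ket (val : Format c) (x : Fin N → Bits c) (H : Finset (Fin N)) (h : ℝ≥0)
    (α β γ : Fin N → ℂ)
    (hβ : ∀ i, (if i ∈ H then 1 else rotMatrix h (vec val x i)) false false * α i = β i)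
    (hγ : ∀ i, (if i ∈ H then 1 else rotMatrix h (vec val x i)) true false * α i = γ i) :
    onWire .rot (fun y => if queryPerm x (indPerm H y) .ind then
        rotMatrix h (val (queryPerm x (indPerm H y) ∘ qryReg)) else 1) (ket c a α false) =
      ket c a β false + ket c a γ true := by
  funext y
  have hT : ket c a α false (Function.update y .rot true) = 0 := by
    rw [ket_apply]
    refine Finset.sum_eq_zero fun i _ => ?_
    rw [if_neg, mul_zero]
    intro e
    have := congrFun e .rot
    simp [basis] at this
  rw [Pi.add_apply, ket_apply β, ket_apply γ, onWire, Fintype.sum_bool, hT, mul_zero, zero_add,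
    ket_apply, Finset.mul_sum, ← Finset.sum_add_distrib]
  refine Finset.sum_congr rfl fun i _ => ?_
  simp only [eq_basis_iff y]
  by_cases hy : Function.update y .rot false = basis c a i false
  · have hq : ∀ q, q ≠ Wire.rot → y q = basis c a i false q := fun q hq => by
      rw [← hy, Function.update_of_ne hq]
    have hout : y ∘ (outReg : _ ↪ Wire (idxLen N) c a) = encode i := by
      funext j
      exact hq _ (by simp [outReg_apply])
    have hind : queryPerm x (indPerm H y) .ind = decide (i ∉ H) := by
      rw [queryPerm_of_ne x _ (by simp), indPerm_ind, hout, hq .ind (by simp)]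
      simp only [basis, Bool.false_xor]
      congr 1
      simp only [eq_iff_iff, not_iff_not]
      exact ⟨fun ⟨s, hs, e⟩ => encode_injective e ▸ hs, fun hi => ⟨i, hi, rfl⟩⟩
    have hqry : queryPerm x (indPerm H y) ∘ (qryReg : _ ↪ Wire (idxLen N) c a) = x i := by
      funext j
      simp only [Function.comp_apply, qryReg_apply]
      rw [queryPerm_qry, indPerm_comp_out, hout, entryAt_encode, indPerm_of_ne H _ (by simp),
        hq (.qry j) (by simp)]
      simp [basis]
    rw [hind, hqry, hy]
    have hM : (if decide (i ∉ H) = true then rotMatrix h (val (x i)) else 1) =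
        if i ∈ H then 1 else rotMatrix h (vec val x i) := by
      by_cases hi : i ∈ H <;> simp [hi, vec]
    rw [hM, if_pos rfl, mul_one]
    cases y .rot
    · simpa using hβ i
    · simpa using hγ i
  · simp only [hy, and_false, if_false, mul_zero, add_zero]

theorem card_mul_minOn_le (w : Fin N → ℝ≥0) (H : Finset (Fin N)) :
    H.card * (minOn w H : ℝ) ≤ ∑ i ∈ H, (w i : ℝ) := by
  rw [← nsmul_eq_mul]
  exact Finset.card_nsmul_le_sum _ _ _ fun i hi => by exact_mod_cast minOn_le w hi

theorem sum_subset_le (w : Fin N → ℝ≥0) (H : Finset (Fin N)) :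
    ∑ i ∈ H, (w i : ℝ) ≤ ∑ i, (w i : ℝ) :=
  Finset.sum_le_sum_of_subset_of_nonneg (Finset.subset_univ _) fun i _ _ => (w i).2

theorem sum_flatten (w : Fin N → ℝ≥0) (H : Finset (Fin N)) :
    ∑ i, (flatten w H i : ℝ) = ∑ i ∈ H, (w i : ℝ) + (N - H.card) * (minOn w H : ℝ) := by
  rw [← Finset.sum_add_sum_compl H]
  congr 1
  · exact Finset.sum_congr rfl fun i hi => by rw [flatten, if_pos hi]
  · have h : ∀ i ∈ Hᶜ, (flatten w H i : ℝ) = minOn w H := fun i hi => by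
      rw [flatten, if_neg (Finset.mem_compl.1 hi)]
    rw [Finset.sum_congr rfl h, Finset.sum_const, nsmul_eq_mul, Finset.card_compl,
      Fintype.card_fin, Nat.cast_sub ((Finset.card_le_univ H).trans_eq (Fintype.card_fin N))]

theorem le_flatten {w : Fin N → ℝ≥0} {K : ℕ} (hK : 0 < K) {H : Finset (Fin N)}
    (hH : IsTop K w H) (i : Fin N) : w i ≤ flatten w H i := by
  rw [flatten]
  split_ifs with hi
  · exact le_rfl
  · exact le_minOn w (Finset.card_pos.1 (hH.1 ▸ hK)) fun k hk => hH.2 k hk i hi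

theorem preparesTarget_mainCircuit (val : Format c) (x : Fin N → Bits c) {K : ℕ} (hK : 0 < K)
    {H : Finset (Fin N)} (hH : IsTop K (vec val x) H) (hw : vec val x ≠ 0)
    (D : Circuit N c (Wire (idxLen N) c a))
    (hD : output val x D = ket c a (amplitudes (flatten (vec val x) H)) false) :
    PreparesTarget val K x (mainCircuit D H (minOn (vec val x) H)) := by
  set w := vec val x with hw_def
  set S : ℝ := ∑ i, (w i : ℝ) with hS
  set Z : ℝ := ∑ i, (flatten w H i : ℝ) with hZ
  have hle : ∀ i, (w i : ℝ) ≤ flatten w H i := fun i => by exact_mod_cast le_flatten hK hH i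
  have hSpos : 0 < S := by
    refine lt_of_le_of_ne (Finset.sum_nonneg fun i _ => (w i).2) fun h => hw (funext fun i => ?_)
    exact NNReal.coe_eq_zero.1
      ((Finset.sum_eq_zero_iff_of_nonneg fun i _ => (w i).2).1 h.symm i (Finset.mem_univ i))
  have hSZ : S ≤ Z := Finset.sum_le_sum fun i _ => hle i
  have hZpos : 0 < Z := hSpos.trans_le hSZ
  have hp1 : S / Z ≤ 1 := (div_le_one hZpos).2 hSZ
  have hKN : (K : ℝ) / N ≤ S / Z := by
    have hKN' : K ≤ N := by
      rw [← hH.1]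
      exact (Finset.card_le_univ H).trans_eq (Fintype.card_fin N)
    have hN : (0 : ℝ) < N := by exact_mod_cast hK.trans_le hKN'
    have h1 := card_mul_minOn_le w H
    have h2 := sum_subset_le w H
    rw [← hS] at h2
    have h3 : Z = _ := sum_flatten w H
    rw [hH.1] at h1 h3
    rw [div_le_div_iff₀ hN hZpos, h3]
    have h4 : (0 : ℝ) ≤ N - K := sub_nonneg.2 (by exact_mod_cast hKN')
    -- The chain is `K Z = K ∑_H w + (N - K) K h ≤ N ∑_H w ≤ N S`.
    nlinarith [mul_le_mul_of_nonneg_left h1 h4, mul_le_mul_of_nonneg_left h2 hN.le]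
  have hβ : ∀ i, (if i ∈ H then 1 else rotMatrix (minOn w H) (w i)) false false *
      amplitudes (flatten w H) i = ((Real.sqrt (S / Z) : ℝ) : ℂ) * amplitudes w i := by
    intro i
    have h1 : ((Real.sqrt (S / Z) : ℝ) : ℂ) * amplitudes w i =
        ((Real.sqrt (w i / Z) : ℝ) : ℂ) := by
      rw [amplitudes, ← Complex.ofReal_mul, ← Real.sqrt_mul (by positivity), ← hS]
      congr 2
      field_simp
    rw [h1, amplitudes, ← hZ]
    by_cases hi : i ∈ H
    · rw [if_pos hi, Matrix.one_apply_eq, one_mul, flatten, if_pos hi]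
    · have hli := le_flatten hK hH i
      rw [flatten, if_neg hi] at hli
      rw [if_neg hi, flatten, if_neg hi]
      by_cases h0 : 0 < minOn w H ∧ w i ≤ minOn w H
      · have hpos : (0 : ℝ) < minOn w H := by exact_mod_cast h0.1
        rw [rotMatrix_of_pos h0, planeMatrix, if_pos rfl, ← Complex.ofReal_mul,
          ← Real.sqrt_mul (by positivity)]
        congr 2
        field_simp
      · have h00 : minOn w H = 0 := by
          by_contra hne
          exact h0 ⟨pos_iff_ne_zero.2 hne, hli⟩
        rw [h00, nonpos_iff_eq_zero] at hli
        rw [h00, hli]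
        simp
  have hγ : ∀ i, (if i ∈ H then 1 else rotMatrix (minOn w H) (w i)) true false *
      amplitudes (flatten w H) i = ((Real.sqrt ((flatten w H i - w i) / Z) : ℝ) : ℂ) := by
    intro i
    rw [amplitudes, ← hZ]
    by_cases hi : i ∈ H
    · rw [if_pos hi, flatten, if_pos hi]
      simp
    · have hli := le_flatten hK hH i
      rw [flatten, if_neg hi] at hli
      rw [if_neg hi, flatten, if_neg hi]
      by_cases h0 : 0 < minOn w H ∧ w i ≤ minOn w H
      · have hpos : (0 : ℝ) < minOn w H := by exact_mod_cast h0.1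
        rw [rotMatrix_of_pos h0, planeMatrix, if_neg (by simp), if_neg (by simp),
          ← Complex.ofReal_mul, ← Real.sqrt_mul']
        · congr 2
          field_simp
        · positivity
      · have h00 : minOn w H = 0 := by
          by_contra hne
          exact h0 ⟨pos_iff_ne_zero.2 hne, hli⟩
        rw [h00, nonpos_iff_eq_zero] at hli
        rw [h00, hli]
        simp
  have hout := (runOn_stages val x H (minOn w H) D).trans
    ((congrArg _ hD).trans (onWire_rot_ket val x H (minOn w H) _ _ _ hβ hγ))
  have hsmul : ∀ (r : ℂ) (φ : Fin N → ℂ) (b : Bool), ket c a (fun i => r * φ i) b =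
      r • ket c a φ b := by
    intro r φ b
    rw [ket, ket, Finset.smul_sum]
    exact Finset.sum_congr rfl fun i _ => mul_smul _ _ _
  rw [hsmul] at hout
  have hdiff : ∑ i, ((flatten w H i : ℝ) - w i) = Z - S := Finset.sum_sub_distrib _ _
  have h1p : 1 - S / Z = (Z - S) / Z := by field_simp
  rcases eq_or_lt_of_le hSZ with heq | hlt
  · have hN : 0 < N := by
      rw [← Fintype.card_fin N, ← Finset.card_univ]
      exact (hH.1 ▸ hK).trans_le (Finset.card_le_univ H)
    -- For `p = 1` the second component has coefficient zero, and any unit vector serves.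
    refine ⟨S / Z, Pi.single ⟨0, hN⟩ 1, hKN, hp1, ?_, ?_⟩
    · rw [Finset.sum_eq_single ⟨0, hN⟩]
      · simp
      · intro i _ hi
        simp [hi]
      · simp
    · have hzero : ∀ i, (flatten w H i : ℝ) - w i = 0 := fun i =>
        (Finset.sum_eq_zero_iff_of_nonneg fun i _ => sub_nonneg.2 (hle i)).1
          (hdiff.trans (by rw [heq, sub_self])) i (Finset.mem_univ i)
      rw [hout, h1p, heq, sub_self]
      simp only [hzero, zero_div, Real.sqrt_zero, Complex.ofReal_zero, zero_smul]
      congr 1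
      exact Finset.sum_eq_zero fun i _ => zero_smul _ _
  · have hpos : 0 < Z - S := sub_pos.2 hlt
    refine ⟨S / Z, fun i => ((Real.sqrt ((flatten w H i - w i) / (Z - S)) : ℝ) : ℂ), hKN, hp1,
      ?_, ?_⟩
    · have : ∀ i, ‖((Real.sqrt ((flatten w H i - w i) / (Z - S)) : ℝ) : ℂ)‖ ^ 2 =
          (flatten w H i - w i) / (Z - S) := by
        intro i
        rw [Complex.norm_real, Real.norm_eq_abs, sq_abs,
          Real.sq_sqrt (div_nonneg (sub_nonneg.2 (hle i)) hpos.le)]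
      simp only [this]
      rw [← Finset.sum_div, hdiff, div_self hpos.ne']
    · rw [hout, ← hsmul _ _ true]
      congr 2
      funext i
      rw [← Complex.ofReal_mul, ← Real.sqrt_mul (by rw [h1p]; positivity), h1p]
      congr 2
      field_simp

end Main

/-! ### The preprocessing phase -/

section Preprocessing

variable {N c a K : ℕ} (val : Format c)

/-- Once `H` is found, the rest is deterministic. The unread entries are stored as default strings,
but the circuit depends on the values on `H` only. -/
theorem prob_preprocessing_ge {δ : ℝ} {topK : Algo N c (Finset (Fin N))}
    (hT : FindsTop val K δ topK)
    (prep : (Fin N → ℝ≥0) → Circuit N c (Wire (idxLen N) c a)) (x : Fin N → Bits c)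
    (P : Circuit N c (Wire (idxLen N) c a) → Prop)
    (hP : ∀ H, IsTop K (vec val x) H →
      P (mainCircuit (prep (flatten (vec val x) H)) H (minOn (vec val x) H))) :
    1 - δ ≤ (preprocessing val topK prep).prob val x P := by
  classical
  refine (hT x).trans ?_
  rw [Algo.prob_eq_expect, Algo.prob_eq_expect, preprocessing, Algo.expect_bind]
  refine Algo.expect_mono val x (fun H => ?_) topK
  split_ifs with hH
  · rw [Algo.expect_bind, Algo.expect_readList, Algo.expect]
    have hr : ∀ i ∈ H, vec val (fun i => if i ∈ H.toList then x i else fun _ => false) i =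
        vec val x i := by
      intro i hi
      simp [vec, hi]
    have hmin := minOn_congr (vec val fun i => if i ∈ H.toList then x i else fun _ => false) hr
    have hflat : flatten (vec val fun i => if i ∈ H.toList then x i else fun _ => false) H =
        flatten (vec val x) H := by
      funext i
      rw [flatten, flatten, hmin]
      split_ifs with hi
      · exact hr i hi
      · rfl
    rw [hflat, hmin, if_pos (hP H hH)]
  · refine (Algo.expect_const val x 0 _).ge.trans (Algo.expect_mono val x (fun C => ?_) _)
    split_ifs <;> norm_num

theorem costLE_preprocessing {q : ℕ} {topK : Algo N c (Finset (Fin N))}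
    (hT : Algo.CostLE (gateFactor N c) q topK) (hK : Algo.AllRet (fun H => H.card ≤ K) topK)
    (prep : (Fin N → ℝ≥0) → Circuit N c (Wire (idxLen N) c a)) :
    Algo.CostLE (gateFactor N c) (q + K) (preprocessing val topK prep) := by
  refine Algo.costLE_bind_of hK hT _ fun H hH => ?_
  exact Algo.costLE_bind (q' := 0) ((costLE_readList_gateFactor H).mono hH) _
    fun r => Algo.costLE_ret _ _ _

theorem queryCount_mainCircuit {D : Circuit N c (Wire (idxLen N) c a)} (hD : queryCount D = 0)
    (H : Finset (Fin N)) (h : ℝ≥0) : queryCount (mainCircuit D H h) = 2 := by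
  rw [mainCircuit, queryCount_append, hD]
  rfl

theorem idxLen_le (hN : 0 < N) : (idxLen N : ℝ) ≤ 2 * (1 + Real.log N) := by
  have h : ((2 ^ idxLen N : ℕ) : ℝ) ≤ ((2 * N : ℕ) : ℝ) := by
    exact_mod_cast two_pow_idxLen_le hN
  have hN' : (0 : ℝ) < N := by exact_mod_cast hN
  have h1 := Real.log_le_log (by positivity) h
  rw [Nat.cast_pow, Real.log_pow, Nat.cast_mul, Real.log_mul (by norm_num) hN'.ne'] at h1
  have h2 : (0.69 : ℝ) ≤ Real.log 2 := by linarith [Real.log_two_gt_d9]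
  have h3 : 0 ≤ Real.log N := Real.log_natCast_nonneg N
  have h4 : (0 : ℝ) ≤ idxLen N := Nat.cast_nonneg _
  push_cast at h1
  have h5 : Real.log 2 ≤ 0.7 := by linarith [Real.log_two_lt_d9]
  nlinarith

/-- At most `2 (1 + log N)` levels with at most `6 (K + 2) ≤ 18 K` gates each, and five final gates:
`41 = 36 + 5`. -/
theorem length_mainCircuit_le (hK : 0 < K) (hKN : K ≤ N) (w : Fin N → ℝ≥0)
    {H : Finset (Fin N)} (hH : H.card = K) :
    ((mainCircuit (prepCircuit (c := c) (flatten w H) (idxLen N)) H (minOn w H)).length : ℝ) ≤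
      41 * (K * (1 + Real.log N)) := by
  have h1 := length_prepCircuit_le (c := c) (flatten w H) (H := H) (h := minOn w H)
    (fun i hi => if_neg hi) (idxLen N)
  have h2 : (mainCircuit (prepCircuit (c := c) (flatten w H) (idxLen N)) H (minOn w H)).length =
      (prepCircuit (c := c) (flatten w H) (idxLen N)).length + 5 := by
    rw [mainCircuit, List.length_append]
    rfl
  rw [hH] at h1
  have h3 : ((prepCircuit (c := c) (flatten w H) (idxLen N)).length : ℝ) ≤
      idxLen N * (6 * (K + 2)) := by exact_mod_cast h1
  have h4 := idxLen_le (hK.trans_le hKN)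
  have hK1 : (1 : ℝ) ≤ K := by exact_mod_cast hK
  have h5 : 0 ≤ Real.log N := Real.log_natCast_nonneg N
  have h6 : (idxLen N : ℝ) * (6 * (K + 2)) ≤ 2 * (1 + Real.log N) * (18 * K) :=
    mul_le_mul h4 (by linarith) (by positivity) (by positivity)
  rw [h2]
  push_cast
  nlinarith

/-- The factor `2` suffices because `2 log 2 ≥ 1`. -/
theorem half_pow_le {δ : ℝ} (hδ : 0 < δ) {n : ℕ} (hn : 2 * Real.log (1 / δ) ≤ n) :
    (1 / 2 : ℝ) ^ n ≤ δ := by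
  rw [← Real.log_le_log_iff (by positivity) hδ, Real.log_pow, one_div, Real.log_inv]
  rw [one_div, Real.log_inv] at hn
  have h2 : (0.69 : ℝ) ≤ Real.log 2 := by linarith [Real.log_two_gt_d9]
  have h3 : (0 : ℝ) ≤ n := Nat.cast_nonneg _
  nlinarith

/-- The two readings of `K` entries cost at most `2 √(K N)` since `K ≤ N`. As `√(K N) ≥ 1`, rounding
up the budget replaces `3120` by `3121`. -/
theorem total_queries_le (hK : 0 < K) (hKN : K ≤ N) {δ : ℝ} (hδ : 0 < δ) (hδ1 : δ < 1) :
    (((K + ⌈2 * Real.log (1 / δ)⌉₊ * ⌈3120 * Real.sqrt (K * N)⌉₊) + K : ℕ) : ℝ) ≤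
      6300 * (Real.sqrt (K * N) * (1 + Real.log (1 / δ))) := by
  have hlog : 0 ≤ Real.log (1 / δ) := Real.log_nonneg (by rw [le_div_iff₀ hδ]; linarith)
  have hK1 : (1 : ℝ) ≤ K := by exact_mod_cast hK
  have hKN' : (K : ℝ) ≤ N := by exact_mod_cast hKN
  have hKs : (K : ℝ) ≤ Real.sqrt (K * N) := Real.le_sqrt_of_sq_le (by nlinarith)
  have h1 := (Nat.ceil_lt_add_one (a := 2 * Real.log (1 / δ)) (by positivity)).le
  have h2 := (Nat.ceil_lt_add_one (a := 3120 * Real.sqrt (K * N)) (by positivity)).le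
  have h3 : (⌈2 * Real.log (1 / δ)⌉₊ : ℝ) * ⌈3120 * Real.sqrt (K * N)⌉₊ ≤
      (2 * Real.log (1 / δ) + 1) * (3121 * Real.sqrt (K * N)) :=
    mul_le_mul h1 (by linarith) (Nat.cast_nonneg _) (by positivity)
  have h4 : 0 ≤ Real.log (1 / δ) * Real.sqrt (K * N) := by positivity
  push_cast
  nlinarith

theorem gateFactor_le (hN : 0 < N) (c : ℕ) :
    (gateFactor N c : ℝ) ≤ (oracleSize c + 12) * (1 + Real.log N) := by
  have h1 := idxLen_le hN
  have h2 : 0 ≤ Real.log N := Real.log_natCast_nonneg N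
  have h3 : (0 : ℝ) ≤ oracleSize c := Nat.cast_nonneg _
  unfold gateFactor
  push_cast
  nlinarith

end Preprocessing

end StatePrep

end

/-! ### Assembly of the preprocessing theorem -/

theorem theorem2 :
    ∃ (Cq Cg : ℝ) (d : ℕ), ∀ c : ℕ, ∃ B : ℝ,
      ∀ (val : StatePrep.Format c) (N K : ℕ) (δ : ℝ), 1 ≤ K → K ≤ N → 0 < δ → δ < 1 →
        ∃ (a : ℕ) (topK : StatePrep.Algo N c (Finset (Fin N)))
          (prep : (Fin N → NNReal) →
            StatePrep.Circuit N c (StatePrep.Wire (StatePrep.idxLen N) c a)),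
          StatePrep.FindsTop val K δ topK ∧
          StatePrep.PreparesStates val prep ∧
          ((StatePrep.preprocessing val topK prep).queries : ℝ) ≤
            Cq * (Real.sqrt (K * N) * (1 + Real.log (1 / δ))) ∧
          ((StatePrep.preprocessing val topK prep).gates : ℝ) ≤
            B * (1 + Real.log N) ^ d * (Real.sqrt (K * N) * (1 + Real.log (1 / δ))) ∧
          ∀ x : Fin N → StatePrep.Bits c, StatePrep.vec val x ≠ 0 →
            (∀ H : Finset (Fin N), StatePrep.IsTop K (StatePrep.vec val x) H →
              (StatePrep.minOn (StatePrep.vec val x) H : ℝ) ≤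
                (∑ i, (StatePrep.vec val x i : ℝ)) / K) ∧
            1 - δ ≤ (StatePrep.preprocessing val topK prep).prob val x (fun C =>
              StatePrep.PreparesTarget val K x C ∧
              StatePrep.queryCount C = 2 ∧
              (C.length : ℝ) ≤ Cg * (K * (1 + Real.log N))) := by
  -- Only the gate bound depends on `c`, through the size of the sign circuit; one factor `1 + log
  -- N` covers the gates per query.
  refine ⟨6300, 41, 1, fun c => ⟨(StatePrep.oracleSize c + 12) * 6300, ?_⟩⟩
  intro val N K δ hK hKN hδ hδ1
  obtain ⟨H₀, -, hH₀⟩ := Finset.exists_subset_card_eq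
    (s := (Finset.univ : Finset (Fin N))) (n := K) (by simpa using hKN)
  set n := ⌈2 * Real.log (1 / δ)⌉₊ with hn
  set b := ⌈3120 * Real.sqrt (K * N)⌉₊ with hb
  have hfind : StatePrep.FindsTop val K δ (StatePrep.findTop val b n K H₀) :=
    StatePrep.findsTop_findTop hK b n (Nat.le_ceil _) (StatePrep.half_pow_le hδ (Nat.le_ceil _))
      hH₀
  have hprep := StatePrep.preparesStates_prepCircuit (N := N) val
  have hcost := StatePrep.costLE_preprocessing val (StatePrep.costLE_findTop b n K H₀)
    (StatePrep.allRet_findTop (val := val) b n K H₀)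
    (fun u => StatePrep.prepCircuit u (StatePrep.idxLen N))
  rw [hH₀] at hcost
  have htotal := StatePrep.total_queries_le hK hKN hδ hδ1
  rw [← hn, ← hb] at htotal
  refine ⟨1, StatePrep.findTop val b n K H₀,
    fun u => StatePrep.prepCircuit u (StatePrep.idxLen N), hfind, hprep, ?_, ?_, ?_⟩
  · exact (Nat.cast_le.2 hcost.1).trans htotal
  · refine (Nat.cast_le.2 hcost.2).trans ?_
    have hg := StatePrep.gateFactor_le (hK.trans hKN) c
    have := mul_le_mul hg htotal (Nat.cast_nonneg _) (le_trans (Nat.cast_nonneg _) hg)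
    rw [Nat.cast_mul, pow_one]
    linarith
  · intro x hw
    refine ⟨fun H hH => ?_, ?_⟩
    · have h1 := StatePrep.card_mul_minOn_le (StatePrep.vec val x) H
      rw [hH.1] at h1
      rw [le_div_iff₀ (by exact_mod_cast hK), mul_comm]
      exact h1.trans (StatePrep.sum_subset_le _ H)
    · refine StatePrep.prob_preprocessing_ge val hfind _ x _ fun H hH => ?_
      -- The flattened vector dominates `w`, so it is non-zero and can be prepared.
      have hne : StatePrep.flatten (StatePrep.vec val x) H ≠ 0 := fun h => hw (funext fun i => by
        have h1 := StatePrep.le_flatten hK hH i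
        rw [h] at h1
        exact nonpos_iff_eq_zero.1 h1)
      obtain ⟨h0, -, hout⟩ := hprep _ hne
      exact ⟨StatePrep.preparesTarget_mainCircuit val x hK hH hw _ (hout x),
        StatePrep.queryCount_mainCircuit h0 H _,
        StatePrep.length_mainCircuit_le hK hKN _ hH.1⟩
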